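/- Varieties are integral separated schemes of finite type over $\mathbb{C}$. Let $S$ be either the point $\operatorname{Spec}\mathbb{C}$ or a smooth curve over $\mathbb{C}$, let $q:\mathcal{W}\to S$ be a smooth dominant morphism of varieties, and let $i:\mathcal{X}\hookrightarrow\mathcal{W}$ be a closed subvariety of codimension $1$ that is flat over $S$. Let $T^\vee(\mathcal{W}/S)=\operatorname{Spec}_{\mathcal{W}}\operatorname{Sym}T_{\mathcal{W}/S}$ be the relative cotangent bundle and $\pi:\mathbb{P}T^\vee(\mathcal{W}/S)=\operatorname{Proj}_{\mathcal{W}}\operatorname{Sym}T_{\mathcal{W}/S}\to\mathcal{W}$ the bundle of lines in it. Let $\operatorname{Sm}(\mathcal{X}/S)\subset\mathcal{X}$ be the open locus where $\mathcal{X}\to S$ is smooth. The relative conormal variety is the closure $$\Lambda_{\mathcal{X}/S}=\overline{\{(x,\xi)\in T^\vee(\mathcal{W}/S)\;|\;x\in\operatorname{Sm}(\mathcal{X}/S),\ \xi\perp T_x\mathcal{X}_{q(x)}\}}\subset T^\vee(\mathcal{W}/S),$$ and $\mathbb{P}\Lambda_{\mathcal{X}/S}\subset\mathbb{P}T^\vee(\mathcal{W}/S)$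 is the image of $\Lambda_{\mathcal{X}/S}$ minus the zero section, with its reduced closed subscheme structure. The relative singular scheme $\operatorname{Sing}(\mathcal{X}/S)\subset\mathcal{X}$ is the closed subscheme given locally by $V(F,\partial_1F,\dots,\partial_nF)$, where $F$ is a local equation of $\mathcal{X}$ in $\mathcal{W}$ and $\partial_1,\dots,\partial_n$ generate the relative tangent sheaf $T_{\mathcal{W}/S}$. Then the restriction of $\pi$ to $\mathbb{P}\Lambda_{\mathcal{X}/S}$ factors through a morphism $p:\mathbb{P}\Lambda_{\mathcal{X}/S}\to\mathcal{X}$, and $p$ is the blowup of $\mathcal{X}$ along $\operatorname{Sing}(\mathcal{X}/S)$; that is, the inverse image ideal of $\operatorname{Sing}(\mathcal{X}/S)$ under $p$ is invertible and $p$ is universal among morphisms to $\mathcal{X}$ with this property. Equivalently, there is a unique isomorphism $\mathbb{P}\Lambda_{\mathcal{X}/S}\cong\operatorname{Bl}_{\operatorname{Sing}(\mathcal{X}/S)}\mathcal{X}$ of schemes over $\mathcal{X}$. -/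

import Mathlib

open CategoryTheory CategoryTheory.Limits AlgebraicGeometry TensorProduct HomogeneousLocalization

universe u
noncomputable section

namespace RelConormal

/-! ### The scheme `Proj (Sym T)` of an `A`-module `T` and its base change -/

namespace SymProj
variable (A : Type u) [CommRing A] (T : Type u) [AddCommGroup T] [Module A T]

/-- The grading of `Sym_A T`: the degree `n` part is spanned by products of `n` elements of `T`. -/
def grading (n : ℕ) : Submodule A (SymmetricAlgebra A T) :=
  LinearMap.range (SymmetricAlgebra.ι A T) ^ n

variable {A T} in
theorem ι_mem (t : T) : SymmetricAlgebra.ι A T t ∈ grading A T 1 := by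
  simp [grading]

instance : SetLike.GradedMonoid (grading A T) :=
  inferInstanceAs (SetLike.GradedMonoid ((LinearMap.range (SymmetricAlgebra.ι A T) ^ ·)))

/-- The inclusion of `T` as the degree one part. -/
def gι : T →ₗ[A] DirectSum ℕ fun i => grading A T i :=
  DirectSum.lof A ℕ (fun i => grading A T i) 1 ∘ₗ
    (SymmetricAlgebra.ι A T).codRestrict _ ι_mem

instance : GradedAlgebra (grading A T) :=
  GradedAlgebra.ofAlgHom _ (SymmetricAlgebra.lift (gι A T))
    (by
      apply SymmetricAlgebra.algHom_ext
      ext m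
      simp [gι, DirectSum.lof_eq_of, DirectSum.coeAlgHom_of])
    fun i x => by
      obtain ⟨x, hx⟩ := x
      unfold grading at hx
      induction hx using Submodule.pow_induction_on_left' with
      | algebraMap r => rw [AlgHom.commutes, DirectSum.algebraMap_apply]; rfl
      | add x y i hx hy ihx ihy => simp only [map_add, ihx, ihy]; rw [← map_add]; rfl
      | mem_mul m hm i x hx ih =>
        obtain ⟨m, rfl⟩ := hm
        simp only [map_mul, ih, SymmetricAlgebra.lift_ι_apply]
        simp only [gι, LinearMap.comp_apply, DirectSum.lof_eq_of, DirectSum.of_mul_of]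
        exact DirectSum.of_eq_of_gradedMonoid_eq (Sigma.subtype_ext (add_comm _ _) rfl)

variable {A T}
variable {A' : Type u} [CommRing A'] [Algebra A A'] {T' : Type u} [AddCommGroup T'] [Module A' T']
  [Module A T'] [IsScalarTower A A' T']

/-- The ring map `Sym_A T → Sym_A' T'` induced by a linear map `T → T'` over `A → A'`. -/
def map (φ : T →ₗ[A] T') : SymmetricAlgebra A T →ₐ[A] SymmetricAlgebra A' T' :=
  SymmetricAlgebra.lift ((SymmetricAlgebra.ι A' T').restrictScalars A ∘ₗ φ)

@[simp] theorem map_ι (φ : T →ₗ[A] T') (t : T) :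
    map φ (SymmetricAlgebra.ι A T t) = SymmetricAlgebra.ι A' T' (φ t) := by
  simp [map]

theorem map_mem (φ : T →ₗ[A] T') {n : ℕ} {x : SymmetricAlgebra A T} (hx : x ∈ grading A T n) :
    map φ x ∈ grading A' T' n := by
  unfold grading at hx
  induction hx using Submodule.pow_induction_on_left' with
  | algebraMap r =>
    rw [AlgHom.commutes, IsScalarTower.algebraMap_apply A A']
    exact SetLike.algebraMap_mem_graded (grading A' T') _
  | add x y i hx hy ihx ihy => rw [map_add]; exact add_mem ihx ihy
  | mem_mul m hm i x hx ih =>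
    obtain ⟨m, rfl⟩ := hm
    rw [map_mul, map_ι, Nat.succ_eq_add_one, add_comm]
    exact SetLike.GradedMul.mul_mem (ι_mem _) ih

/-- `map` as a homomorphism of graded rings. -/
def gmap (φ : T →ₗ[A] T') : grading A T →+*ᵍ grading A' T' where
  toRingHom := (map (A' := A') φ).toRingHom
  map_mem := map_mem φ

theorem gmap_mem (φ : T →ₗ[A] T') {n : ℕ} {x : SymmetricAlgebra A T} (hx : x ∈ grading A T n) :
    gmap (A' := A') φ x ∈ grading A' T' n := map_mem φ hx

@[simp] theorem gmap_ι (φ : T →ₗ[A] T') (t : T) :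
    gmap (A' := A') φ (SymmetricAlgebra.ι A T t) = SymmetricAlgebra.ι A' T' (φ t) := map_ι φ t

@[simp] theorem gmap_algebraMap (φ : T →ₗ[A] T') (a : A) :
    gmap (A' := A') φ (algebraMap A _ a) = algebraMap A' _ (algebraMap A A' a) :=
  ((map (A' := A') φ).commutes a).trans (IsScalarTower.algebraMap_apply A A' _ a)

theorem ringHom_ext {B : Type*} [CommRing B] {f g : SymmetricAlgebra A T →+* B}
    (h₁ : ∀ a, f (algebraMap A _ a) = g (algebraMap A _ a))
    (h₂ : ∀ t, f (SymmetricAlgebra.ι A T t) = g (SymmetricAlgebra.ι A T t)) : f = g := by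
  refine RingHom.ext fun x => ?_
  induction x using SymmetricAlgebra.induction with
  | algebraMap r => exact h₁ r
  | ι x => exact h₂ x
  | mul a b ha hb => simp [ha, hb]
  | add a b ha hb => simp [ha, hb]

theorem irrelevant_le_span :
    (HomogeneousIdeal.irrelevant (grading A T)).toIdeal ≤
      Ideal.span (Set.range (SymmetricAlgebra.ι A T)) := by
  rw [HomogeneousIdeal.toIdeal_irrelevant_le]
  intro i hi x hx
  obtain ⟨i, rfl⟩ := Nat.exists_eq_succ_of_ne_zero hi.ne'
  replace hx : x ∈ LinearMap.range (SymmetricAlgebra.ι A T) ^ (i + 1) := hx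
  rw [pow_succ] at hx
  induction hx using Submodule.mul_induction_on' with
  | mem_mul_mem m _ n hn => exact Ideal.mul_mem_left _ _ (Ideal.subset_span hn)
  | add x _ y _ hx hy => exact add_mem hx hy

theorem irrelevant_le_map {φ : T →ₗ[A] T'} (hφ : IsBaseChange A' φ) :
    HomogeneousIdeal.irrelevant (grading A' T') ≤
      (HomogeneousIdeal.irrelevant (grading A T)).map (gmap φ) := by
  change HomogeneousIdeal.toIdeal _ ≤ HomogeneousIdeal.toIdeal _
  refine irrelevant_le_span.trans (Ideal.span_le.mpr ?_)
  rintro _ ⟨t, rfl⟩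
  simp only [HomogeneousIdeal.toIdeal_map, SetLike.mem_coe]
  induction t using hφ.inductionOn with
  | zero => simp
  | tmul t =>
    rw [← gmap_ι]
    refine Ideal.mem_map_of_mem _ ?_
    exact HomogeneousIdeal.mem_irrelevant_of_mem _ one_pos (ι_mem t)
  | smul a t h => rw [map_smul, Algebra.smul_def]; exact Ideal.mul_mem_left _ _ h
  | add x y hx hy => rw [map_add]; exact add_mem hx hy

variable (A T) in
/-- The structure map of `A` into the degree zero part. -/
def toZero : A →+* grading A T 0 where
  toFun a := ⟨algebraMap A _ a, SetLike.algebraMap_mem_graded _ _⟩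
  map_one' := by ext; simp
  map_mul' _ _ := by ext; simp
  map_zero' := by ext; simp
  map_add' _ _ := by ext; simp

variable (A T) in
/-- The structure morphism `Proj (Sym_A T) ⟶ Spec A`. -/
def toSpec : Proj (grading A T) ⟶ Spec (.of A) :=
  Proj.toSpecZero (grading A T) ≫ Spec.map (CommRingCat.ofHom (toZero A T))

variable (T) in
/-- The structure map of `A` into the coordinate ring of the basic open `D₊(s)`. -/
def toAway (s : SymmetricAlgebra A T) : A →+* Away (grading A T) s :=
  (fromZeroRingHom (grading A T) _).comp (toZero A T)

/-- The function `x / s` on `D₊(s)`, for `x ∈ T` and `s` of degree one. -/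
def frac {s : SymmetricAlgebra A T} (hs : s ∈ grading A T 1) (x : T) : Away (grading A T) s :=
  Away.mk _ hs 1 (SymmetricAlgebra.ι A T x) (by simpa using ι_mem x)

theorem away_mk_add {s : SymmetricAlgebra A T} (hs : s ∈ grading A T 1) (n : ℕ)
    {x y : SymmetricAlgebra A T} (hx : x ∈ grading A T (n • 1)) (hy : y ∈ grading A T (n • 1)) :
    Away.mk (grading A T) hs n (x + y) (add_mem hx hy) =
      Away.mk (grading A T) hs n x hx + Away.mk (grading A T) hs n y hy := by
  ext
  rw [val_add, Away.val_mk, Away.val_mk, Away.val_mk, Localization.add_mk_self]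

theorem away_mk_succ {s : SymmetricAlgebra A T} (hs : s ∈ grading A T 1) (m : T) (n : ℕ)
    {x : SymmetricAlgebra A T} (hx : x ∈ grading A T (n • 1))
    (h : SymmetricAlgebra.ι A T m * x ∈ grading A T ((n + 1) • 1)) :
    Away.mk (grading A T) hs (n + 1) (SymmetricAlgebra.ι A T m * x) h =
      frac hs m * Away.mk (grading A T) hs n x hx := by
  ext
  rw [val_mul, frac, Away.val_mk, Away.val_mk, Away.val_mk, Localization.mk_mul]
  congr 1
  ext
  simp only [pow_one, Submonoid.coe_mul]
  exact pow_succ' _ n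

theorem away_ext {B : Type*} [CommRing B] {s : SymmetricAlgebra A T} (hs : s ∈ grading A T 1)
    {f g : Away (grading A T) s →+* B}
    (h₁ : ∀ a, f (toAway T s a) = g (toAway T s a)) (h₂ : ∀ x, f (frac hs x) = g (frac hs x)) :
    f = g := by
  refine RingHom.ext fun z => ?_
  obtain ⟨n, x, hx, rfl⟩ := Away.mk_surjective _ hs z
  have hx' : x ∈ LinearMap.range (SymmetricAlgebra.ι A T) ^ n := by
    rw [smul_eq_mul, mul_one] at hx
    exact hx
  induction hx' using Submodule.pow_induction_on_left' with
  | algebraMap r =>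
    have : Away.mk (grading A T) hs 0 _ hx = toAway T s r := by
      ext
      rw [Away.val_mk]
      simp only [pow_zero]
      rfl
    rw [this, h₁]
  | add x y i hx1 hy1 ihx ihy =>
    have hx2 : x ∈ grading A T (i • 1) := by rw [smul_eq_mul, mul_one]; exact hx1
    have hy2 : y ∈ grading A T (i • 1) := by rw [smul_eq_mul, mul_one]; exact hy1
    rw [away_mk_add hs i hx2 hy2, map_add, map_add, ihx, ihy]
  | mem_mul m hm i x hx1 ih =>
    obtain ⟨m, rfl⟩ := hm
    have hx2 : x ∈ grading A T (i • 1) := by rw [smul_eq_mul, mul_one]; exact hx1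
    rw [away_mk_succ hs m i hx2, map_mul, map_mul, ih, h₂]

/-- A linear map `T → B` with `s ↦ 1` induces a ring map on functions of `D₊(s)`. -/
def awayLift {B : Type*} [CommRing B] [Algebra A B] {s : SymmetricAlgebra A T} (φ : T →ₗ[A] B)
    (h : SymmetricAlgebra.lift φ s = 1) : Away (grading A T) s →+* B :=
  (Localization.awayLift (SymmetricAlgebra.lift φ).toRingHom s (by simp [h])).comp
    (algebraMap (Away (grading A T) s) (Localization.Away _))

theorem awayLift_toAway {B : Type*} [CommRing B] [Algebra A B] {s : SymmetricAlgebra A T}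
    (φ : T →ₗ[A] B) (h : SymmetricAlgebra.lift φ s = 1) (a : A) :
    awayLift φ h (toAway T s a) = algebraMap A B a := by
  have : (toAway T s a).val = algebraMap _ _ (algebraMap A (SymmetricAlgebra A T) a) := by
    rw [← Localization.mk_one_eq_algebraMap]; rfl
  simp [awayLift, this, Localization.awayLift]

theorem awayLift_frac {B : Type*} [CommRing B] [Algebra A B] {s : SymmetricAlgebra A T}
    (hs : s ∈ grading A T 1) (φ : T →ₗ[A] B) (h : SymmetricAlgebra.lift φ s = 1) (x : T) :
    awayLift φ h (frac hs x) = φ x := by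
  have hu : IsUnit ((SymmetricAlgebra.lift φ).toRingHom s) := by simp [h]
  have key : (frac hs x).val * algebraMap _ _ s = algebraMap _ _ (SymmetricAlgebra.ι A T x) := by
    rw [frac, Away.val_mk, ← Localization.mk_one_eq_algebraMap, ← Localization.mk_one_eq_algebraMap,
      Localization.mk_mul, Localization.mk_eq_mk_iff, Localization.r_iff_exists]
    refine ⟨1, ?_⟩
    simp only [pow_one, mul_one, OneMemClass.coe_one, one_mul]
    exact CommMonoid.mul_comm _ _
  have := congrArg (Localization.awayLift (SymmetricAlgebra.lift φ).toRingHom s hu) key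
  rw [map_mul] at this
  simpa [awayLift, Localization.awayLift, h] using this

theorem frac_self {s : SymmetricAlgebra A T} (hs : s ∈ grading A T 1) {t : T}
    (h : SymmetricAlgebra.ι A T t = s) : frac hs t = 1 := by
  subst h
  ext
  rw [frac, Away.val_mk, val_one]
  simp only [pow_one]
  exact Localization.mk_self (⟨_, _⟩ : Submonoid.powers _)

theorem frac_add {s : SymmetricAlgebra A T} (hs : s ∈ grading A T 1) (x y : T) :
    frac hs (x + y) = frac hs x + frac hs y := by
  ext
  rw [val_add, frac, frac, frac, Away.val_mk, Away.val_mk, Away.val_mk, Localization.add_mk_self,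
    map_add]

theorem frac_smul {s : SymmetricAlgebra A T} (hs : s ∈ grading A T 1) (a : A) (x : T) :
    frac hs (a • x) = toAway T s a * frac hs x := by
  have : (toAway T s a).val = algebraMap _ _ (algebraMap A (SymmetricAlgebra A T) a) := by
    rw [← Localization.mk_one_eq_algebraMap]; rfl
  ext
  rw [val_mul, this, frac, frac, Away.val_mk, Away.val_mk, map_smul, Algebra.smul_def,
    ← Localization.mk_one_eq_algebraMap, Localization.mk_mul, one_mul]

theorem isPushout_of_univ {R S R' S' : Type u} [CommRing R] [CommRing S] [CommRing R'] [CommRing S']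
    {f : R →+* S} {g : R →+* R'} {k : S →+* S'} {l : R' →+* S'} (w : k.comp f = l.comp g)
    (H : ∀ (B : Type u) [CommRing B] (α : S →+* B) (β : R' →+* B), α.comp f = β.comp g →
      ∃ γ : S' →+* B, γ.comp k = α ∧ γ.comp l = β)
    (H' : ∀ (B : Type u) [CommRing B] (γ γ' : S' →+* B), γ.comp k = γ'.comp k →
      γ.comp l = γ'.comp l → γ = γ') :
    IsPushout (CommRingCat.ofHom f) (CommRingCat.ofHom g) (CommRingCat.ofHom k)
      (CommRingCat.ofHom l) := by
  have hw : CommRingCat.ofHom f ≫ CommRingCat.ofHom k = CommRingCat.ofHom g ≫ CommRingCat.ofHom l :=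
    CommRingCat.hom_ext w
  have E (s : PushoutCocone (CommRingCat.ofHom f) (CommRingCat.ofHom g)) :=
    H s.pt s.inl.hom s.inr.hom congr(($s.condition).hom)
  refine ⟨⟨hw⟩, ⟨PushoutCocone.IsColimit.mk hw (fun s => CommRingCat.ofHom (E s).choose)
    (fun s => CommRingCat.hom_ext (E s).choose_spec.1)
    (fun s => CommRingCat.hom_ext (E s).choose_spec.2) fun s m h₁ h₂ => CommRingCat.hom_ext ?_⟩⟩
  exact H' _ _ _ (congr(($h₁).hom).trans (E s).choose_spec.1.symm)
    (congr(($h₂).hom).trans (E s).choose_spec.2.symm)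

theorem isPushout_sym {φ : T →ₗ[A] T'} (hφ : IsBaseChange A' φ) :
    IsPushout (CommRingCat.ofHom (algebraMap A (SymmetricAlgebra A T)))
      (CommRingCat.ofHom (algebraMap A A'))
      (CommRingCat.ofHom (gmap (A' := A') φ).toRingHom)
      (CommRingCat.ofHom (algebraMap A' (SymmetricAlgebra A' T'))) := by
  refine isPushout_of_univ ?_ ?_ ?_
  · ext a
    exact gmap_algebraMap φ a
  · intro B _ α β h
    let : Algebra A' B := β.toAlgebra
    let : Algebra A B := (β.comp (algebraMap A A')).toAlgebra
    have : IsScalarTower A A' B := .of_algebraMap_eq' rfl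
    let αₐ : SymmetricAlgebra A T →ₐ[A] B := { α with commutes' := fun a => congr($h a) }
    let ψ := hφ.lift (αₐ.toLinearMap ∘ₗ SymmetricAlgebra.ι A T)
    refine ⟨(SymmetricAlgebra.lift ψ).toRingHom, ringHom_ext (fun a => ?_) fun t => ?_, ?_⟩
    · have := (SymmetricAlgebra.lift ψ).commutes (algebraMap A A' a)
      refine (congrArg (SymmetricAlgebra.lift ψ) (gmap_algebraMap φ a)).trans (this.trans ?_)
      exact congr($h a).symm
    · refine (congrArg (SymmetricAlgebra.lift ψ) (gmap_ι φ t)).trans ?_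
      simp [ψ, hφ.lift_eq]
      rfl
    · ext a
      exact (SymmetricAlgebra.lift ψ).commutes a
  · intro B _ γ γ' h₁ h₂
    refine ringHom_ext (fun a => congr($h₂ a)) fun t => ?_
    induction t using hφ.inductionOn with
    | zero => simp
    | tmul t => 
      have := congr($h₁ (SymmetricAlgebra.ι A T t))
      simpa using this
    | smul a t h =>
      have := congr($h₂ a)
      simp only [RingHom.comp_apply] at this
      rw [map_smul, Algebra.smul_def, map_mul, map_mul, h, this]
    | add x y hx hy => rw [map_add, map_add, map_add, hx, hy]

theorem awayMap_toAway (φ : T →ₗ[A] T') (s : SymmetricAlgebra A T) (a : A) :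
    Away.map (gmap (A' := A') φ) s (toAway T s a) = toAway T' _ (algebraMap A A' a) := by
  change HomogeneousLocalization.map _ _ (HomogeneousLocalization.mk _) =
    HomogeneousLocalization.mk _
  rw [map_mk]
  ext
  rw [val_mk, val_mk]
  simp [toZero]

theorem awayMap_frac (φ : T →ₗ[A] T') {s : SymmetricAlgebra A T} (hs : s ∈ grading A T 1) (x : T) :
    Away.map (gmap (A' := A') φ) s (frac hs x) = frac (gmap_mem φ hs) (φ x) := by
  ext
  rw [frac, Away.map_mk, frac, Away.val_mk, Away.val_mk, gmap_ι]

theorem isPushout_away {φ : T →ₗ[A] T'} (hφ : IsBaseChange A' φ) (t : T) :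
    IsPushout (CommRingCat.ofHom (toAway T (SymmetricAlgebra.ι A T t)))
      (CommRingCat.ofHom (algebraMap A A'))
      (CommRingCat.ofHom (Away.map (gmap (A' := A') φ) (SymmetricAlgebra.ι A T t)))
      (CommRingCat.ofHom (toAway T' (gmap (A' := A') φ (SymmetricAlgebra.ι A T t)))) := by
  have hs' := gmap_mem (A' := A') φ (ι_mem t)
  refine isPushout_of_univ ?_ ?_ ?_
  · ext a : 1
    exact awayMap_toAway φ _ a
  · intro B _ α β h
    let : Algebra A' B := β.toAlgebra
    let : Algebra A B := (β.comp (algebraMap A A')).toAlgebra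
    have : IsScalarTower A A' B := .of_algebraMap_eq' rfl
    let ψ₀ : T →ₗ[A] B :=
      { toFun x := α (frac (ι_mem t) x)
        map_add' x y := by rw [frac_add, map_add]
        map_smul' a x := by
          rw [frac_smul, map_mul, RingHom.id_apply, Algebra.smul_def]
          exact congrArg (· * _) congr($h a) }
    let ψ := hφ.lift ψ₀
    have h1 : SymmetricAlgebra.lift ψ (gmap (A' := A') φ (SymmetricAlgebra.ι A T t)) = 1 := by
      rw [gmap_ι, SymmetricAlgebra.lift_ι_apply, hφ.lift_eq]
      change α (frac (ι_mem t) t) = 1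
      rw [frac_self _ rfl, map_one]
    refine ⟨awayLift ψ h1, away_ext (ι_mem t) (fun a => ?_) fun x => ?_, ?_⟩
    · rw [RingHom.comp_apply, awayMap_toAway, awayLift_toAway]
      exact congr($h a).symm
    · rw [RingHom.comp_apply, awayMap_frac, awayLift_frac, hφ.lift_eq]
      rfl
    · ext a
      exact awayLift_toAway ψ h1 a
  · intro B _ γ γ' h₁ h₂
    refine away_ext hs' (fun a => congr($h₂ a)) fun t => ?_
    induction t using hφ.inductionOn with
    | zero =>
      have : frac hs' (0 : T') = 0 := by
        have := frac_add hs' 0 0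
        simpa using this
      rw [this, map_zero, map_zero]
    | tmul x =>
      have := congr($h₁ (frac (ι_mem t) x))
      rwa [RingHom.comp_apply, RingHom.comp_apply, awayMap_frac] at this
    | smul a x h =>
      have := congr($h₂ a)
      simp only [RingHom.comp_apply] at this
      rw [frac_smul, map_mul, map_mul, h, this]
    | add x y hx hy => rw [frac_add, map_add, map_add, hx, hy]

/-- Functoriality of `Proj (Sym T)` under base change. -/
def projMap {φ : T →ₗ[A] T'} (hφ : IsBaseChange A' φ) :
    Proj (grading A' T') ⟶ Proj (grading A T) :=
  Proj.map (gmap φ) (irrelevant_le_map hφ)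

theorem awayι_toSpec (s : SymmetricAlgebra A T) (hs : s ∈ grading A T 1) :
    Proj.awayι (grading A T) s hs one_pos ≫ toSpec A T =
      Spec.map (CommRingCat.ofHom (toAway T s)) := by
  rw [toSpec, Proj.awayι_toSpecZero_assoc, ← Spec.map_comp]
  rfl

variable (A T) in
/-- The affine cover of `Proj (Sym_A T)` by the `D₊(t)`, `t ∈ T`. -/
def cover : (Proj (grading A T)).AffineOpenCover :=
  Proj.affineOpenCoverOfIrrelevantLESpan (grading A T) (SymmetricAlgebra.ι A T) (m := fun _ => 1)
    ι_mem (fun _ => one_pos) irrelevant_le_span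

theorem isPullback_proj {φ : T →ₗ[A] T'} (hφ : IsBaseChange A' φ) :
    IsPullback (projMap hφ) (toSpec A' T') (toSpec A T)
      (Spec.map (CommRingCat.ofHom (algebraMap A A'))) := by
  refine Scheme.isPullback_of_openCover _ _ _ _ (cover A T).openCover fun (t : T) => ?_
  have h₁ : IsPullback (Spec.map (CommRingCat.ofHom (Away.map (gmap (A' := A') φ)
      (SymmetricAlgebra.ι A T t)))) 
      (Proj.awayι (grading A' T') _ (gmap_mem φ (ι_mem t)) one_pos)
      (Proj.awayι (grading A T) _ (ι_mem t) one_pos) (projMap hφ) := by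
    refine IsOpenImmersion.isPullback _ _ _ _ ?_ ?_
    · exact Proj.awayι_comp_map _ _ one_pos _ (ι_mem t)
    · rw [Proj.opensRange_awayι, Proj.opensRange_awayι]
      rfl
  have h₂ := isPullback_SpecMap_of_isPushout _ _ _ _ (isPushout_away hφ t)
  rw [← awayι_toSpec _ (ι_mem t), ← awayι_toSpec _ (gmap_mem φ (ι_mem t))] at h₂
  refine h₂.of_iso h₁.flip.isoPullback (Iso.refl _) (Iso.refl _) (Iso.refl _) ?_ ?_ ?_ ?_
  · exact (Category.comp_id _).trans h₁.flip.isoPullback_hom_snd.symm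
  · exact (Category.comp_id _).trans (h₁.flip.isoPullback_hom_fst_assoc _).symm
  · exact (Category.comp_id _).trans (Category.id_comp _).symm
  · simp

end SymProj

/-! ### Relative one-forms and relative vector fields on pairs of affine opens -/

theorem isBaseChange_kaehlerDifferential_map (R R' A A' : Type u) [CommRing R] [CommRing R']
    [CommRing A] [CommRing A'] [Algebra R R'] [Algebra R A] [Algebra R A'] [Algebra R' A']
    [Algebra A A'] [IsScalarTower R A A'] [IsScalarTower R R' A']
    [Algebra.FormallyEtale A A'] [Algebra.FormallyUnramified R R'] :
    IsBaseChange A' (KaehlerDifferential.map R R' A A') := by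
  have h : Function.Bijective (KaehlerDifferential.map R R' A' A') := by
    refine ⟨?_, KaehlerDifferential.map_surjective R R' A'⟩
    rw [injective_iff_map_eq_zero]
    intro x hx
    obtain ⟨x, rfl⟩ := (KaehlerDifferential.exact_mapBaseChange_map R R' A' x).mp hx
    rw [Subsingleton.elim x 0, map_zero]
  have h' := (KaehlerDifferential.isBaseChange_of_formallyEtale R A A').comp
    (IsBaseChange.ofEquiv (LinearEquiv.ofBijective _ h))
  convert h'
  refine Derivation.liftKaehlerDifferential_unique _ _ ?_
  ext x
  simp

section
variable (R R' A A' : Type u) [CommRing R] [CommRing R']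
    [CommRing A] [CommRing A'] [Algebra R R'] [Algebra R A] [Algebra R A'] [Algebra R' A']
    [Algebra A A'] [IsScalarTower R A A'] [IsScalarTower R R' A']
    [Algebra.FormallyEtale A A'] [Algebra.FormallyUnramified R R']

/-- The restriction of relative vector fields (linear forms on one-forms) along `A → A'`. -/
def vfMap : Module.Dual A Ω[A⁄R] →ₗ[A] Module.Dual A' Ω[A'⁄R'] :=
  (isBaseChange_kaehlerDifferential_map R R' A A').toDual

theorem vfMap_D (t : Module.Dual A Ω[A⁄R]) (x : A) :
    vfMap R R' A A' t (KaehlerDifferential.D R' A' (algebraMap A A' x)) =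
      algebraMap A A' (t (KaehlerDifferential.D R A x)) := by
  rw [← IsBaseChange.toDual_comp_apply (isBaseChange_kaehlerDifferential_map R R' A A'),
    KaehlerDifferential.map_D]
  rfl

theorem isBaseChange_vfMap [Module.Free A Ω[A⁄R]] [Module.Finite A Ω[A⁄R]] :
    IsBaseChange A' (vfMap R R' A A') :=
  (isBaseChange_kaehlerDifferential_map R R' A A').dual

end

theorem formallyEtale_res {X : Scheme.{u}} {U V : X.Opens} (hU : IsAffineOpen U)
    (hV : IsAffineOpen V) (h : U ≤ V) :
    (X.presheaf.map (homOfLE h).op).hom.FormallyEtale := by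
  have h' : Scheme.Hom.appLE (𝟙 X) V U h = X.presheaf.map (homOfLE h).op := by
    simp [Scheme.Hom.appLE]
    rfl
  exact h' ▸ (Scheme.Hom.etale_appLE (𝟙 X) hV hU h).formallyEtale

variable {W S : Scheme.{u}}

/-- Affine opens `U ⊆ W` and `V ⊆ S` such that `q` maps `U` into `V`. -/
structure AffinePair (q : W ⟶ S) where
  V : S.Opens
  isAffineOpen_V : IsAffineOpen V
  U : W.Opens
  isAffineOpen_U : IsAffineOpen U
  le : U ≤ q ⁻¹ᵁ V

namespace AffinePair
variable {q : W ⟶ S}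

instance (c : AffinePair q) : Algebra Γ(S, c.V) Γ(W, c.U) := (q.appLE c.V c.U c.le).hom.toAlgebra

/-- The module of relative one-forms on `U`. -/
abbrev Cotangent (c : AffinePair q) : Type u := Ω[Γ(W, c.U)⁄Γ(S, c.V)]

/-- The module of relative vector fields on `U`, the dual of the relative one-forms. -/
abbrev Tangent (c : AffinePair q) : Type u := Module.Dual Γ(W, c.U) c.Cotangent

instance : Preorder (AffinePair q) where
  le c d := c.V ≤ d.V ∧ c.U ≤ d.U
  le_refl c := ⟨le_rfl, le_rfl⟩
  le_trans _ _ _ h₁ h₂ := ⟨h₁.1.trans h₂.1, h₁.2.trans h₂.2⟩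

variable {c d : AffinePair q}

theorem isScalarTower_left (h : c ≤ d) :
    letI := (W.presheaf.map (homOfLE h.2).op).hom.toAlgebra
    letI := (q.appLE d.V c.U (h.2.trans d.le)).hom.toAlgebra
    IsScalarTower Γ(S, d.V) Γ(W, d.U) Γ(W, c.U) := by
  let := (W.presheaf.map (homOfLE h.2).op).hom.toAlgebra
  let := (q.appLE d.V c.U (h.2.trans d.le)).hom.toAlgebra
  refine .of_algebraMap_eq' ?_
  simp only [RingHom.algebraMap_toAlgebra, ← CommRingCat.hom_comp]
  rw [Scheme.Hom.appLE_map]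

theorem isScalarTower_right (h : c ≤ d) :
    letI := (S.presheaf.map (homOfLE h.1).op).hom.toAlgebra
    letI := (q.appLE d.V c.U (h.2.trans d.le)).hom.toAlgebra
    IsScalarTower Γ(S, d.V) Γ(S, c.V) Γ(W, c.U) := by
  let := (S.presheaf.map (homOfLE h.1).op).hom.toAlgebra
  let := (q.appLE d.V c.U (h.2.trans d.le)).hom.toAlgebra
  refine .of_algebraMap_eq' ?_
  simp only [RingHom.algebraMap_toAlgebra, ← CommRingCat.hom_comp]
  rw [Scheme.Hom.map_appLE]

open SymProj

/-- The graded ring `Sym (T_{W/S})` on `U`. -/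
abbrev symGrading (c : AffinePair q) := grading Γ(W, c.U) c.Tangent

/-- Restriction of relative vector fields to a smaller pair. -/
def res (h : c ≤ d) : d.Tangent →+ c.Tangent :=
  letI := (W.presheaf.map (homOfLE h.2).op).hom.toAlgebra
  letI := (S.presheaf.map (homOfLE h.1).op).hom.toAlgebra
  letI := (q.appLE d.V c.U (h.2.trans d.le)).hom.toAlgebra
  haveI := isScalarTower_left h
  haveI := isScalarTower_right h
  haveI : Algebra.FormallyEtale Γ(W, d.U) Γ(W, c.U) :=
    formallyEtale_res c.isAffineOpen_U d.isAffineOpen_U h.2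
  haveI : Algebra.FormallyEtale Γ(S, d.V) Γ(S, c.V) :=
    formallyEtale_res c.isAffineOpen_V d.isAffineOpen_V h.1
  (vfMap Γ(S, d.V) Γ(S, c.V) Γ(W, d.U) Γ(W, c.U)).toAddMonoidHom

/-- Restriction on symmetric algebras of relative vector fields. -/
def symRes (h : c ≤ d) : d.symGrading →+*ᵍ c.symGrading :=
  letI := (W.presheaf.map (homOfLE h.2).op).hom.toAlgebra
  letI := (S.presheaf.map (homOfLE h.1).op).hom.toAlgebra
  letI := (q.appLE d.V c.U (h.2.trans d.le)).hom.toAlgebra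
  haveI := isScalarTower_left h
  haveI := isScalarTower_right h
  haveI : Algebra.FormallyEtale Γ(W, d.U) Γ(W, c.U) :=
    formallyEtale_res c.isAffineOpen_U d.isAffineOpen_U h.2
  haveI : Algebra.FormallyEtale Γ(S, d.V) Γ(S, c.V) :=
    formallyEtale_res c.isAffineOpen_V d.isAffineOpen_V h.1
  gmap (vfMap Γ(S, d.V) Γ(S, c.V) Γ(W, d.U) Γ(W, c.U))

theorem res_D (h : c ≤ d) (t : d.Tangent) (x : Γ(W, d.U)) :
    res h t (KaehlerDifferential.D _ _ (W.presheaf.map (homOfLE h.2).op x)) =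
      W.presheaf.map (homOfLE h.2).op (t (KaehlerDifferential.D _ _ x)) := by
  let := (W.presheaf.map (homOfLE h.2).op).hom.toAlgebra
  let := (S.presheaf.map (homOfLE h.1).op).hom.toAlgebra
  let := (q.appLE d.V c.U (h.2.trans d.le)).hom.toAlgebra
  have := isScalarTower_left h
  have := isScalarTower_right h
  have : Algebra.FormallyEtale Γ(W, d.U) Γ(W, c.U) :=
    formallyEtale_res c.isAffineOpen_U d.isAffineOpen_U h.2
  have : Algebra.FormallyEtale Γ(S, d.V) Γ(S, c.V) :=
    formallyEtale_res c.isAffineOpen_V d.isAffineOpen_V h.1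
  exact vfMap_D Γ(S, d.V) Γ(S, c.V) Γ(W, d.U) Γ(W, c.U) t x

theorem symRes_algebraMap (h : c ≤ d) (x : Γ(W, d.U)) :
    symRes h (algebraMap _ _ x) = algebraMap _ _ (W.presheaf.map (homOfLE h.2).op x) := by
  let := (W.presheaf.map (homOfLE h.2).op).hom.toAlgebra
  let := (S.presheaf.map (homOfLE h.1).op).hom.toAlgebra
  let := (q.appLE d.V c.U (h.2.trans d.le)).hom.toAlgebra
  have := isScalarTower_left h
  have := isScalarTower_right h
  have : Algebra.FormallyEtale Γ(W, d.U) Γ(W, c.U) :=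
    formallyEtale_res c.isAffineOpen_U d.isAffineOpen_U h.2
  have : Algebra.FormallyEtale Γ(S, d.V) Γ(S, c.V) :=
    formallyEtale_res c.isAffineOpen_V d.isAffineOpen_V h.1
  exact gmap_algebraMap (vfMap Γ(S, d.V) Γ(S, c.V) Γ(W, d.U) Γ(W, c.U)) x

theorem symRes_ι (h : c ≤ d) (t : d.Tangent) :
    symRes h (SymmetricAlgebra.ι _ _ t) = SymmetricAlgebra.ι _ _ (res h t) := by
  let := (W.presheaf.map (homOfLE h.2).op).hom.toAlgebra
  let := (S.presheaf.map (homOfLE h.1).op).hom.toAlgebra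
  let := (q.appLE d.V c.U (h.2.trans d.le)).hom.toAlgebra
  have := isScalarTower_left h
  have := isScalarTower_right h
  have : Algebra.FormallyEtale Γ(W, d.U) Γ(W, c.U) :=
    formallyEtale_res c.isAffineOpen_U d.isAffineOpen_U h.2
  have : Algebra.FormallyEtale Γ(S, d.V) Γ(S, c.V) :=
    formallyEtale_res c.isAffineOpen_V d.isAffineOpen_V h.1
  exact gmap_ι (vfMap Γ(S, d.V) Γ(S, c.V) Γ(W, d.U) Γ(W, c.U)) t

theorem free_of_le (h : c ≤ d) (hd : Module.Free Γ(W, d.U) d.Cotangent) :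
    Module.Free Γ(W, c.U) c.Cotangent := by
  let := (W.presheaf.map (homOfLE h.2).op).hom.toAlgebra
  let := (S.presheaf.map (homOfLE h.1).op).hom.toAlgebra
  let := (q.appLE d.V c.U (h.2.trans d.le)).hom.toAlgebra
  have := isScalarTower_left h
  have := isScalarTower_right h
  have : Algebra.FormallyEtale Γ(W, d.U) Γ(W, c.U) :=
    formallyEtale_res c.isAffineOpen_U d.isAffineOpen_U h.2
  have : Algebra.FormallyEtale Γ(S, d.V) Γ(S, c.V) :=
    formallyEtale_res c.isAffineOpen_V d.isAffineOpen_V h.1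
  have hb := isBaseChange_kaehlerDifferential_map Γ(S, d.V) Γ(S, c.V) Γ(W, d.U) Γ(W, c.U)
  exact Module.Free.of_equiv hb.equiv

theorem finite_of_le (h : c ≤ d) (hd : Module.Finite Γ(W, d.U) d.Cotangent) :
    Module.Finite Γ(W, c.U) c.Cotangent := by
  let := (W.presheaf.map (homOfLE h.2).op).hom.toAlgebra
  let := (S.presheaf.map (homOfLE h.1).op).hom.toAlgebra
  let := (q.appLE d.V c.U (h.2.trans d.le)).hom.toAlgebra
  have := isScalarTower_left h
  have := isScalarTower_right h
  have : Algebra.FormallyEtale Γ(W, d.U) Γ(W, c.U) :=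
    formallyEtale_res c.isAffineOpen_U d.isAffineOpen_U h.2
  have : Algebra.FormallyEtale Γ(S, d.V) Γ(S, c.V) :=
    formallyEtale_res c.isAffineOpen_V d.isAffineOpen_V h.1
  have hb := isBaseChange_kaehlerDifferential_map Γ(S, d.V) Γ(S, c.V) Γ(W, d.U) Γ(W, c.U)
  exact Module.Finite.equiv hb.equiv

theorem free_and_finite (h : (q.appLE c.V c.U c.le).hom.IsStandardSmooth) :
    Module.Free Γ(W, c.U) c.Cotangent ∧ Module.Finite Γ(W, c.U) c.Cotangent := by
  have : Algebra.IsStandardSmooth Γ(S, c.V) Γ(W, c.U) := h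
  exact ⟨inferInstance, inferInstance⟩

theorem tangent_ext {s t : c.Tangent} (h : c ≤ d)
    (H : ∀ x, s (KaehlerDifferential.D _ _ (W.presheaf.map (homOfLE h.2).op x)) =
      t (KaehlerDifferential.D _ _ (W.presheaf.map (homOfLE h.2).op x))) : s = t := by
  let := (W.presheaf.map (homOfLE h.2).op).hom.toAlgebra
  let := (S.presheaf.map (homOfLE h.1).op).hom.toAlgebra
  let := (q.appLE d.V c.U (h.2.trans d.le)).hom.toAlgebra
  have := isScalarTower_left h
  have := isScalarTower_right h
  have : Algebra.FormallyEtale Γ(W, d.U) Γ(W, c.U) :=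
    formallyEtale_res c.isAffineOpen_U d.isAffineOpen_U h.2
  have : Algebra.FormallyEtale Γ(S, d.V) Γ(S, c.V) :=
    formallyEtale_res c.isAffineOpen_V d.isAffineOpen_V h.1
  have hb := isBaseChange_kaehlerDifferential_map Γ(S, d.V) Γ(S, c.V) Γ(W, d.U) Γ(W, c.U)
  refine hb.algHom_ext _ _ fun v => ?_
  have : (s.restrictScalars Γ(W, d.U) ∘ₗ
      KaehlerDifferential.map Γ(S, d.V) Γ(S, c.V) Γ(W, d.U) Γ(W, c.U)) =
    (t.restrictScalars Γ(W, d.U) ∘ₗ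
      KaehlerDifferential.map Γ(S, d.V) Γ(S, c.V) Γ(W, d.U) Γ(W, c.U)) := by
    refine Derivation.liftKaehlerDifferential_unique _ _ ?_
    ext x
    have e := KaehlerDifferential.map_D Γ(S, d.V) Γ(S, c.V) Γ(W, d.U) Γ(W, c.U) x
    exact (congrArg s e).trans ((H x).trans (congrArg t e).symm)
  exact congr($this v)

theorem symRes_irrelevant (h : c ≤ d) (h₁ : Module.Free Γ(W, d.U) d.Cotangent)
    (h₂ : Module.Finite Γ(W, d.U) d.Cotangent) :
    HomogeneousIdeal.irrelevant c.symGrading ≤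
      (HomogeneousIdeal.irrelevant d.symGrading).map (symRes h) := by
  let := (W.presheaf.map (homOfLE h.2).op).hom.toAlgebra
  let := (S.presheaf.map (homOfLE h.1).op).hom.toAlgebra
  let := (q.appLE d.V c.U (h.2.trans d.le)).hom.toAlgebra
  have := isScalarTower_left h
  have := isScalarTower_right h
  have : Algebra.FormallyEtale Γ(W, d.U) Γ(W, c.U) :=
    formallyEtale_res c.isAffineOpen_U d.isAffineOpen_U h.2
  have : Algebra.FormallyEtale Γ(S, d.V) Γ(S, c.V) :=
    formallyEtale_res c.isAffineOpen_V d.isAffineOpen_V h.1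
  exact irrelevant_le_map (isBaseChange_vfMap Γ(S, d.V) Γ(S, c.V) Γ(W, d.U) Γ(W, c.U))

theorem isPullback_projMap (h : c ≤ d) (h₁ : Module.Free Γ(W, d.U) d.Cotangent)
    (h₂ : Module.Finite Γ(W, d.U) d.Cotangent) :
    IsPullback (Proj.map (symRes h) (symRes_irrelevant h h₁ h₂)) (toSpec Γ(W, c.U) c.Tangent)
      (toSpec Γ(W, d.U) d.Tangent) (Spec.map (W.presheaf.map (homOfLE h.2).op)) := by
  let := (W.presheaf.map (homOfLE h.2).op).hom.toAlgebra
  let := (S.presheaf.map (homOfLE h.1).op).hom.toAlgebra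
  let := (q.appLE d.V c.U (h.2.trans d.le)).hom.toAlgebra
  have := isScalarTower_left h
  have := isScalarTower_right h
  have : Algebra.FormallyEtale Γ(W, d.U) Γ(W, c.U) :=
    formallyEtale_res c.isAffineOpen_U d.isAffineOpen_U h.2
  have : Algebra.FormallyEtale Γ(S, d.V) Γ(S, c.V) :=
    formallyEtale_res c.isAffineOpen_V d.isAffineOpen_V h.1
  exact isPullback_proj (isBaseChange_vfMap Γ(S, d.V) Γ(S, c.V) Γ(W, d.U) Γ(W, c.U))

theorem isPullback_specMap (h : c ≤ d) (h₁ : Module.Free Γ(W, d.U) d.Cotangent)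
    (h₂ : Module.Finite Γ(W, d.U) d.Cotangent) :
    IsPullback (Spec.map (CommRingCat.ofHom (symRes h).toRingHom))
      (Spec.map (CommRingCat.ofHom (algebraMap Γ(W, c.U) (SymmetricAlgebra Γ(W, c.U) c.Tangent))))
      (Spec.map (CommRingCat.ofHom (algebraMap Γ(W, d.U) (SymmetricAlgebra Γ(W, d.U) d.Tangent))))
      (Spec.map (W.presheaf.map (homOfLE h.2).op)) := by
  let := (W.presheaf.map (homOfLE h.2).op).hom.toAlgebra
  let := (S.presheaf.map (homOfLE h.1).op).hom.toAlgebra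
  let := (q.appLE d.V c.U (h.2.trans d.le)).hom.toAlgebra
  have := isScalarTower_left h
  have := isScalarTower_right h
  have : Algebra.FormallyEtale Γ(W, d.U) Γ(W, c.U) :=
    formallyEtale_res c.isAffineOpen_U d.isAffineOpen_U h.2
  have : Algebra.FormallyEtale Γ(S, d.V) Γ(S, c.V) :=
    formallyEtale_res c.isAffineOpen_V d.isAffineOpen_V h.1
  exact isPullback_SpecMap_of_isPushout _ _ _ _
    (isPushout_sym (isBaseChange_vfMap Γ(S, d.V) Γ(S, c.V) Γ(W, d.U) Γ(W, c.U)))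

theorem res_self (t : c.Tangent) : res le_rfl t = t := by
  refine tangent_ext le_rfl fun x => ?_
  rw [res_D]
  simp

theorem res_res {e : AffinePair q} (h : c ≤ d) (h' : d ≤ e) (t : e.Tangent) :
    res h (res h' t) = res (h.trans h') t := by
  refine tangent_ext (h.trans h') fun x => ?_
  rw [res_D]
  have : W.presheaf.map (homOfLE (h.trans h').2).op x =
    W.presheaf.map (homOfLE h.2).op (W.presheaf.map (homOfLE h'.2).op x) := by
    rw [← CategoryTheory.comp_apply, ← Functor.map_comp]
    rfl
  rw [this, res_D, res_D, ← CategoryTheory.comp_apply, ← Functor.map_comp]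
  rfl

theorem symRes_self : symRes (le_refl c) = .id _ := by
  refine GradedRingHom.ext fun x => ?_
  have : (symRes (le_refl c)).toRingHom = RingHom.id _ :=
    ringHom_ext (fun a => (symRes_algebraMap _ a).trans (by simp))
      fun t => (symRes_ι _ t).trans (by rw [res_self]; rfl)
  exact congr($this x)

theorem symRes_comp {e : AffinePair q} (h : c ≤ d) (h' : d ≤ e) :
    (symRes h).comp (symRes h') = symRes (h.trans h') := by
  refine GradedRingHom.ext fun x => ?_
  have : ((symRes h).comp (symRes h')).toRingHom = (symRes (h.trans h')).toRingHom := by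
    refine ringHom_ext (fun a => ?_) fun t => ?_
    · change symRes h (symRes h' _) = symRes (h.trans h') _
      rw [symRes_algebraMap, symRes_algebraMap, symRes_algebraMap, ← CategoryTheory.comp_apply,
        ← Functor.map_comp]
      rfl
    · change symRes h (symRes h' _) = symRes (h.trans h') _
      rw [symRes_ι, symRes_ι, symRes_ι, res_res]
  exact congr($this x)

end AffinePair

/-! ### Charts and the relative cotangent bundle -/

/-- A chart of a smooth morphism `q : W ⟶ S`: affine opens `U ⊆ W`, `V ⊆ S` with `q(U) ⊆ V` such
that the relative one-forms on `U` are free of finite rank. These cover `W` when `q` is smooth. -/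
structure Chart (q : W ⟶ S) extends AffinePair q where
  free : Module.Free Γ(W, U) toAffinePair.Cotangent
  finite : Module.Finite Γ(W, U) toAffinePair.Cotangent

namespace Chart
variable {q : W ⟶ S}

open SymProj

instance : Preorder (Chart q) := Preorder.lift Chart.toAffinePair

theorem exists_mem [Smooth q] (w : W) : ∃ c : Chart q, w ∈ c.U := by
  obtain ⟨V, hV, U, hU, hw, e, h⟩ := Smooth.exists_isStandardSmooth q w
  have h' := AffinePair.free_and_finite (c := ⟨V, hV, U, hU, e⟩) h
  exact ⟨⟨⟨V, hV, U, hU, e⟩, h'.1, h'.2⟩, hw⟩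

theorem exists_le (c d : Chart q) {w : W} (hc : w ∈ c.U) (hd : w ∈ d.U) :
    ∃ e : Chart q, e ≤ c ∧ e ≤ d ∧ w ∈ e.U := by
  obtain ⟨_, ⟨V, hV, rfl⟩, hwV, hV'⟩ := S.isBasis_affineOpens.exists_subset_of_mem_open
    (show q w ∈ ((c.V ⊓ d.V : S.Opens) : Set S) from ⟨c.le hc, d.le hd⟩) (c.V ⊓ d.V).2
  obtain ⟨_, ⟨U, hU, rfl⟩, hwU, hU'⟩ := W.isBasis_affineOpens.exists_subset_of_mem_open
    (show w ∈ ((c.U ⊓ d.U ⊓ q ⁻¹ᵁ V : W.Opens) : Set W) from ⟨⟨hc, hd⟩, hwV⟩)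
    (c.U ⊓ d.U ⊓ q ⁻¹ᵁ V).2
  let e : AffinePair q := ⟨V, hV, U, hU, fun x hx => (hU' hx).2⟩
  have h : e ≤ c.toAffinePair := ⟨fun x hx => (hV' hx).1, fun x hx => (hU' hx).1.1⟩
  have h' : e ≤ d.toAffinePair := ⟨fun x hx => (hV' hx).2, fun x hx => (hU' hx).1.2⟩
  exact ⟨⟨e, AffinePair.free_of_le h c.free, AffinePair.finite_of_le h c.finite⟩, h, h', hwU⟩

/-- The inclusion of a smaller chart. -/
def resSpec {c d : Chart q} (h : c ≤ d) : Spec Γ(W, c.U) ⟶ Spec Γ(W, d.U) :=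
  Spec.map (W.presheaf.map (homOfLE h.2).op)

theorem resSpec_fromSpec {c d : Chart q} (h : c ≤ d) :
    resSpec h ≫ d.isAffineOpen_U.fromSpec = c.isAffineOpen_U.fromSpec :=
  d.isAffineOpen_U.map_fromSpec c.isAffineOpen_U _

instance {c d : Chart q} (h : c ≤ d) : IsOpenImmersion (resSpec h) := by
  have : IsOpenImmersion (resSpec h ≫ d.isAffineOpen_U.fromSpec) := by
    rw [resSpec_fromSpec h]
    exact c.isAffineOpen_U.isOpenImmersion_fromSpec
  have := d.isAffineOpen_U.isOpenImmersion_fromSpec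
  exact IsOpenImmersion.of_comp _ d.isAffineOpen_U.fromSpec

theorem cover_directed (c d : Chart q)
    (x : ↥(pullback c.isAffineOpen_U.fromSpec d.isAffineOpen_U.fromSpec)) :
    ∃ (e : Chart q) (hc : e ≤ c) (hd : e ≤ d) (y : Spec Γ(W, e.U)),
      pullback.lift (resSpec hc) (resSpec hd)
        ((resSpec_fromSpec hc).trans (resSpec_fromSpec hd).symm) y = x := by
  have := c.isAffineOpen_U.isOpenImmersion_fromSpec
  have := d.isAffineOpen_U.isOpenImmersion_fromSpec
  let p := pullback.fst c.isAffineOpen_U.fromSpec d.isAffineOpen_U.fromSpec ≫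
    c.isAffineOpen_U.fromSpec
  have hc : p x ∈ c.U := c.isAffineOpen_U.range_fromSpec.le ⟨_, rfl⟩
  have hd : p x ∈ d.U := by
    refine d.isAffineOpen_U.range_fromSpec.le ?_
    simp only [p, pullback.condition]
    exact ⟨_, rfl⟩
  obtain ⟨e, hec, hed, hw⟩ := exists_le c d hc hd
  obtain ⟨y, hy⟩ : p x ∈ Set.range e.isAffineOpen_U.fromSpec := e.isAffineOpen_U.range_fromSpec.ge hw
  refine ⟨e, hec, hed, y, ?_⟩
  apply p.isOpenEmbedding.injective
  rw [← Scheme.Hom.comp_apply, pullback.lift_fst_assoc, resSpec_fromSpec, hy]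

variable (q) in
/-- The open cover of `W` by all charts. -/
abbrev cover [Smooth q] : W.OpenCover where
  I₀ := Chart q
  X c := Spec Γ(W, c.U)
  f c := c.isAffineOpen_U.fromSpec
  mem₀ := by
    rw [Scheme.presieve₀_mem_precoverage_iff]
    refine ⟨fun w => ?_, fun c => c.isAffineOpen_U.isOpenImmersion_fromSpec⟩
    obtain ⟨c, hc⟩ := exists_mem (q := q) w
    refine ⟨c, ?_⟩
    rw [c.isAffineOpen_U.range_fromSpec]
    exact hc

variable [Smooth q]

instance : (cover q).LocallyDirected where
  trans {c d} h := resSpec (leOfHom h)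
  trans_id c := by
    change Spec.map (W.presheaf.map (𝟙 _)) = _
    rw [CategoryTheory.Functor.map_id, Spec.map_id]
  trans_comp {c d e} h h' := by
    rw [resSpec, resSpec, resSpec, ← Spec.map_comp, ← Functor.map_comp]
    rfl
  w {c d} h := resSpec_fromSpec _
  directed {c d} x := by
    obtain ⟨e, hc, hd, y, h⟩ := cover_directed c d x
    exact ⟨e, homOfLE hc, homOfLE hd, y, h⟩
  property_trans {c d} h := inferInstanceAs (IsOpenImmersion (resSpec _))

variable (q) in
/-- The schemes `Proj (Sym T_{U/V})` over the charts, with their gluing. -/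
def projGluing : (cover q).RelativeGluingData where
  functor :=
    { obj c := Proj (AffinePair.symGrading (Chart.toAffinePair c))
      map {c d} h := Proj.map (AffinePair.symRes (leOfHom h))
        (AffinePair.symRes_irrelevant (leOfHom h) d.free d.finite)
      map_id c := by
        simp only [AffinePair.symRes_self]
        exact Proj.map_id
      map_comp {c d e} h h' := by
        simp only [← AffinePair.symRes_comp (leOfHom h) (leOfHom h')]
        exact Proj.map_comp _ _ _ _ }
  natTrans :=
    { app c := toSpec Γ(W, c.U) c.Tangent
      naturality {c d} h := (AffinePair.isPullback_projMap (leOfHom h) d.free d.finite).w }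
  equifibered {c d} h := AffinePair.isPullback_projMap (leOfHom h) d.free d.finite

variable (q) in
/-- The schemes `Spec (Sym T_{U/V})` over the charts, with their gluing. -/
def specGluing : (cover q).RelativeGluingData where
  functor :=
    { obj c := Spec (.of (SymmetricAlgebra Γ(W, c.U) c.Tangent))
      map {c d} h := Spec.map (CommRingCat.ofHom (AffinePair.symRes (leOfHom h)).toRingHom)
      map_id c := by
        rw [AffinePair.symRes_self]
        exact Spec.map_id _
      map_comp {c d e} h h' := by
        rw [← AffinePair.symRes_comp (leOfHom h) (leOfHom h'), ← Spec.map_comp]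
        rfl }
  natTrans :=
    { app c := Spec.map (CommRingCat.ofHom (algebraMap Γ(W, c.U) (SymmetricAlgebra Γ(W, c.U) c.Tangent)))
      naturality {c d} h := (AffinePair.isPullback_specMap (leOfHom h) d.free d.finite).w }
  equifibered {c d} h := AffinePair.isPullback_specMap (leOfHom h) d.free d.finite

end Chart

/-! ### The conormal variety, the relative singular scheme, and blowups -/

section Bundles
variable (q : W ⟶ S) [Smooth q]

/-- The relative cotangent bundle `T^∨(W/S)`, the relative spectrum of `Sym (T_{W/S})`. -/
def cotangentBundle : Scheme.{u} := (Chart.specGluing q).glued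

/-- The projection `T^∨(W/S) ⟶ W`. -/
def cotangentBundle.proj : cotangentBundle q ⟶ W := (Chart.specGluing q).toBase

/-- The open part of `T^∨(W/S)` over a chart. -/
def cotangentBundle.chart (c : Chart q) :
    Spec (.of (SymmetricAlgebra Γ(W, c.U) c.Tangent)) ⟶ cotangentBundle q :=
  (Chart.specGluing q).cover.f c

/-- The projectivised relative cotangent bundle `ℙT^∨(W/S)`: the relative `Proj` of `Sym (T_{W/S})`,
whose points over `w` are the lines in the cotangent space of the fibre at `w`. -/
def projCotangentBundle : Scheme.{u} := (Chart.projGluing q).glued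

/-- The projection `ℙT^∨(W/S) ⟶ W`. -/
def projCotangentBundle.proj : projCotangentBundle q ⟶ W := (Chart.projGluing q).toBase

/-- The open part of `ℙT^∨(W/S)` over a chart. -/
def projCotangentBundle.chart (c : Chart q) : Proj c.symGrading ⟶ projCotangentBundle q :=
  (Chart.projGluing q).cover.f c

end Bundles

/-- The set of points at which `f` is smooth, i.e. with a neighbourhood that is smooth over `S`. -/
def smoothLocus {X : Scheme.{u}} (f : X ⟶ S) : Set X :=
  {x | ∃ U : X.Opens, x ∈ U ∧ Smooth (U.ι ≫ f)}

variable {X : Scheme.{u}} (q : W ⟶ S) (i : X ⟶ W)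

variable {q} in
/-- The ideal of the closed subscheme `X` of `W` on a chart. -/
def Chart.equations (c : Chart q) : Ideal Γ(W, c.U) := i.ker.ideal ⟨c.U, c.isAffineOpen_U⟩

variable {q} in
/-- The derivative `t(F)` of a function `F` along a relative vector field `t`. -/
def Chart.deriv (c : Chart q) (t : c.Tangent) (F : Γ(W, c.U)) : Γ(W, c.U) :=
  t (KaehlerDifferential.D Γ(S, c.V) Γ(W, c.U) F)

/-- The set of all `(x, ξ)` in `T^∨(W/S)` with `x` in the smooth locus of `X/S` and `ξ ⊥ T_x X_{q(x)}`.
In a chart, a point `ξ` over `x` is a prime `𝔮` of `Sym T` over the prime of `x`; the value at `x` of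
a vector field `t` is tangent to the fibre of `X` when `t(F)` vanishes at `x` for all equations `F`
of `X`, and `ξ` annihilates it when `t ∈ 𝔮`. -/
def conormalSet [Smooth q] : Set (cotangentBundle q) :=
  {ξ | cotangentBundle.proj q ξ ∈ i '' smoothLocus (i ≫ q) ∧
    ∃ (c : Chart q) (𝔮 : PrimeSpectrum (SymmetricAlgebra Γ(W, c.U) c.Tangent)),
      cotangentBundle.chart q c 𝔮 = ξ ∧
      ∀ t : c.Tangent,
        (∀ F ∈ c.equations i, algebraMap _ _ (c.deriv t F) ∈ 𝔮.asIdeal) →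
        SymmetricAlgebra.ι Γ(W, c.U) c.Tangent t ∈ 𝔮.asIdeal}

/-- The relative conormal variety `Λ_{X/S}`. -/
def conormalVariety [Smooth q] : Set (cotangentBundle q) := closure (conormalSet q i)

/-- The image of `Λ` minus the zero section under the quotient map `T^∨(W/S) ∖ 0 → ℙT^∨(W/S)`. In a chart
this map sends a prime of `Sym T` to its homogeneous core, and the zero section consists of the
primes whose homogeneous core contains the irrelevant ideal, which is not a point of `Proj`. -/
def projectivization [Smooth q] (Λ : Set (cotangentBundle q)) : Set (projCotangentBundle q) :=
  {p | ∃ (c : Chart q) (𝔮 : PrimeSpectrum (SymmetricAlgebra Γ(W, c.U) c.Tangent))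
    (l : ProjectiveSpectrum c.symGrading),
      cotangentBundle.chart q c 𝔮 ∈ Λ ∧
      l.asHomogeneousIdeal = 𝔮.asIdeal.homogeneousCore c.symGrading ∧
      projCotangentBundle.chart q c l = p}

/-- The ideal of `ℙΛ_{X/S}` with its reduced structure. -/
def projConormalIdeal [Smooth q] : (projCotangentBundle q).IdealSheafData :=
  .vanishingIdeal ⟨closure (projectivization q (conormalVariety q i)), isClosed_closure⟩

/-- The projectivised relative conormal variety `ℙΛ_{X/S}`. -/
def projConormal [Smooth q] : Scheme.{u} := (projConormalIdeal q i).subscheme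

/-- The inclusion of `ℙΛ_{X/S}` into `ℙT^∨(W/S)`. -/
def projConormal.ι [Smooth q] : projConormal q i ⟶ projCotangentBundle q :=
  (projConormalIdeal q i).subschemeι

/-- The ideal sheaf of the relative singular scheme `Sing(X/S) ⊆ W`: it is generated by the local
equations `F` of `X` and their derivatives along relative vector fields. -/
def relSingIdeal : W.IdealSheafData :=
  sInf {J | ∀ c : Chart q, ∀ F ∈ c.equations i,
    F ∈ J.ideal ⟨c.U, c.isAffineOpen_U⟩ ∧
    ∀ t : c.Tangent, c.deriv t F ∈ J.ideal ⟨c.U, c.isAffineOpen_U⟩}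

/-- An ideal sheaf is invertible if it is locally generated by a nonzerodivisor. -/
def IsInvertibleIdeal {T : Scheme.{u}} (J : T.IdealSheafData) : Prop :=
  ∀ x : T, ∃ U : T.affineOpens, x ∈ U.1 ∧
    ∃ f ∈ nonZeroDivisors Γ(T, U.1), J.ideal U = Ideal.span {f}

/-- `b : B ⟶ X` is the blowup of `X` along the closed subscheme with ideal sheaf `I`: the inverse image
ideal of `I` on `B` is invertible, and `b` is universal with this property. -/
structure IsBlowup {B X : Scheme.{u}} (b : B ⟶ X) (I : X.IdealSheafData) : Prop where
  isInvertibleIdeal : IsInvertibleIdeal (I.comap b)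
  existsUnique_lift : ∀ (T : Scheme.{u}) (g : T ⟶ X), IsInvertibleIdeal (I.comap g) →
    ∃! h : T ⟶ B, h ≫ b = g

end RelConormal

end

/-!
On a chart of `W` the divisor `X` has one equation `F`, because a height one prime in a smooth
algebra over an algebraically closed field is locally principal: its extension to the completion,
a power series ring, is principal by unique factorization, and principality descends along the
faithfully flat completion. The relative differential `t ↦ ∂ₜF` of `F` is nonzero at the generic
point of `X`, so `ℙΛ` is the closure of the single point of `Proj (Sym T)` over that generic point
which it defines.

Consequently a morphism to a standard open `D₊(t)` of `Proj (Sym T)` lands in `ℙΛ` exactly when it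
satisfies every homogeneous relation between the functions `∂ₜF` on `X`: locally `ℙΛ` is `Proj` of
the image of `Sym T → 𝒪_X[z]`, `t ↦ ∂ₜF · z`, which is the Rees algebra of the ideal of
`Sing (X/S)`. Hence that ideal is generated by `∂ₜF` on `ℙΛ ∩ D₊(t)`. Conversely, if its inverse
image along `g : Y ⟶ X` is invertible, then locally on `Y` some `∂ₜF` is a regular generator, and
the quotients `∂ₛF / ∂ₜF` are the coordinates of the only lift of `g` to `ℙΛ`.
-/

noncomputable section

namespace RelConormal

/-! ### Unique factorization in power series rings -/

section PowerSeries

open IsLocalRing MvPowerSeries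

section Field

variable {k : Type*} [Field k]

lemma idealOfVars_eq_ker_constantCoeff (n : ℕ) :
    MvPolynomial.idealOfVars (Fin n) k = RingHom.ker MvPolynomial.constantCoeff := by
  ext p
  rw [← pow_one (MvPolynomial.idealOfVars (Fin n) k), MvPolynomial.mem_pow_idealOfVars_iff',
    RingHom.mem_ker, MvPolynomial.constantCoeff_eq]
  refine ⟨fun H => H 0 (by simp), fun H d hd => ?_⟩
  rw [Nat.lt_one_iff, Finsupp.degree_eq_zero_iff] at hd
  rw [hd, H]

lemma isMaximal_idealOfVars (n : ℕ) : (MvPolynomial.idealOfVars (Fin n) k).IsMaximal := by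
  rw [idealOfVars_eq_ker_constantCoeff]
  exact RingHom.ker_isMaximal_of_surjective _ fun a => ⟨MvPolynomial.C a, by simp⟩

lemma map_idealOfVars_eq_comap_toAdicCompletionAlgEquiv (n : ℕ) :
    (MvPolynomial.idealOfVars (Fin n) k).map
        (algebraMap (MvPolynomial (Fin n) k) (MvPowerSeries (Fin n) k)) =
      ((MvPolynomial.idealOfVars (Fin n) k).map (algebraMap (MvPolynomial (Fin n) k)
        (AdicCompletion (MvPolynomial.idealOfVars (Fin n) k) (MvPolynomial (Fin n) k)))).comap
          (toAdicCompletionAlgEquiv (Fin n) k).toRingEquiv := by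
  rw [← Ideal.map_symm, ← (toAdicCompletionAlgEquiv (Fin n) k).symm.toAlgHom.comp_algebraMap,
    ← Ideal.map_map]
  rfl

lemma maximalIdeal_eq_map_idealOfVars (n : ℕ) :
    maximalIdeal (MvPowerSeries (Fin n) k) =
      (MvPolynomial.idealOfVars (Fin n) k).map
        (algebraMap (MvPolynomial (Fin n) k) (MvPowerSeries (Fin n) k)) := by
  have hmax := isMaximal_idealOfVars (k := k) n
  have := AdicCompletion.isMaximal_map_of_le _ (MvPolynomial.idealOfVars (Fin n) k) le_rfl
    (IsNoetherian.noetherian _)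
  refine (eq_maximalIdeal ?_).symm
  rw [map_idealOfVars_eq_comap_toAdicCompletionAlgEquiv]
  exact Ideal.comap_isMaximal_of_equiv _

instance isAdicComplete_maximalIdeal (n : ℕ) :
    IsAdicComplete (maximalIdeal (MvPowerSeries (Fin n) k)) (MvPowerSeries (Fin n) k) := by
  let e := toAdicCompletionAlgEquiv (Fin n) k
  rw [maximalIdeal_eq_map_idealOfVars, ← e.symm.toAlgHom.comp_algebraMap, ← Ideal.map_map]
  exact (IsAdicComplete.congr_ringEquiv _ e.symm.toRingEquiv).mpr
    (AdicCompletion.isAdicComplete_self _ (IsNoetherian.noetherian _))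

instance flat_mvPowerSeries (n : ℕ) :
    Module.Flat (MvPolynomial (Fin n) k) (MvPowerSeries (Fin n) k) :=
  .of_linearEquiv (toAdicCompletionAlgEquiv (Fin n) k).toLinearEquiv

/-- The restriction of a power series to the first coordinate axis. -/
def toFirstAxis (n : ℕ) : MvPowerSeries (Fin (n + 1)) k →+* PowerSeries k :=
  (PowerSeries.map constantCoeff).comp (finSuccEquiv k n).toRingEquiv.toRingHom

lemma toFirstAxis_apply (n : ℕ) (f : MvPowerSeries (Fin (n + 1)) k) :
    toFirstAxis n f = PowerSeries.map constantCoeff (finSuccEquiv k n f) := rfl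

lemma toFirstAxis_X_zero (n : ℕ) : toFirstAxis (k := k) n (X 0) = PowerSeries.X := by
  rw [toFirstAxis_apply, finSuccEquiv_X_zero, PowerSeries.map_X]

lemma toFirstAxis_X_succ (n : ℕ) (j : Fin n) : toFirstAxis (k := k) n (X j.succ) = 0 := by
  rw [toFirstAxis_apply, finSuccEquiv_X_succ, PowerSeries.map_C, constantCoeff_X, map_zero]

lemma toFirstAxis_C (n : ℕ) (a : k) : toFirstAxis (k := k) n (C a) = PowerSeries.C a := by
  rw [toFirstAxis_apply, finSuccEquiv_C, PowerSeries.map_C, constantCoeff_C]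

lemma coeff_toFirstAxis (n d : ℕ) (f : MvPowerSeries (Fin (n + 1)) k) :
    PowerSeries.coeff d (toFirstAxis n f) = coeff (Finsupp.single 0 d) f := by
  rw [toFirstAxis_apply, PowerSeries.coeff_map, ← coeff_zero_eq_constantCoeff_apply,
    coeff_coeff_finSuccEquiv]
  congr
  ext j
  refine Fin.cases ?_ (fun j => ?_) j <;> simp

/-- The images of the coordinates under the linear change of coordinates that maps the first
coordinate axis to the line spanned by `a` and fixes the other coordinate vectors. -/
def linearChange {n : ℕ} (a : Fin (n + 1) → k) : Fin (n + 1) → MvPowerSeries (Fin (n + 1)) k :=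
  Fin.cons (C (a 0) * X 0) fun j => C (a j.succ) * X 0 + X j.succ

lemma linearChange_zero {n : ℕ} (a : Fin (n + 1) → k) : linearChange a 0 = C (a 0) * X 0 := rfl

lemma linearChange_succ {n : ℕ} (a : Fin (n + 1) → k) (j : Fin n) :
    linearChange a j.succ = C (a j.succ) * X 0 + X j.succ := rfl

lemma hasSubst_linearChange {n : ℕ} (a : Fin (n + 1) → k) : HasSubst (linearChange a) := by
  refine hasSubst_of_constantCoeff_zero fun j => ?_
  refine Fin.cases ?_ (fun j => ?_) j <;> simp [linearChange]

lemma toFirstAxis_linearChange {n : ℕ} (a : Fin (n + 1) → k) (j : Fin (n + 1)) :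
    toFirstAxis n (linearChange a j) = PowerSeries.C (a j) * PowerSeries.X := by
  refine Fin.cases ?_ (fun j => ?_) j <;>
    simp [linearChange, toFirstAxis_C, toFirstAxis_X_zero, toFirstAxis_X_succ]

lemma substAlgHom_linearChange_linearChange {n : ℕ} (a b : Fin (n + 1) → k)
    (h₀ : a 0 * b 0 = 1) (h : ∀ j : Fin n, a j.succ * b 0 + b j.succ = 0) (j : Fin (n + 1)) :
    substAlgHom (hasSubst_linearChange b) (linearChange a j) = X j := by
  have substAlgHom_C (r : k) : substAlgHom (hasSubst_linearChange b) (C r) = C r :=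
    (substAlgHom (hasSubst_linearChange b)).commutes r
  refine Fin.cases ?_ (fun j => ?_) j
  · rw [linearChange_zero, map_mul, substAlgHom_C, substAlgHom_X, linearChange_zero, ← mul_assoc,
      ← map_mul, h₀, map_one, one_mul]
  · rw [linearChange_succ, map_add, map_mul, substAlgHom_C, substAlgHom_X, substAlgHom_X,
      linearChange_zero, linearChange_succ, ← mul_assoc, ← map_mul, ← add_assoc, ← add_mul,
      ← map_add, h, map_zero, zero_mul, zero_add]

lemma substAlgHom_linearChange_comp {n : ℕ} (a b : Fin (n + 1) → k) (h₀ : a 0 * b 0 = 1)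
    (h : ∀ j : Fin n, a j.succ * b 0 + b j.succ = 0) :
    (substAlgHom (hasSubst_linearChange b)).toRingHom.comp
      (substAlgHom (hasSubst_linearChange a)).toRingHom = RingHom.id _ := by
  ext1 f
  change substAlgHom (hasSubst_linearChange b) (substAlgHom (hasSubst_linearChange a) f) = f
  rw [substAlgHom_comp_substAlgHom_apply, substAlgHom_apply]
  simp only [substAlgHom_linearChange_linearChange a b h₀ h]
  exact congrFun subst_self f

/-- The automorphism of the power series ring that substitutes `linearChange a`. -/
def linearEquiv {n : ℕ} (a : Fin (n + 1) → k) (h : a 0 ≠ 0) :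
    MvPowerSeries (Fin (n + 1)) k ≃+* MvPowerSeries (Fin (n + 1)) k :=
  RingEquiv.ofRingHom (substAlgHom (hasSubst_linearChange a)).toRingHom
    (substAlgHom (hasSubst_linearChange
      (Fin.cons (a 0)⁻¹ fun j => - a j.succ * (a 0)⁻¹ : Fin (n + 1) → k))).toRingHom
    (substAlgHom_linearChange_comp _ _ (by simp [h]) fun j => by simp [h])
    (substAlgHom_linearChange_comp _ _ (by simp [h]) fun j => by simp)

lemma linearEquiv_apply {n : ℕ} (a : Fin (n + 1) → k) (h : a 0 ≠ 0)
    (f : MvPowerSeries (Fin (n + 1)) k) : linearEquiv a h f = subst (linearChange a) f :=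
  substAlgHom_apply (hasSubst_linearChange a) f

lemma coeff_single_prod_linearChange {n : ℕ} (a : Fin (n + 1) → k) (d : ℕ)
    (e : Fin (n + 1) →₀ ℕ) :
    coeff (Finsupp.single 0 d) (e.prod fun s m => linearChange a s ^ m) =
      if e.degree = d then e.prod fun j m => a j ^ m else 0 := by
  rw [← coeff_toFirstAxis, Finsupp.prod, map_prod]
  simp only [map_pow, toFirstAxis_linearChange, mul_pow, Finset.prod_mul_distrib,
    Finset.prod_pow_eq_pow_sum]
  rw [← Finset.prod_congr rfl (fun i _ => map_pow PowerSeries.C (a i) (e i)), ← map_prod,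
    PowerSeries.coeff_C_mul, PowerSeries.coeff_X_pow, Finsupp.degree_apply]
  simp [Finsupp.prod, eq_comm]

lemma coeff_toFirstAxis_linearEquiv {n : ℕ} (a : Fin (n + 1) → k) (h : a 0 ≠ 0)
    (f : MvPowerSeries (Fin (n + 1)) k) (d : ℕ) :
    PowerSeries.coeff d (toFirstAxis n (linearEquiv a h f)) =
      ∑ e ∈ Finset.finsuppAntidiag Finset.univ d, coeff e f * e.prod fun j m => a j ^ m := by
  rw [coeff_toFirstAxis, linearEquiv_apply, coeff_subst (hasSubst_linearChange a)]
  simp only [coeff_single_prod_linearChange, smul_eq_mul]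
  rw [finsum_eq_sum_of_support_subset (s := Finset.finsuppAntidiag Finset.univ d)]
  · refine Finset.sum_congr rfl fun e he => ?_
    rw [Finset.mem_finsuppAntidiag] at he
    rw [if_pos]
    rw [← he.1, Finsupp.degree_eq_sum]
  · intro e he
    simp only [Function.mem_support, ne_eq, mul_eq_zero, ite_eq_right_iff, not_or,
      Classical.not_imp] at he
    rw [Finset.mem_coe, Finset.mem_finsuppAntidiag]
    refine ⟨?_, Finset.subset_univ _⟩
    rw [← he.2.1, Finsupp.degree_eq_sum]

lemma exists_toFirstAxis_linearEquiv_ne_zero [Infinite k] {n : ℕ}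
    {f : MvPowerSeries (Fin (n + 1)) k} (hf : f ≠ 0) :
    ∃ (a : Fin (n + 1) → k) (h : a 0 ≠ 0), toFirstAxis n (linearEquiv a h f) ≠ 0 := by
  obtain ⟨e₀, he₀⟩ : ∃ e, coeff e f ≠ 0 := by
    by_contra! H
    exact hf (ext fun e => by simp [H])
  let g : MvPolynomial (Fin (n + 1)) k :=
    ∑ e ∈ Finset.finsuppAntidiag Finset.univ e₀.degree, MvPolynomial.monomial e (coeff e f)
  have coeff_g : MvPolynomial.coeff e₀ g = coeff e₀ f := by
    simp only [g, MvPolynomial.coeff_sum, MvPolynomial.coeff_monomial]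
    rw [Finset.sum_ite_eq', if_pos (by simp [Finset.mem_finsuppAntidiag, Finsupp.degree_eq_sum])]
  have hg : MvPolynomial.X 0 * g ≠ 0 :=
    mul_ne_zero (MvPolynomial.X_ne_zero _) fun H => he₀ (by rw [← coeff_g, H]; rfl)
  obtain ⟨a, ha⟩ : ∃ a, MvPolynomial.eval a (MvPolynomial.X 0 * g) ≠ 0 := by
    by_contra! H
    exact hg (MvPolynomial.funext fun a => by simpa using H a)
  simp only [map_mul, MvPolynomial.eval_X, mul_ne_zero_iff] at ha
  refine ⟨a, ha.1, fun H => ha.2 ?_⟩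
  simp only [g, map_sum, MvPolynomial.eval_monomial]
  rw [← coeff_toFirstAxis_linearEquiv a ha.1, H, map_zero]

end Field

section Weierstrass

variable {A : Type*} [CommRing A] [IsLocalRing A]

lemma isDistinguishedAt_of_dvd {g p : Polynomial A}
    (hg : g.IsDistinguishedAt (maximalIdeal A)) (hp : p.Monic) (hpg : p ∣ g) :
    p.IsDistinguishedAt (maximalIdeal A) := by
  let : Field (A ⧸ maximalIdeal A) := Ideal.Quotient.field _
  have hdvd : p.map (Ideal.Quotient.mk (maximalIdeal A)) ∣ Polynomial.X ^ g.natDegree :=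
    hg.map_eq_X_pow ▸ Polynomial.map_dvd _ hpg
  obtain ⟨j, -, hj⟩ := (dvd_prime_pow Polynomial.prime_X _).mp hdvd
  have hmap := Polynomial.eq_of_monic_of_associated (hp.map _) (Polynomial.monic_X_pow j) hj
  have hdeg : j = p.natDegree := by
    rw [← hp.natDegree_map (Ideal.Quotient.mk (maximalIdeal A)), hmap, Polynomial.natDegree_X_pow]
  refine ⟨⟨fun {m} hm => ?_⟩, hp⟩
  rw [← Ideal.Quotient.eq_zero_iff_mem, ← Polynomial.coeff_map, hmap, Polynomial.coeff_X_pow,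
    if_neg (by omega)]

variable [IsAdicComplete (maximalIdeal A) A]

lemma prime_coe_of_isDistinguishedAt {p : Polynomial A}
    (h : p.IsDistinguishedAt (maximalIdeal A)) (hp : Prime p) : Prime (p : PowerSeries A) := by
  have h₀ : (p : PowerSeries A) ≠ 0 := by
    rw [Ne, Polynomial.coe_eq_zero_iff]
    exact hp.ne_zero
  rw [← Ideal.span_singleton_prime h₀, ← Ideal.Quotient.isDomain_iff_prime]
  have := (Ideal.Quotient.isDomain_iff_prime _).mpr
    ((Ideal.span_singleton_prime hp.ne_zero).mpr hp)
  exact h.algEquivQuotient.symm.toMulEquiv.isDomain _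

variable [IsDomain A]

lemma prime_coe_of_dvd_isDistinguishedAt {g p : Polynomial A}
    (hg : g.IsDistinguishedAt (maximalIdeal A)) (hp : Prime p) (hpg : p ∣ g) :
    Prime (p : PowerSeries A) := by
  obtain ⟨u, hu⟩ : IsUnit p.leadingCoeff := by
    obtain ⟨r, rfl⟩ := hpg
    refine .of_mul_eq_one r.leadingCoeff ?_
    rw [← Polynomial.leadingCoeff_mul]
    exact hg.monic
  have hC : IsUnit (Polynomial.C (↑u⁻¹ : A)) := (Units.isUnit _).map _
  have hassoc := associated_unit_mul_left p _ hC
  have hmonic : (Polynomial.C (↑u⁻¹ : A) * p).Monic := by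
    simp only [Polynomial.Monic, Polynomial.leadingCoeff_mul, Polynomial.leadingCoeff_C, ← hu,
      Units.inv_mul]
  have hprime := prime_coe_of_isDistinguishedAt
    (isDistinguishedAt_of_dvd hg hmonic (hassoc.dvd.trans hpg)) (hassoc.symm.prime hp)
  rw [Polynomial.coe_mul] at hprime
  exact (associated_unit_mul_left _ _
    (hC.map Polynomial.coeToPowerSeries.ringHom)).prime hprime

lemma exists_prime_mem_of_map_residue_ne_zero [UniqueFactorizationMonoid A]
    {P : Ideal (PowerSeries A)} [hP : P.IsPrime] {f : PowerSeries A} (hf : f ∈ P)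
    (hf₀ : f.map (residue A) ≠ 0) : ∃ p ∈ P, Prime p := by
  obtain ⟨g, u, H⟩ := PowerSeries.exists_isWeierstrassFactorization hf₀
  have hgP : (g : PowerSeries A) ∈ P :=
    (hP.mem_or_mem (H.eq_mul ▸ hf)).resolve_right fun h =>
      hP.ne_top (P.eq_top_of_isUnit_mem h H.isUnit)
  obtain ⟨v, hv⟩ := UniqueFactorizationMonoid.factors_prod H.isDistinguishedAt.monic.ne_zero
  have hprod : (UniqueFactorizationMonoid.factors g).prod ∈
      P.comap Polynomial.coeToPowerSeries.ringHom := by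
    rw [(Units.eq_mul_inv_iff_mul_eq v).mpr hv]
    exact Ideal.mul_mem_right _ _ hgP
  obtain ⟨p, hp, hpP⟩ := (hP.comap _).multiset_prod_mem_iff_exists_mem _ |>.mp hprod
  exact ⟨_, hpP, prime_coe_of_dvd_isDistinguishedAt H.isDistinguishedAt
    (UniqueFactorizationMonoid.prime_of_factor p hp)
    (UniqueFactorizationMonoid.dvd_of_mem_factors hp)⟩

end Weierstrass

lemma map_residue_finSuccEquiv_ne_zero {k : Type*} [Field k] {n : ℕ}
    {f : MvPowerSeries (Fin (n + 1)) k} (hf : toFirstAxis n f ≠ 0) :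
    (finSuccEquiv k n f).map (residue (MvPowerSeries (Fin n) k)) ≠ 0 := by
  refine fun H => hf (PowerSeries.ext fun d => ?_)
  have := congrArg (PowerSeries.coeff d) H
  rw [PowerSeries.coeff_map, map_zero, residue_eq_zero_iff, mem_maximalIdeal, mem_nonunits_iff,
    MvPowerSeries.isUnit_iff_constantCoeff, isUnit_iff_ne_zero, not_not] at this
  rwa [map_zero, toFirstAxis_apply, PowerSeries.coeff_map]

instance uniqueFactorizationMonoid_mvPowerSeries {k : Type*} [Field k] [Infinite k] (n : ℕ) :
    UniqueFactorizationMonoid (MvPowerSeries (Fin n) k) := by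
  induction n with
  | zero =>
    exact (isEmptyEquiv (Fin 0) k).symm.toMulEquiv.uniqueFactorizationMonoid inferInstance
  | succ n ih =>
    have : IsDomain (MvPowerSeries (Fin (n + 1)) k) := NoZeroDivisors.to_isDomain _
    have : IsDomain (MvPowerSeries (Fin n) k) := NoZeroDivisors.to_isDomain _
    refine UniqueFactorizationMonoid.iff_exists_prime_mem_of_isPrime.mpr fun P hP hP' => ?_
    obtain ⟨f, hfP, hf⟩ := Submodule.exists_mem_ne_zero_of_ne_bot hP
    obtain ⟨a, ha, hfa⟩ := exists_toFirstAxis_linearEquiv_ne_zero hf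
    let E : MvPowerSeries (Fin (n + 1)) k ≃+* PowerSeries (MvPowerSeries (Fin n) k) :=
      (linearEquiv a ha).trans (finSuccEquiv k n).toRingEquiv
    have := hP'.comap E.symm
    obtain ⟨p, hpP, hp⟩ := exists_prime_mem_of_map_residue_ne_zero (P := P.comap E.symm)
      (Ideal.mem_comap.mpr ((E.symm_apply_apply f).symm ▸ hfP))
      (map_residue_finSuccEquiv_ne_zero hfa)
    exact ⟨E.symm p, hpP, (MulEquiv.prime_iff E.symm.toMulEquiv).mpr hp⟩

end PowerSeries

/-! ### Primes of height one in smooth algebras -/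

section HeightOne

open IsLocalRing

section Flat

variable {A B : Type*} [CommRing A] [CommRing B] [Algebra A B] [Module.Flat A B]

lemma exists_sum_of_mul_eq_mul_of_flat {f g : A} {b b' : B}
    (h : b * algebraMap A B g = b' * algebraMap A B f) :
    ∃ (l : ℕ) (a : Fin l → A) (y : Fin l → B), (∀ j, f ∣ a j * g) ∧
      b = ∑ j, algebraMap A B (a j) * y j := by
  obtain ⟨l, a, y, hb, ha⟩ := Module.Flat.isTrivialRelation_of_sum_smul_eq_zero
    (f := ![g, -f]) (x := ![b, b']) (by
      simp only [Fin.sum_univ_two, Matrix.cons_val_zero, Matrix.cons_val_one, Algebra.smul_def,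
        map_neg]
      linear_combination h)
  refine ⟨l, a 0, y, fun j => ⟨a 1 j, ?_⟩, by simpa [Algebra.smul_def] using hb 0⟩
  have := ha j
  simp only [Fin.sum_univ_two, Matrix.cons_val_zero, Matrix.cons_val_one] at this
  linear_combination this

variable {P : Ideal A}

lemma exists_mul_mem_span_of_map_eq_span [IsLocalRing B] {F : A}
    (hF : P.map (algebraMap A B) = Ideal.span {algebraMap A B F}) {y : A} (hy : y ∈ P) :
    ∃ s, algebraMap A B s ∉ maximalIdeal B ∧ s * y ∈ Ideal.span {F} := by
  obtain ⟨c, hc⟩ := Ideal.mem_span_singleton.mp (hF.le (Ideal.mem_map_of_mem _ hy))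
  obtain ⟨l, a, z, ha, hz⟩ := exists_sum_of_mul_eq_mul_of_flat (f := F) (g := y) (b := 1) (b' := c)
    (by rw [hc, one_mul, mul_comm])
  by_contra! H
  refine (mem_maximalIdeal (1 : B)).mp ?_ isUnit_one
  rw [hz]
  refine Submodule.sum_mem _ fun j _ => Ideal.mul_mem_right _ _ ?_
  by_contra h
  exact H _ h (Ideal.mem_span_singleton.mpr (ha j))

lemma exists_forall_mul_mem_span_of_map_eq_span [IsLocalRing B] (hP : P.FG) {F : A}
    (hF : P.map (algebraMap A B) = Ideal.span {algebraMap A B F}) :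
    ∃ s, algebraMap A B s ∉ maximalIdeal B ∧ ∀ y ∈ P, s * y ∈ Ideal.span {F} := by
  classical
  obtain ⟨t, rfl⟩ := hP
  choose! σ hσ hσF using
    fun y => exists_mul_mem_span_of_map_eq_span hF (y := y)
  refine ⟨∏ y ∈ t, σ y, ?_, fun y hy => ?_⟩
  · rw [map_prod, Ideal.IsPrime.prod_mem_iff]
    rintro ⟨y, hy, h⟩
    exact hσ y (Submodule.subset_span hy) h
  · induction hy using Submodule.span_induction with
    | mem y hy =>
      rw [← Finset.prod_erase_mul _ _ hy, mul_assoc]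
      exact Ideal.mul_mem_left _ _ (hσF y (Submodule.subset_span hy))
    | zero => simp
    | add x y _ _ hx hy => rw [mul_add]; exact add_mem hx hy
    | smul a x _ hx => rw [smul_eq_mul, mul_left_comm]; exact Ideal.mul_mem_left _ _ hx

end Flat

-- If no element of `P` generated `P B`, then `P B ⊆ 𝔪 P B`, contradicting Nakayama.
lemma exists_map_eq_span_algebraMap {A B : Type*} [CommRing A] [CommRing B] [IsDomain B]
    [IsLocalRing B] [Algebra A B] {P : Ideal A} {b : B} (hb : b ≠ 0)
    (hP : P.map (algebraMap A B) = Ideal.span {b}) :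
    ∃ F ∈ P, P.map (algebraMap A B) = Ideal.span {algebraMap A B F} := by
  suffices ∃ F ∈ P, Associated b (algebraMap A B F) by
    obtain ⟨F, hF, hbF⟩ := this
    exact ⟨F, hF, hP.trans (Ideal.span_singleton_eq_span_singleton.mpr hbF)⟩
  by_contra! H
  have hle : P.map (algebraMap A B) ≤ maximalIdeal B * Ideal.span {b} := by
    refine Ideal.map_le_iff_le_comap.mpr fun a ha => ?_
    obtain ⟨c, hc⟩ := Ideal.mem_span_singleton.mp (hP.le (Ideal.mem_map_of_mem _ ha))
    rw [Ideal.mem_comap, hc, mul_comm b c]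
    refine Ideal.mul_mem_mul (I := maximalIdeal B) ?_ (Ideal.mem_span_singleton_self b)
    rw [mem_maximalIdeal, mem_nonunits_iff]
    rintro ⟨u, rfl⟩
    exact H a ha ⟨u, hc.symm⟩
  obtain ⟨z, hz, hzb⟩ := Ideal.mem_mul_span_singleton.mp
    (hle (hP.ge (Ideal.mem_span_singleton_self _)))
  have hz₁ : z = 1 := mul_right_cancel₀ hb (by rw [hzb, one_mul])
  exact (mem_maximalIdeal z).mp hz (hz₁ ▸ isUnit_one)

section Domain

variable {A : Type*} [CommRing A] [IsDomain A] [IsNoetherianRing A] (P : Ideal A) [P.IsPrime]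

lemma exists_mem_iff_dvd_mul_of_height_eq_one (hP : P.height = 1) :
    ∃ f g : A, f ≠ 0 ∧ ∀ a, a ∈ P ↔ f ∣ a * g := by
  obtain ⟨f, hfP, hf⟩ := Submodule.exists_mem_ne_zero_of_ne_bot (P.ne_bot_of_height_eq_one hP)
  have hmin : P ∈ (Module.annihilator A (A ⧸ Ideal.span {f})).minimalPrimes := by
    rw [Ideal.annihilator_quotient]
    refine ⟨⟨inferInstance, (Ideal.span_singleton_le_iff_mem P).mpr hfP⟩, fun Q hQ hle => ?_⟩
    by_contra hlt
    have := hQ.1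
    have hQP : Q.height < 1 := hP ▸ Ideal.height_strict_mono_of_isPrime_of_isPrime
      (lt_of_le_not_ge hle hlt)
    rw [Order.lt_one_iff, Ideal.height_eq_zero_iff_eq_bot] at hQP
    exact hf (by simpa [hQP] using hQ.2)
  obtain ⟨-, x, hx⟩ := isAssociatedPrime_iff.mp
    (Module.associatedPrimes.minimalPrimes_annihilator_subset_associatedPrimes A _ hmin)
  obtain ⟨g, rfl⟩ := Ideal.Quotient.mk_surjective x
  refine ⟨f, g, hf, fun a => ?_⟩
  rw [hx, Submodule.mem_colon_singleton, Submodule.mem_bot, ← Ideal.mem_span_singleton,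
    ← Ideal.Quotient.eq_zero_iff_mem, map_mul]
  rfl

variable {B : Type*} [CommRing B] [IsDomain B] [Algebra A B] [Module.Flat A B]

-- `P = (f : g)`, and forming colon ideals commutes with flat base change, so `P B` is generated
-- by `f / gcd(f, g)`.
lemma exists_map_eq_span_of_height_eq_one [UniqueFactorizationMonoid B] (hP : P.height = 1) :
    ∃ b : B, b ≠ 0 ∧ P.map (algebraMap A B) = Ideal.span {b} := by
  obtain ⟨f, g, hf, hfg⟩ := exists_mem_iff_dvd_mul_of_height_eq_one P hP
  have hf_map : algebraMap A B f ≠ 0 := by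
    rwa [Ne, map_eq_zero_iff _ (FaithfulSMul.algebraMap_injective A B)]
  obtain ⟨f', g', d, hrel, hfd, hgd⟩ := UniqueFactorizationMonoid.exists_reduced_factors _ hf_map
    (algebraMap A B g)
  obtain ⟨hd, hf'⟩ : d ≠ 0 ∧ f' ≠ 0 := by rwa [← mul_ne_zero_iff, hfd]
  refine ⟨f', hf', le_antisymm (Ideal.map_le_iff_le_comap.mpr fun a ha => ?_)
    ((Ideal.span_singleton_le_iff_mem _).mpr ?_)⟩
  · rw [Ideal.mem_comap, Ideal.mem_span_singleton]
    refine hrel.dvd_of_dvd_mul_right ?_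
    have := map_dvd (algebraMap A B) ((hfg a).mp ha)
    rw [map_mul, ← hfd, ← hgd, mul_left_comm] at this
    exact (mul_dvd_mul_iff_left hd).mp this
  · obtain ⟨l, a, y, ha, hsum⟩ := exists_sum_of_mul_eq_mul_of_flat (f := f) (g := g)
      (b := f') (b' := g') (by rw [← hfd, ← hgd]; ring)
    rw [hsum]
    exact Submodule.sum_mem _ fun j _ =>
      Ideal.mul_mem_right _ _ (Ideal.mem_map_of_mem _ ((hfg _).mpr (ha j)))

end Domain

lemma exists_locally_eq_span_of_flat {A B : Type*} [CommRing A] [IsDomain A] [IsNoetherianRing A]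
    [CommRing B] [IsDomain B] [UniqueFactorizationMonoid B] [IsLocalRing B] {φ : A →+* B}
    (hφ : φ.Flat) (P : Ideal A) [P.IsPrime] (hP : P.height = 1) :
    ∃ F ∈ P, ∃ s ∉ (maximalIdeal B).comap φ, ∀ y ∈ P, s * y ∈ Ideal.span {F} := by
  algebraize [φ]
  obtain ⟨b, hb, hPb⟩ := exists_map_eq_span_of_height_eq_one (B := B) P hP
  obtain ⟨F, hFP, hF⟩ := exists_map_eq_span_algebraMap hb hPb
  exact ⟨F, hFP, exists_forall_mul_mem_span_of_map_eq_span (IsNoetherian.noetherian P) hF⟩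

lemma flat_of_etale_of_flat {R A S : Type*} [CommRing R] [CommRing A] [CommRing S] [Algebra R A]
    [Algebra R S] [Algebra.Etale R A] [Module.Flat R S] (g : A →ₐ[R] S) : g.toRingHom.Flat := by
  let fold : S ⊗[R] A →ₐ[S] S := Algebra.TensorProduct.lift (AlgHom.id _ _) g fun _ _ => .all _ _
  have flat_fold : fold.toRingHom.Flat := by
    algebraize [fold.toRingHom]
    have : IsScalarTower S (S ⊗[R] A) S := .of_algebraMap_eq' fold.comp_algebraMap.symm
    have : Algebra.Etale (S ⊗[R] A) S := Algebra.Etale.of_restrictScalars S _ _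
    change Module.Flat (S ⊗[R] A) S
    infer_instance
  have flat_includeRight :
      (Algebra.TensorProduct.includeRight : A →ₐ[R] S ⊗[R] A).toRingHom.Flat := by
    have : (algebraMap A (A ⊗[R] S)).Flat := by
      rw [RingHom.flat_algebraMap_iff]
      infer_instance
    convert! this.comp (RingHom.Flat.of_bijective
      (f := (Algebra.TensorProduct.comm R A S).toRingEquiv.toRingHom)
      (Algebra.TensorProduct.comm R A S).bijective)
  have factor : g.toRingHom = fold.toRingHom.comp
      (Algebra.TensorProduct.includeRight : A →ₐ[R] S ⊗[R] A).toRingHom :=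
    RingHom.ext fun a => by simp [fold]
  rw [factor]
  exact flat_includeRight.comp flat_fold

section AlgClosed

variable {k A : Type u} [Field k] [CommRing A] [Algebra k A]

lemma exists_algHom_ker_eq [IsAlgClosed k] [Algebra.FiniteType k A] (m : Ideal A) [m.IsMaximal] :
    ∃ ev : A →ₐ[k] k, RingHom.ker ev = m := by
  have hbij : Function.Bijective (algebraMap k (A ⧸ m)) := by
    let := Ideal.Quotient.field m
    have : Module.Finite k (A ⧸ m) := finite_of_finite_type_of_isJacobsonRing k (A ⧸ m)
    exact ⟨(algebraMap k (A ⧸ m)).injective, IsAlgClosed.algebraMap_bijective_of_isIntegral.2⟩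
  let ε : (A ⧸ m) ≃ₐ[k] k := (AlgEquiv.ofBijective (Algebra.ofId k (A ⧸ m)) hbij).symm
  refine ⟨ε.toAlgHom.comp (Ideal.Quotient.mkₐ k m), ?_⟩
  ext a
  change ε (Ideal.Quotient.mk m a) = 0 ↔ _
  rw [EmbeddingLike.map_eq_zero_iff, Ideal.Quotient.eq_zero_iff_mem]

lemma exists_etale_mvPolynomial_eval_eq_zero [Algebra.IsStandardSmooth k A] (ev : A →ₐ[k] k) :
    ∃ (n : ℕ) (ψ : MvPolynomial (Fin n) k →ₐ[k] A), ψ.toRingHom.Etale ∧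
      ∀ j, ev (ψ (.X j)) = 0 := by
  obtain ⟨n, ψ, hψ, hetale⟩ := RingHom.IsStandardSmooth.exists_etale_mvPolynomial
    (f := algebraMap k A) (by rwa [RingHom.isStandardSmooth_algebraMap])
  let ψₐ : MvPolynomial (Fin n) k →ₐ[k] A := { ψ with commutes' := fun a => congr($hψ a) }
  let c : Fin n → k := fun j => ev (ψₐ (.X j))
  let translation : MvPolynomial (Fin n) k ≃ₐ[k] MvPolynomial (Fin n) k :=
    AlgEquiv.ofAlgHom (MvPolynomial.aeval fun j => .X j - .C (c j))
      (MvPolynomial.aeval fun j => .X j + .C (c j)) (by ext; simp) (by ext; simp)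
  have hetale_comp : (ψ.comp translation.toRingEquiv.toRingHom).Etale :=
    RingHom.Etale.respectsIso.2 _ _ hetale
  refine ⟨n, ψₐ.comp translation.toAlgHom, hetale_comp, fun j => ?_⟩
  have hC : ψₐ (.C (c j)) = algebraMap k A (c j) := ψₐ.commutes (c j)
  simp [translation, hC, c]

lemma ker_constantCoeff_eq_maximalIdeal (n : ℕ) :
    RingHom.ker (MvPowerSeries.constantCoeff (σ := Fin n) (R := k)) = maximalIdeal _ := by
  ext p
  rw [RingHom.mem_ker, mem_maximalIdeal, mem_nonunits_iff, MvPowerSeries.isUnit_iff_constantCoeff,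
    isUnit_iff_ne_zero, not_not]

-- In étale coordinates centred at the point, evaluation at the point lifts to the power series
-- ring because the latter is complete and étale algebras are formally smooth.
lemma exists_flat_constantCoeff_eq [Algebra.IsStandardSmooth k A] (ev : A →ₐ[k] k) :
    ∃ (n : ℕ) (φ : A →+* MvPowerSeries (Fin n) k), φ.Flat ∧
      ∀ a, MvPowerSeries.constantCoeff (φ a) = ev a := by
  obtain ⟨n, ψ, hetale, hψ⟩ := exists_etale_mvPolynomial_eval_eq_zero ev
  algebraize [ψ.toRingHom]
  let M := maximalIdeal (MvPowerSeries (Fin n) k)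
  have mk_eq_mk {p q : MvPowerSeries (Fin n) k} : Ideal.Quotient.mk M p = Ideal.Quotient.mk M q ↔
      MvPowerSeries.constantCoeff p = MvPowerSeries.constantCoeff q := by
    rw [Ideal.Quotient.eq, ← sub_eq_zero, ← map_sub, ← RingHom.mem_ker,
      ker_constantCoeff_eq_maximalIdeal]
  have ev_ψ (p : MvPolynomial (Fin n) k) :
      ev (ψ p) = MvPowerSeries.constantCoeff (p : MvPowerSeries (Fin n) k) := by
    have : (ev.comp ψ).toRingHom = MvPowerSeries.constantCoeff.comp
        (MvPolynomial.coeToMvPowerSeries.ringHom (σ := Fin n) (R := k)) :=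
      MvPolynomial.ringHom_ext (fun a => by simp)
        fun j => by simp [hψ]
    exact congr($this p)
  let evₘ : A →ₐ[MvPolynomial (Fin n) k] MvPowerSeries (Fin n) k ⧸ M :=
    { (Ideal.Quotient.mk M).comp ((MvPowerSeries.C (σ := Fin n)).comp ev.toRingHom) with
      commutes' := fun p => mk_eq_mk.mpr ((MvPowerSeries.constantCoeff_C _).trans (ev_ψ p)) }
  obtain ⟨g, hg⟩ := Algebra.FormallySmooth.exists_mkₐ_comp_eq_of_isAdicComplete
    (R := MvPolynomial (Fin n) k) evₘ
  exact ⟨n, g.toRingHom, flat_of_etale_of_flat g,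
    fun a => (mk_eq_mk.mp congr($hg a)).trans (MvPowerSeries.constantCoeff_C _)⟩

variable (k) in
lemma exists_locally_eq_span_of_isStandardSmooth [IsAlgClosed k] [IsDomain A]
    [Algebra.IsStandardSmooth k A] (m : Ideal A) [m.IsMaximal] (P : Ideal A) [P.IsPrime]
    (hP : P.height = 1) : ∃ F ∈ P, ∃ s ∉ m, ∀ y ∈ P, s * y ∈ Ideal.span {F} := by
  obtain ⟨ev, rfl⟩ := exists_algHom_ker_eq (k := k) m
  obtain ⟨n, φ, hφ, hev⟩ := exists_flat_constantCoeff_eq ev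
  have : IsDomain (MvPowerSeries (Fin n) k) := NoZeroDivisors.to_isDomain _
  have : IsNoetherianRing A := Algebra.FiniteType.isNoetherianRing k A
  have hcomap : (maximalIdeal (MvPowerSeries (Fin n) k)).comap φ = RingHom.ker ev := by
    ext a
    rw [← ker_constantCoeff_eq_maximalIdeal, Ideal.mem_comap, RingHom.mem_ker, hev,
      RingHom.mem_ker]
  rw [← hcomap]
  exact exists_locally_eq_span_of_flat hφ P hP

end AlgClosed

end HeightOne

/-! ### Equations of smooth hypersurfaces -/

lemma exists_retraction_kerCotangentToTensor {R P D : Type*} [CommRing R] [CommRing P]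
    [CommRing D] [Algebra R P] [Algebra P D] [Algebra R D] [IsScalarTower R P D]
    [Algebra.FormallySmooth R D] (hsurj : Function.Surjective (algebraMap P D)) :
    ∃ l, l ∘ₗ KaehlerDifferential.kerCotangentToTensor R P D = LinearMap.id := by
  let π : P ⧸ RingHom.ker (algebraMap P D) ^ 2 →ₐ[R] D :=
    (IsScalarTower.toAlgHom R P D).kerSquareLift
  have hπ : Function.Surjective π := .of_comp (g := Ideal.Quotient.mk _) hsurj
  have hnil : IsNilpotent (RingHom.ker π.toRingHom) := by
    refine ⟨2, ?_⟩
    rw [show RingHom.ker π.toRingHom = _ from AlgHom.ker_kerSquareLift _]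
    exact Ideal.cotangentIdeal_square _
  let splitting : D →ₐ[R] P ⧸ RingHom.ker (algebraMap P D) ^ 2 :=
    Algebra.FormallySmooth.liftOfSurjective (AlgHom.id R D) π hπ hnil
  exact ⟨_, ((retractionKerCotangentToTensorEquivSection hsurj).symm ⟨splitting,
    AlgHom.ext (Algebra.FormallySmooth.liftOfSurjective_apply (AlgHom.id R D) π hπ hnil)⟩).2⟩

lemma eq_zero_of_toCotangent_mem_smul_top {A : Type*} [CommRing A] [IsLocalRing A] {I : Ideal A}
    {a : A} (hI : I = Ideal.span {a}) (hI' : I ≠ ⊤) (ha : a ∈ I)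
    (h : I.toCotangent ⟨a, ha⟩ ∈ IsLocalRing.maximalIdeal A • (⊤ : Submodule A I.Cotangent)) :
    a = 0 := by
  subst hI
  have htop : (⊤ : Submodule A (Ideal.span {a}).Cotangent) =
      A ∙ (Ideal.span {a}).toCotangent ⟨a, ha⟩ := by
    rw [eq_comm, eq_top_iff]
    rintro x -
    obtain ⟨⟨y, hy⟩, rfl⟩ := Ideal.toCotangent_surjective _ x
    obtain ⟨c, rfl⟩ := Ideal.mem_span_singleton'.mp hy
    exact Submodule.mem_span_singleton.mpr ⟨c, (map_smul _ c _).symm⟩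
  have hbot : (⊤ : Submodule A (Ideal.span {a}).Cotangent) = ⊥ :=
    Submodule.eq_bot_of_le_smul_of_le_jacobson_bot (IsLocalRing.maximalIdeal A) _
      (htop ▸ Submodule.fg_span_singleton _)
      (htop.le.trans ((Submodule.span_singleton_le_iff_mem _ _).mpr h))
      (IsLocalRing.maximalIdeal_le_jacobson _)
  have hsub : Subsingleton (Ideal.span {a}).Cotangent :=
    (Submodule.subsingleton_iff A).mp (subsingleton_of_bot_eq_top hbot.symm)
  have hidem := (Ideal.cotangent_subsingleton_iff _).mp hsub
  exact Ideal.span_singleton_eq_bot.mp (Submodule.eq_bot_of_le_smul_of_le_jacobson_bot _ _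
    (Submodule.fg_span_singleton a) hidem.ge
    ((IsLocalRing.le_maximalIdeal hI').trans (IsLocalRing.maximalIdeal_le_jacobson _)))

/-- With `I` the kernel of `A' → D`, a splitting of `I / I² → D ⊗ Ω[A'⁄R]` sends `1 ⊗ d F` back to
the class of `F`, so that `d F` is nonzero modulo the maximal ideal by Nakayama's lemma. -/
lemma exists_isUnit_dual_D {R A A' D : Type*} [CommRing R] [CommRing A] [CommRing A'] [CommRing D]
    [Nontrivial D] [IsLocalRing A'] [Algebra R A] [Algebra R A'] [Algebra A A']
    [IsScalarTower R A A'] [Algebra A' D] [Algebra R D] [IsScalarTower R A' D]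
    [Module.Free A Ω[A⁄R]] [Module.Finite A Ω[A⁄R]] [Algebra.FormallySmooth R D]
    (hsurj : Function.Surjective (algebraMap A' D)) {F : A}
    (hker : RingHom.ker (algebraMap A' D) = Ideal.span {algebraMap A A' F})
    (hF : algebraMap A A' F ≠ 0) :
    ∃ t : Module.Dual A Ω[A⁄R], IsUnit (algebraMap A A' (t (KaehlerDifferential.D R A F))) := by
  by_contra! hdual
  obtain ⟨r, hr⟩ := exists_retraction_kerCotangentToTensor (R := R) hsurj
  have hFker : algebraMap A A' F ∈ RingHom.ker (algebraMap A' D) :=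
    hker ▸ Ideal.mem_span_singleton_self _
  let φ : Ω[A⁄R] →ₗ[A] (RingHom.ker (algebraMap A' D)).Cotangent :=
    (r ∘ₗ TensorProduct.mk A' D Ω[A'⁄R] 1).restrictScalars A ∘ₗ KaehlerDifferential.map R R A A'
  have hφ : φ (KaehlerDifferential.D R A F) = Ideal.toCotangent _ ⟨algebraMap A A' F, hFker⟩ := by
    have := LinearMap.congr_fun hr (Ideal.toCotangent _ ⟨algebraMap A A' F, hFker⟩)
    simpa [φ] using this
  refine hF (eq_zero_of_toCotangent_mem_smul_top hker (RingHom.ker_ne_top _) hFker ?_)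
  let b := Module.Free.chooseBasis A Ω[A⁄R]
  rw [← hφ, ← b.sum_repr (KaehlerDifferential.D R A F), map_sum]
  refine Submodule.sum_mem _ fun j _ => ?_
  rw [map_smul, ← algebraMap_smul A' (b.repr _ j)]
  exact Submodule.smul_mem_smul (hdual (b.coord j)) Submodule.mem_top

/-! ### Ideal sheaves -/

section IdealSheaf

open Scheme.IdealSheafData

lemma ideal_comap_of_isAffine {X Y : Scheme.{u}} [IsAffine X] [IsAffine Y] (f : X ⟶ Y)
    (J : Y.IdealSheafData) :
    (J.comap f).ideal ⟨⊤, isAffineOpen_top X⟩ =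
      (J.ideal ⟨⊤, isAffineOpen_top Y⟩).map f.appTop.hom := by
  refine eq_of_forall_ge_iff fun K => ?_
  have hK : (ofIdealTop K).ideal ⟨⊤, isAffineOpen_top X⟩ = K := by simp
  have hmap : ((ofIdealTop K).map f).ideal ⟨⊤, isAffineOpen_top Y⟩ = K.comap f.appTop.hom := by
    rw [ideal_map_of_isAffineHom]
    exact congrArg (Ideal.comap _) hK
  calc (J.comap f).ideal ⟨⊤, isAffineOpen_top X⟩ ≤ K ↔ J.comap f ≤ ofIdealTop K :=
        ⟨fun h => le_of_isAffine (h.trans hK.ge), fun h => (h _).trans hK.le⟩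
    _ ↔ J ≤ (ofIdealTop K).map f := le_map_iff_comap_le.symm
    _ ↔ J.ideal ⟨⊤, isAffineOpen_top Y⟩ ≤ K.comap f.appTop.hom :=
        ⟨fun h => (h _).trans hmap.le, fun h => le_of_isAffine (h.trans hmap.ge)⟩
    _ ↔ _ := Ideal.map_le_iff_le_comap.symm

lemma ideal_comap_of_image_eq {X Y : Scheme.{u}} (f : X ⟶ Y) [IsOpenImmersion f]
    (J : Y.IdealSheafData) (U : Y.affineOpens) (V : X.affineOpens) (h : f ''ᵁ V.1 = U.1)
    (hVU : V.1 ≤ f ⁻¹ᵁ U.1) :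
    (J.comap f).ideal V = (J.ideal U).map (f.appLE U V hVU).hom := by
  obtain ⟨U, hU⟩ := U
  subst h
  have happ : f.appLE (f ''ᵁ V.1) V hVU = (f.appIso V).hom := by rw [Scheme.Hom.appIso_hom']
  rw [ideal_comap_of_isOpenImmersion]
  simp only [happ]
  exact Ideal.comap_symm (I := J.ideal ⟨f ''ᵁ V.1, hU⟩) (f.appIso V.1).commRingCatIsoToRingEquiv

lemma ideal_comap {X Y : Scheme.{u}} (f : X ⟶ Y) (J : Y.IdealSheafData) (U : Y.affineOpens)
    (V : X.affineOpens) (h : V.1 ≤ f ⁻¹ᵁ U.1) :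
    (J.comap f).ideal V = (J.ideal U).map (f.appLE U V h).hom := by
  have : IsAffine V.1 := V.2
  have : IsAffine U.1 := U.2
  let fUV := f.resLE U.1 V.1 h
  let ιV := V.1.ι.appLE V ⊤ V.1.ι_preimage_self.ge
  let ιU := U.1.ι.appLE U ⊤ U.1.ι_preimage_self.ge
  have hfUV : fUV ≫ U.1.ι = V.1.ι ≫ f := f.resLE_comp_ι h
  have happ : ιU ≫ fUV.appTop = f.appLE U V h ≫ ιV := by
    have htop : fUV.appTop = fUV.appLE ⊤ ⊤ fUV.preimage_top.ge := Scheme.Hom.app_eq_appLE _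
    simp only [htop, ιU, ιV, Scheme.Hom.appLE_comp_appLE, hfUV]
  have hιV : ((J.comap f).ideal V).map ιV.hom =
      ((J.ideal U).map (f.appLE U V h).hom).map ιV.hom := by
    rw [Ideal.map_map, ← CommRingCat.hom_comp, ← happ, CommRingCat.hom_comp, ← Ideal.map_map,
      ← ideal_comap_of_image_eq V.1.ι (J.comap f) V ⟨⊤, isAffineOpen_top _⟩ V.1.ι_image_top,
      ← ideal_comap_of_image_eq U.1.ι J U ⟨⊤, isAffineOpen_top _⟩ U.1.ι_image_top,
      ← ideal_comap_of_isAffine, ← comap_comp, ← comap_comp, hfUV]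
  have hbij : Function.Bijective ιV.hom := ConcreteCategory.bijective_of_isIso ιV
  rw [← Ideal.comap_map_of_bijective ιV.hom hbij (I := (J.comap f).ideal V), hιV,
    Ideal.comap_map_of_bijective ιV.hom hbij]

lemma le_ker_of_range_subset_support {X Y : Scheme.{u}} [IsReduced X] {f : X ⟶ Y}
    {J : Y.IdealSheafData} (h : Set.range f ⊆ J.support) : J ≤ f.ker := by
  rw [← map_bot, le_map_iff_comap_le, le_bot_iff, ← support_eq_top_iff, support_comap]
  exact top_le_iff.mp fun x _ => h ⟨x, rfl⟩

lemma mem_ideal_vanishingIdeal_closure_singleton {X : Scheme.{u}} (η : X) (U : X.affineOpens)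
    (f : Γ(X, U.1)) :
    f ∈ (vanishingIdeal ⟨closure {η}, isClosed_closure⟩).ideal U ↔ η ∉ X.basicOpen f := by
  have hbasicOpen (y : Spec Γ(X, U.1)) : U.2.fromSpec y ∈ X.basicOpen f ↔ f ∉ y.asIdeal := by
    change y ∈ U.2.fromSpec ⁻¹ᵁ X.basicOpen f ↔ _
    rw [U.2.fromSpec_preimage_basicOpen]
    rfl
  rw [vanishingIdeal_ideal, PrimeSpectrum.mem_vanishingIdeal]
  constructor
  · intro h hη
    obtain ⟨y, rfl⟩ := U.2.range_fromSpec.ge (X.basicOpen_le f hη)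
    exact (hbasicOpen y).mp hη (h y (subset_closure rfl))
  · intro h y hy
    by_contra hf
    exact h ((specializes_iff_mem_closure.mpr hy).mem_open (X.basicOpen f).2
      ((hbasicOpen y).mpr hf))

end IdealSheaf

section VanishingIdeal

open Scheme.IdealSheafData

lemma isReduced_subscheme_vanishingIdeal {P : Scheme.{u}} (Z : TopologicalSpace.Closeds P) :
    IsReduced (vanishingIdeal Z).subscheme := by
  have hquotient (U : P.affineOpens) :
      IsReduced (Spec (.of (Γ(P, U.1) ⧸ (vanishingIdeal Z).ideal U))) := by
    refine (affine_isReduced_iff _).mpr ((Ideal.isRadical_iff_quotient_reduced _).mp ?_)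
    rw [vanishingIdeal_ideal]
    exact PrimeSpectrum.isRadical_vanishingIdeal _
  have (U : (vanishingIdeal Z).subschemeCover.openCover.I₀) :
      IsReduced ((vanishingIdeal Z).subschemeCover.openCover.X U) := hquotient U
  exact IsReduced.of_openCover _ (vanishingIdeal Z).subschemeCover.openCover

lemma isIntegral_subscheme_vanishingIdeal_closure_singleton {P : Scheme.{u}} (η : P) :
    IsIntegral (vanishingIdeal (X := P) ⟨closure {η}, isClosed_closure⟩).subscheme := by
  let J : P.IdealSheafData := vanishingIdeal ⟨closure {η}, isClosed_closure⟩
  have hrange : Set.range J.subschemeι = closure {η} := by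
    rw [range_subschemeι, coe_support_vanishingIdeal]
    rfl
  obtain ⟨z, hz⟩ : η ∈ Set.range J.subschemeι := hrange.ge (subset_closure rfl)
  have hdense : closure {z} = Set.univ := by
    refine Set.eq_univ_of_forall fun x => ?_
    rw [J.subschemeι.isEmbedding.closure_eq_preimage_closure_image, Set.image_singleton, hz]
    exact hrange.le ⟨x, rfl⟩
  have : IrreducibleSpace J.subscheme := by
    rw [irreducibleSpace_def, Set.top_eq_univ, ← hdense]
    exact isIrreducible_singleton.closure
  have : IsReduced J.subscheme := isReduced_subscheme_vanishingIdeal _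
  exact isIntegral_of_irreducibleSpace_of_isReduced J.subscheme

lemma mem_ideal_comap_vanishingIdeal_iff {P : Scheme.{u}} {B : CommRingCat.{u}} (j : Spec B ⟶ P)
    [IsOpenImmersion j] (y : Spec B) (b : B) :
    (Scheme.ΓSpecIso B).inv b ∈ ((vanishingIdeal ⟨closure {j y}, isClosed_closure⟩).comap j).ideal
      ⟨⊤, isAffineOpen_top _⟩ ↔ b ∈ y.asIdeal := by
  have himage :
      j y ∈ P.basicOpen ((j.appIso ⊤).inv ((Scheme.ΓSpecIso B).inv b)) ↔
        y ∈ (Spec B).basicOpen ((Scheme.ΓSpecIso B).inv b) := by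
    rw [← Scheme.image_basicOpen]
    exact Function.Injective.mem_set_image j.isOpenEmbedding.injective
  have hbasicOpen : y ∈ (Spec B).basicOpen ((Scheme.ΓSpecIso B).inv b) ↔ b ∉ y.asIdeal := by
    rw [basicOpen_eq_of_affine', ← CategoryTheory.comp_apply, Iso.inv_hom_id]
    rfl
  rw [ideal_comap_of_isOpenImmersion, Ideal.mem_comap, mem_ideal_vanishingIdeal_closure_singleton]
  exact (not_congr (himage.trans hbasicOpen)).trans not_not

lemma mem_ideal_ker_SpecMap_iff {B C : CommRingCat.{u}} (φ : B ⟶ C) (b : B) :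
    (Scheme.ΓSpecIso B).inv b ∈ (Spec.map φ).ker.ideal ⟨⊤, isAffineOpen_top _⟩ ↔ φ b = 0 := by
  have hnaturality : (Spec.map φ).appTop ((Scheme.ΓSpecIso B).inv b) =
      (Scheme.ΓSpecIso C).inv (φ b) := congr($(Scheme.ΓSpecIso_inv_naturality φ) b).symm
  rw [Scheme.Hom.ker_apply, RingHom.mem_ker]
  exact (Eq.congr_left hnaturality).trans
    (map_eq_zero_iff _ (ConcreteCategory.bijective_of_isIso (Scheme.ΓSpecIso C).inv).1)

lemma vanishingIdeal_closure_singleton_le_ker_iff {P : Scheme.{u}} {B C : CommRingCat.{u}}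
    (j : Spec B ⟶ P) [IsOpenImmersion j] (y : Spec B) (φ : B ⟶ C) :
    vanishingIdeal ⟨closure {j y}, isClosed_closure⟩ ≤ (Spec.map φ ≫ j).ker ↔
      ∀ b ∈ y.asIdeal, φ b = 0 := by
  rw [Scheme.Hom.ker_comp, le_map_iff_comap_le]
  constructor
  · intro h b hb
    exact (mem_ideal_ker_SpecMap_iff φ b).mp
      (h _ ((mem_ideal_comap_vanishingIdeal_iff j y b).mpr hb))
  · intro h
    refine le_of_isAffine fun f hf => ?_
    obtain ⟨b, rfl⟩ := (ConcreteCategory.bijective_of_isIso (Scheme.ΓSpecIso B).inv).2 f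
    exact (mem_ideal_ker_SpecMap_iff φ b).mpr
      (h b ((mem_ideal_comap_vanishingIdeal_iff j y b).mp hf))

end VanishingIdeal

section IsInvertibleIdeal

variable {T : Scheme.{u}} {J : T.IdealSheafData}

lemma IsInvertibleIdeal.exists_le (hJ : IsInvertibleIdeal J) {x : T} {O : T.Opens} (hx : x ∈ O) :
    ∃ V : T.affineOpens, x ∈ V.1 ∧ V.1 ≤ O ∧
      ∃ f ∈ nonZeroDivisors Γ(T, V.1), J.ideal V = Ideal.span {f} := by
  obtain ⟨U, hxU, f, hf, h⟩ := hJ x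
  obtain ⟨r, hr, hxr⟩ := U.2.exists_basicOpen_le (⟨x, hx⟩ : O) hxU
  refine ⟨T.affineBasicOpen r, hxr, hr, T.presheaf.map (homOfLE (T.basicOpen_le r)).op f, ?_, ?_⟩
  · have := U.2.isLocalization_basicOpen r
    exact IsLocalization.map_nonZeroDivisors_le (.powers r) Γ(T, T.basicOpen r) ⟨f, hf, rfl⟩
  · rw [← J.map_ideal (U := T.affineBasicOpen r) (V := U) (T.basicOpen_le r), h, Ideal.map_span,
      Set.image_singleton]
    rfl

lemma IsInvertibleIdeal.comap_of_isOpenImmersion (hJ : IsInvertibleIdeal J) {T' : Scheme.{u}}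
    (j : T' ⟶ T) [IsOpenImmersion j] : IsInvertibleIdeal (J.comap j) := by
  intro x
  obtain ⟨V, hxV, hV, f, hf, h⟩ := hJ.exists_le (x := j x) (O := j.opensRange) ⟨x, rfl⟩
  let restrict := j.appLE V.1 (j ⁻¹ᵁ V.1) le_rfl
  have hiso : IsIso restrict := by
    rw [show restrict = j.app V.1 from (Scheme.Hom.app_eq_appLE _).symm]
    exact Scheme.Hom.isIso_app j V.1 hV
  refine ⟨⟨j ⁻¹ᵁ V.1, V.2.preimage_of_isOpenImmersion j hV⟩, hxV, restrict f, ?_, ?_⟩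
  · exact (MulEquivClass.map_nonZeroDivisors
      (asIso restrict).commRingCatIsoToRingEquiv).le ⟨f, hf, rfl⟩
  · rw [ideal_comap j J V _ le_rfl, h, Ideal.map_span, Set.image_singleton]

end IsInvertibleIdeal

/-! ### The relative singular scheme on charts -/

lemma SpecMap_fromSpec_appLE {W : Scheme.{u}} {U : W.Opens} (hU : IsAffineOpen U)
    {B : CommRingCat.{u}} (ψ : Γ(W, U) ⟶ B) (h : ⊤ ≤ (Spec.map ψ ≫ hU.fromSpec) ⁻¹ᵁ U) :
    (Spec.map ψ ≫ hU.fromSpec).appLE U ⊤ h = ψ ≫ (Scheme.ΓSpecIso B).inv := by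
  have hfromSpec : hU.fromSpec.appLE U ⊤ hU.fromSpec_preimage_self.ge =
      (Scheme.ΓSpecIso Γ(W, U)).inv := by
    rw [Scheme.Hom.appLE, hU.fromSpec_app_self, Category.assoc, ← Functor.map_comp]
    exact (congrArg _ (CategoryTheory.Functor.map_id _ _)).trans (Category.comp_id _)
  have hSpecMap : (Spec.map ψ).appLE ⊤ ⊤ (Spec.map ψ).preimage_top.ge = (Spec.map ψ).appTop :=
    (Scheme.Hom.app_eq_appLE _).symm
  rw [← Scheme.Hom.appLE_comp_appLE _ _ U ⊤ ⊤ hU.fromSpec_preimage_self.ge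
    (Spec.map ψ).preimage_top.ge, hfromSpec, hSpecMap]
  exact (Scheme.ΓSpecIso_inv_naturality ψ).symm

section SingIdeal

variable {W S X : Scheme.{u}} {q : W ⟶ S} {i : X ⟶ W}

namespace Chart

lemma tangent_induction {e c : Chart q} (h : e ≤ c) {p : e.Tangent → Prop} (zero : p 0)
    (res : ∀ t, p (AffinePair.res h t)) (smul : ∀ (a : Γ(W, e.U)) t, p t → p (a • t))
    (add : ∀ s t, p s → p t → p (s + t)) (t : e.Tangent) : p t := by
  let := (W.presheaf.map (homOfLE h.2).op).hom.toAlgebra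
  let := (S.presheaf.map (homOfLE h.1).op).hom.toAlgebra
  let := (q.appLE c.V e.U (h.2.trans c.le)).hom.toAlgebra
  have := AffinePair.isScalarTower_left h
  have := AffinePair.isScalarTower_right h
  have : Algebra.FormallyEtale Γ(W, c.U) Γ(W, e.U) :=
    formallyEtale_res e.isAffineOpen_U c.isAffineOpen_U h.2
  have : Algebra.FormallyEtale Γ(S, c.V) Γ(S, e.V) :=
    formallyEtale_res e.isAffineOpen_V c.isAffineOpen_V h.1
  have := c.free
  have := c.finite
  exact (isBaseChange_vfMap Γ(S, c.V) Γ(S, e.V) Γ(W, c.U) Γ(W, e.U)).inductionOn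
    t p zero res smul add

variable (i) in
lemma equations_of_le {e c : Chart q} (h : e ≤ c) :
    e.equations i = (c.equations i).map (W.presheaf.map (homOfLE h.2).op).hom :=
  (i.ker.map_ideal (U := ⟨e.U, e.isAffineOpen_U⟩) (V := ⟨c.U, c.isAffineOpen_U⟩) h.2).symm

lemma deriv_mul (c : Chart q) (t : c.Tangent) (F G : Γ(W, c.U)) :
    c.deriv t (F * G) = F * c.deriv t G + G * c.deriv t F := by
  simp [deriv]

lemma deriv_add (c : Chart q) (t : c.Tangent) (F G : Γ(W, c.U)) :
    c.deriv t (F + G) = c.deriv t F + c.deriv t G := by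
  simp [deriv]

lemma deriv_res {e c : Chart q} (h : e ≤ c) (t : c.Tangent) (F : Γ(W, c.U)) :
    e.deriv (AffinePair.res h t) (W.presheaf.map (homOfLE h.2).op F) =
      W.presheaf.map (homOfLE h.2).op (c.deriv t F) :=
  AffinePair.res_D h t F

variable (i) in
/-- The ideal of `Sing(X/S)`, seen as a closed subscheme of `W`, on a chart. -/
def singIdeal (c : Chart q) : Ideal Γ(W, c.U) :=
  c.equations i ⊔ Ideal.span {x | ∃ t : c.Tangent, ∃ F ∈ c.equations i, c.deriv t F = x}

lemma deriv_mem_singIdeal (c : Chart q) (t : c.Tangent) {F : Γ(W, c.U)}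
    (hF : F ∈ c.equations i) : c.deriv t F ∈ c.singIdeal i :=
  Ideal.mem_sup_right (Ideal.subset_span ⟨t, F, hF, rfl⟩)

lemma singIdeal_le_iff (c : Chart q) {I : Ideal Γ(W, c.U)} :
    c.singIdeal i ≤ I ↔ ∀ F ∈ c.equations i, F ∈ I ∧ ∀ t : c.Tangent, c.deriv t F ∈ I := by
  refine ⟨fun h F hF => ⟨h (Ideal.mem_sup_left hF), fun t => h (c.deriv_mem_singIdeal t hF)⟩,
    fun h => sup_le (fun F hF => (h F hF).1) (Ideal.span_le.mpr ?_)⟩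
  rintro _ ⟨t, F, hF, rfl⟩
  exact (h F hF).2 t

lemma deriv_mem_map_singIdeal {e c : Chart q} (h : e ≤ c) (t : e.Tangent) {G : Γ(W, e.U)}
    (hG : G ∈ (c.equations i).map (W.presheaf.map (homOfLE h.2).op).hom) :
    e.deriv t G ∈ (c.singIdeal i).map (W.presheaf.map (homOfLE h.2).op).hom := by
  set res := (W.presheaf.map (homOfLE h.2).op).hom
  have hle : (c.equations i).map res ≤ (c.singIdeal i).map res := Ideal.map_mono le_sup_left
  induction hG using Submodule.span_induction with
  | mem x hx =>
    obtain ⟨F, hF, rfl⟩ := hx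
    induction t using tangent_induction h with
    | zero => simp [deriv]
    | res t =>
      have hres : e.deriv (AffinePair.res h t) (res F) = res (c.deriv t F) := deriv_res h t F
      rw [hres]
      exact Ideal.mem_map_of_mem res (c.deriv_mem_singIdeal t hF)
    | smul a t ht => exact Ideal.mul_mem_left _ _ ht
    | add s t hs ht => exact add_mem hs ht
  | zero => simp [deriv]
  | add x y _ _ hx hy =>
    rw [deriv_add]
    exact add_mem hx hy
  | smul a x hx ih =>
    rw [smul_eq_mul, deriv_mul]
    exact add_mem (Ideal.mul_mem_left _ _ ih) (Ideal.mul_mem_right _ _ (hle hx))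

variable (i) in
lemma singIdeal_of_le {e c : Chart q} (h : e ≤ c) :
    e.singIdeal i = (c.singIdeal i).map (W.presheaf.map (homOfLE h.2).op).hom := by
  apply le_antisymm
  · refine e.singIdeal_le_iff.mpr fun F hF => ?_
    rw [equations_of_le i h] at hF
    exact ⟨Ideal.map_mono le_sup_left hF, fun t => deriv_mem_map_singIdeal h t hF⟩
  · refine Ideal.map_le_iff_le_comap.mpr (c.singIdeal_le_iff.mpr fun F hF => ?_)
    have hF' : W.presheaf.map (homOfLE h.2).op F ∈ e.equations i := by
      rw [equations_of_le i h]
      exact Ideal.mem_map_of_mem _ hF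
    refine ⟨Ideal.mem_sup_left hF', fun t => Ideal.mem_comap.mpr ?_⟩
    have hres : e.deriv (AffinePair.res h t) (W.presheaf.map (homOfLE h.2).op F) =
        (W.presheaf.map (homOfLE h.2).op).hom (c.deriv t F) := deriv_res h t F
    exact hres ▸ e.deriv_mem_singIdeal (AffinePair.res h t) hF'

variable (i) in
/-- The singular scheme of a chart, mapped to `W`. -/
def singι (c : Chart q) : Spec (.of (Γ(W, c.U) ⧸ c.singIdeal i)) ⟶ W :=
  Spec.map (CommRingCat.ofHom (Ideal.Quotient.mk (c.singIdeal i))) ≫ c.isAffineOpen_U.fromSpec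

variable (i) in
lemma top_le_singι_preimage (c : Chart q) : ⊤ ≤ c.singι i ⁻¹ᵁ c.U := fun y _ => by
  change (Spec.map (CommRingCat.ofHom (Ideal.Quotient.mk (c.singIdeal i))) ≫
    c.isAffineOpen_U.fromSpec) y ∈ c.U
  rw [Scheme.Hom.comp_apply]
  exact c.isAffineOpen_U.range_fromSpec.le ⟨_, rfl⟩

lemma singι_appLE_eq_zero_iff (c : Chart q) (F : Γ(W, c.U)) :
    (c.singι i).appLE c.U ⊤ (c.top_le_singι_preimage i) F = 0 ↔ F ∈ c.singIdeal i := by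
  have happ : (c.singι i).appLE c.U ⊤ (c.top_le_singι_preimage i) F =
      (Scheme.ΓSpecIso (.of (Γ(W, c.U) ⧸ c.singIdeal i))).inv (Ideal.Quotient.mk _ F) :=
    congr($(SpecMap_fromSpec_appLE c.isAffineOpen_U
      (CommRingCat.ofHom (Ideal.Quotient.mk (c.singIdeal i))) (c.top_le_singι_preimage i)) F)
  rw [happ, ← Ideal.Quotient.eq_zero_iff_mem]
  exact map_eq_zero_iff _ (ConcreteCategory.bijective_of_isIso (Scheme.ΓSpecIso
    (.of (Γ(W, c.U) ⧸ c.singIdeal i))).inv).1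

variable (i) in
lemma singIdeal_le_ker_singι_app {e c : Chart q} (h : e ≤ c) :
    e.singIdeal i ≤ RingHom.ker ((c.singι i).app e.U).hom := by
  rw [singIdeal_of_le i h, Ideal.map_le_iff_le_comap]
  intro F hF
  rw [Ideal.mem_comap, RingHom.mem_ker, ← CategoryTheory.comp_apply, Scheme.Hom.app_eq_appLE,
    Scheme.Hom.map_appLE, ← Scheme.Hom.appLE_map _ (c.top_le_singι_preimage i) (homOfLE le_top).op,
    CategoryTheory.comp_apply, (c.singι_appLE_eq_zero_iff F).mpr hF, map_zero]

lemma ker_singι_ideal_le (c : Chart q) :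
    (c.singι i).ker.ideal ⟨c.U, c.isAffineOpen_U⟩ ≤ c.singIdeal i := by
  intro F hF
  have happ : (c.singι i).app c.U F = 0 := (c.singι i).ideal_ker_le ⟨c.U, c.isAffineOpen_U⟩ hF
  rw [← singι_appLE_eq_zero_iff, Scheme.Hom.appLE, CategoryTheory.comp_apply, happ, map_zero]

variable (i) in
lemma singIdeal_le_ker_singι_ideal [QuasiSeparatedSpace W] (c d : Chart q) :
    d.singIdeal i ≤ (c.singι i).ker.ideal ⟨d.U, d.isAffineOpen_U⟩ := by
  have : QuasiCompact (c.singι i) := inferInstance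
  rw [Scheme.Hom.ker_apply]
  intro F hF
  rw [RingHom.mem_ker]
  choose e hec hed hye using fun y : c.singι i ⁻¹ᵁ d.U =>
    exists_le c d (c.top_le_singι_preimage i trivial) y.2
  refine TopCat.Sheaf.eq_of_locally_eq' (Spec _).sheaf (fun y => c.singι i ⁻¹ᵁ (e y).U)
    (c.singι i ⁻¹ᵁ d.U) (fun y => homOfLE ((c.singι i).preimage_mono (hed y).2))
    (fun y hy => TopologicalSpace.Opens.mem_iSup.mpr ⟨⟨y, hy⟩, hye _⟩) _ _ fun y => ?_
  have hFe : W.presheaf.map (homOfLE (hed y).2).op F ∈ (e y).singIdeal i := by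
    rw [singIdeal_of_le i (hed y)]
    exact Ideal.mem_map_of_mem _ hF
  have hker := singIdeal_le_ker_singι_app i (hec y) hFe
  rw [RingHom.mem_ker, ← CategoryTheory.comp_apply, Scheme.Hom.naturality,
    CategoryTheory.comp_apply] at hker
  exact hker.trans (map_zero _).symm

variable (q i) in
lemma relSingIdeal_eq_iInf_ker_singι [QuasiSeparatedSpace W] {ι : Type*} [Finite ι]
    (d : ι → Chart q) (hd : ⨆ j, (d j).U = ⊤) :
    relSingIdeal q i = ⨅ j, ((d j).singι i).ker := by
  apply le_antisymm
  · refine sInf_le fun e => e.singIdeal_le_iff.mp ?_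
    simp only [Scheme.IdealSheafData.ideal_iInf, iInf_apply]
    exact le_iInf fun j => singIdeal_le_ker_singι_ideal i (d j) e
  · refine le_sInf fun K hK => Scheme.IdealSheafData.le_of_iSup_eq_top
      (fun j => ⟨(d j).U, (d j).isAffineOpen_U⟩) hd fun j => ?_
    exact (iInf_le (fun j => ((d j).singι i).ker) j _).trans
      ((d j).ker_singι_ideal_le.trans ((d j).singIdeal_le_iff.mpr (hK (d j))))

variable (q i) in
lemma relSingIdeal_ideal [Smooth q] [CompactSpace W] [QuasiSeparatedSpace W] (c : Chart q) :
    (relSingIdeal q i).ideal ⟨c.U, c.isAffineOpen_U⟩ = c.singIdeal i := by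
  classical
  obtain ⟨s, hs⟩ := isCompact_univ.elim_finite_subcover (fun c : Chart q => (c.U : Set W))
    (fun c => c.U.2) (fun w _ => Set.mem_iUnion.mpr (exists_mem w))
  let d (j : ↥(insert c s)) : Chart q := j
  have hd : ⨆ j, (d j).U = ⊤ := by
    refine top_le_iff.mp fun w _ => ?_
    obtain ⟨e, he, hw⟩ := Set.mem_iUnion₂.mp (hs (Set.mem_univ w))
    exact TopologicalSpace.Opens.mem_iSup.mpr ⟨⟨e, Finset.mem_insert_of_mem he⟩, hw⟩
  rw [relSingIdeal_eq_iInf_ker_singι q i d hd]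
  refine le_antisymm ((iInf_le (fun j => ((d j).singι i).ker)
    ⟨c, Finset.mem_insert_self _ _⟩ _).trans c.ker_singι_ideal_le) ?_
  simp only [Scheme.IdealSheafData.ideal_iInf, iInf_apply]
  exact le_iInf fun j => singIdeal_le_ker_singι_ideal i (d j) c

end Chart

end SingIdeal

/-! ### Charts of the cotangent bundles -/

section CotangentCharts

open SymProj

variable {A T : Type u} [CommRing A] [AddCommGroup T] [Module A T]

lemma SymProj.mk_mem_iff_of_pos {s : SymmetricAlgebra A T} (hs : s ∈ grading A T 1)
    (y : Spec (.of (Away (grading A T) s))) {k : ℕ} (hk : 0 < k) {x : SymmetricAlgebra A T}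
    (hx : x ∈ grading A T (k • 1)) :
    Away.mk (grading A T) hs k x hx ∈ y.asIdeal ↔
      x ∈ (Proj.awayι (grading A T) s hs one_pos y).asHomogeneousIdeal := by
  have hx' : x ∈ grading A T k := by simpa using hx
  have hmk : Away.isLocalizationElem hs hx' = Away.mk (grading A T) hs k x hx := by
    ext
    simp only [Away.isLocalizationElem, Away.val_mk, pow_one]
  have hpreimage : y ∈ Proj.awayι (grading A T) s hs one_pos ⁻¹ᵁ Proj.basicOpen (grading A T) x ↔
      Away.mk (grading A T) hs k x hx ∉ y.asIdeal := by
    rw [Proj.awayι_preimage_basicOpen (grading A T) hs one_pos hx' hk, hmk]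
    rfl
  exact (not_iff_not.mp hpreimage).symm

lemma SymProj.mk_mem_iff {s : SymmetricAlgebra A T} (hs : s ∈ grading A T 1)
    (y : Spec (.of (Away (grading A T) s))) (k : ℕ) {x : SymmetricAlgebra A T}
    (hx : x ∈ grading A T (k • 1)) :
    Away.mk (grading A T) hs k x hx ∈ y.asIdeal ↔
      x ∈ (Proj.awayι (grading A T) s hs one_pos y).asHomogeneousIdeal := by
  have hsx : s * x ∈ grading A T ((k + 1) • 1) := by
    rw [add_smul, add_comm, one_smul]
    exact SetLike.mul_mem_graded hs hx
  have hmk : Away.mk (grading A T) hs k x hx =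
      Away.mk (grading A T) hs (k + 1) (s * x) hsx := by
    ext
    rw [Away.val_mk, Away.val_mk, Localization.mk_eq_mk_iff, Localization.r_iff_exists]
    exact ⟨1, by simp only [pow_succ]; ring⟩
  have hs_notMem : s ∉ (Proj.awayι (grading A T) s hs one_pos y).asHomogeneousIdeal := by
    have hy : y ∈ Proj.awayι (grading A T) s hs one_pos ⁻¹ᵁ Proj.basicOpen (grading A T) s := by
      rw [← Proj.opensRange_awayι (grading A T) s hs one_pos]
      exact ⟨y, rfl⟩
    exact hy
  rw [hmk, mk_mem_iff_of_pos hs y k.succ_pos]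
  exact ⟨fun h => ((Proj.awayι (grading A T) s hs one_pos y).isPrime.mem_or_mem h).resolve_left
    hs_notMem, fun h => Ideal.mul_mem_left _ _ h⟩

variable {W S : Scheme.{u}} (q : W ⟶ S) [Smooth q]

namespace projCotangentBundle

instance (c : Chart q) : IsOpenImmersion (chart q c) :=
  (Chart.projGluing q).cover.map_prop c

lemma chart_proj (c : Chart q) :
    chart q c ≫ proj q = toSpec Γ(W, c.U) c.Tangent ≫ c.isAffineOpen_U.fromSpec :=
  (Chart.projGluing q).ι_toBase c

lemma opensRange_chart (c : Chart q) : (chart q c).opensRange = proj q ⁻¹ᵁ c.U := by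
  have hcover : ((Chart.cover q).f c).opensRange = c.U := c.isAffineOpen_U.opensRange_fromSpec
  have hpreimage := (Chart.projGluing q).toBase_preimage_eq_opensRange_ι c
  rw [hcover] at hpreimage
  exact hpreimage.symm

lemma map_chart {c d : Chart q} (h : c ≤ d) :
    Proj.map (AffinePair.symRes h) (AffinePair.symRes_irrelevant h d.free d.finite) ≫ chart q d =
      chart q c :=
  (Chart.projGluing q).cover.trans_map (i := c) (j := d) (homOfLE h : (c : Chart q) ⟶ d)

/-- The affine open of `ℙT^∨(W/S)` where a vector field `t` on a chart does not vanish. -/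
def piece (c : Chart q) (t : c.Tangent) :
    Spec (.of (Away c.symGrading (SymmetricAlgebra.ι Γ(W, c.U) c.Tangent t))) ⟶
      projCotangentBundle q :=
  Proj.awayι c.symGrading _ (ι_mem t) one_pos ≫ chart q c

instance (c : Chart q) (t : c.Tangent) : IsOpenImmersion (piece q c t) :=
  inferInstanceAs (IsOpenImmersion (_ ≫ _))

lemma piece_proj (c : Chart q) (t : c.Tangent) :
    piece q c t ≫ proj q =
      Spec.map (CommRingCat.ofHom (toAway c.Tangent (SymmetricAlgebra.ι Γ(W, c.U) c.Tangent t))) ≫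
        c.isAffineOpen_U.fromSpec := by
  have hchart := congrArg (Proj.awayι c.symGrading _ (ι_mem t) one_pos ≫ ·) (chart_proj q c)
  have haway := congrArg (· ≫ c.isAffineOpen_U.fromSpec) (awayι_toSpec _ (ι_mem t))
  exact (Category.assoc _ _ _).trans
    (hchart.trans ((Category.assoc _ _ _).symm.trans haway))

lemma mem_opensRange_piece (c : Chart q) (t : c.Tangent) (l : Proj c.symGrading) :
    chart q c l ∈ (piece q c t).opensRange ↔
      SymmetricAlgebra.ι Γ(W, c.U) c.Tangent t ∉ l.asHomogeneousIdeal := by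
  have hrange : (piece q c t).opensRange =
      chart q c ''ᵁ Proj.basicOpen c.symGrading (SymmetricAlgebra.ι Γ(W, c.U) c.Tangent t) := by
    rw [← Proj.opensRange_awayι c.symGrading (SymmetricAlgebra.ι Γ(W, c.U) c.Tangent t) (ι_mem t)
      one_pos]
    exact Scheme.Hom.opensRange_comp _ _
  rw [hrange]
  exact Function.Injective.mem_set_image (chart q c).isOpenEmbedding.injective

lemma exists_mem_opensRange_piece (c : Chart q) {y : projCotangentBundle q}
    (hy : proj q y ∈ c.U) : ∃ t : c.Tangent, y ∈ (piece q c t).opensRange := by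
  obtain ⟨l, rfl⟩ : y ∈ (chart q c).opensRange := by rwa [opensRange_chart]
  simp only [mem_opensRange_piece]
  by_contra! h
  refine l.not_irrelevant_le fun x hx => Ideal.span_le.mpr ?_ (irrelevant_le_span hx)
  rintro _ ⟨t, rfl⟩
  exact h t

lemma exists_piece_eq (c : Chart q) (t : c.Tangent) (l : Proj c.symGrading)
    (h : SymmetricAlgebra.ι Γ(W, c.U) c.Tangent t ∉ l.asHomogeneousIdeal) :
    ∃ y : Spec (.of (Away c.symGrading (SymmetricAlgebra.ι Γ(W, c.U) c.Tangent t))),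
      piece q c t y = chart q c l ∧ ∀ k x (hx : x ∈ c.symGrading (k • 1)),
        Away.mk c.symGrading (ι_mem t) k x hx ∈ y.asIdeal ↔ x ∈ l.asHomogeneousIdeal := by
  have hl : l ∈ (Proj.awayι c.symGrading _ (ι_mem t) one_pos).opensRange := by
    rw [Proj.opensRange_awayι]
    exact h
  obtain ⟨y, rfl⟩ := hl
  exact ⟨y, Scheme.Hom.comp_apply _ _ _, fun k x hx => mk_mem_iff (ι_mem t) y k hx⟩

lemma piece_mem_opensRange_piece (c : Chart q) (t t' : c.Tangent)
    (y : Spec (.of (Away c.symGrading (SymmetricAlgebra.ι Γ(W, c.U) c.Tangent t)))) :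
    piece q c t y ∈ (piece q c t').opensRange ↔ frac (ι_mem t) t' ∉ y.asIdeal :=
  (mem_opensRange_piece q c t' (Proj.awayι c.symGrading _ (ι_mem t) one_pos y)).trans
    (mk_mem_iff (ι_mem t) y 1 (by simpa using ι_mem t')).not.symm

end projCotangentBundle

namespace cotangentBundle

instance (c : Chart q) : IsOpenImmersion (chart q c) :=
  (Chart.specGluing q).cover.map_prop c

lemma chart_proj (c : Chart q) :
    chart q c ≫ proj q =
      Spec.map (CommRingCat.ofHom (algebraMap _ _)) ≫ c.isAffineOpen_U.fromSpec :=
  (Chart.specGluing q).ι_toBase c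

lemma opensRange_chart (c : Chart q) : (chart q c).opensRange = proj q ⁻¹ᵁ c.U := by
  have hcover : ((Chart.cover q).f c).opensRange = c.U := c.isAffineOpen_U.opensRange_fromSpec
  have hpreimage := (Chart.specGluing q).toBase_preimage_eq_opensRange_ι c
  rw [hcover] at hpreimage
  exact hpreimage.symm

lemma map_chart {c d : Chart q} (h : c ≤ d) :
    Spec.map (CommRingCat.ofHom (AffinePair.symRes h).toRingHom) ≫ chart q d = chart q c :=
  (Chart.specGluing q).cover.trans_map (i := c) (j := d) (homOfLE h : (c : Chart q) ⟶ d)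

end cotangentBundle

end CotangentCharts

/-! ### The cone of a line in a vector bundle -/

namespace SymProj

variable {A T : Type u} [CommRing A] [AddCommGroup T] [Module A T]

@[elab_as_elim]
lemma grading_induction {p : (n : ℕ) → (x : SymmetricAlgebra A T) → x ∈ grading A T n → Prop}
    (algebraMap : ∀ a, p 0 (algebraMap A _ a) (SetLike.algebraMap_mem_graded _ _))
    (add : ∀ n x y (hx : x ∈ grading A T n) (hy : y ∈ grading A T n), p n x hx → p n y hy →
      p n (x + y) (add_mem hx hy))
    (mul : ∀ n t x (hx : x ∈ grading A T n)
      (hx' : SymmetricAlgebra.ι A T t * x ∈ grading A T (n + 1)), p n x hx →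
      p (n + 1) (SymmetricAlgebra.ι A T t * x) hx')
    {n : ℕ} {x : SymmetricAlgebra A T} (hx : x ∈ grading A T n) : p n x hx := by
  have hpow : x ∈ LinearMap.range (SymmetricAlgebra.ι A T) ^ n := hx
  induction hpow using Submodule.pow_induction_on_left' with
  | algebraMap r => exact algebraMap r
  | add x y i hx' hy' ihx ihy => exact add _ _ _ hx' hy' (ihx hx') (ihy hy')
  | mem_mul m hm i x hx' ih =>
    obtain ⟨m, rfl⟩ := hm
    exact mul _ _ _ hx' hx (ih hx')

lemma toIdeal_le_of_homogeneous {J : HomogeneousIdeal (grading A T)}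
    {K : Ideal (SymmetricAlgebra A T)} (h : ∀ n x, x ∈ grading A T n → x ∈ J → x ∈ K) :
    J.toIdeal ≤ K := by
  classical
  intro x hx
  rw [← DirectSum.sum_support_decompose (grading A T) x]
  exact Ideal.sum_mem _ fun n _ => h n _ (SetLike.coe_mem _) (J.isHomogeneous n hx)

variable (a : T →ₗ[A] A) (I : Ideal A)

/-- The homomorphism `Sym T → (A/I)[X]` with `t ↦ a(t) X`, corresponding to the family over `V(I)`
of the lines spanned by the covector `a`. -/
def coneMap : SymmetricAlgebra A T →ₐ[A] Polynomial (A ⧸ I) :=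
  SymmetricAlgebra.lift
    ((Polynomial.monomial (R := A ⧸ I) 1).restrictScalars A ∘ₗ (Algebra.linearMap A (A ⧸ I)) ∘ₗ a)

lemma coneMap_eq_monomial {n : ℕ} {x : SymmetricAlgebra A T} (hx : x ∈ grading A T n) :
    coneMap a I x = Polynomial.monomial n (Ideal.Quotient.mk I (SymmetricAlgebra.lift a x)) := by
  induction hx using grading_induction with
  | algebraMap r =>
    rw [AlgHom.commutes, AlgHom.commutes]
    rfl
  | add n x y _ _ ihx ihy => simp only [map_add, ihx, ihy]
  | mul n t x _ _ ih =>
    rw [map_mul, ih, coneMap, SymmetricAlgebra.lift_ι_apply, map_mul, map_mul,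
      SymmetricAlgebra.lift_ι_apply, add_comm, ← Polynomial.monomial_mul_monomial]
    rfl

lemma isHomogeneous_ker_coneMap : (RingHom.ker (coneMap a I)).IsHomogeneous (grading A T) := by
  classical
  intro n x hx
  have hcoeff : (coneMap a I x).coeff n =
      (coneMap a I (DirectSum.decompose (grading A T) x n)).coeff n := by
    conv_lhs => rw [← DirectSum.sum_support_decompose (grading A T) x]
    rw [map_sum, Polynomial.finsetSum_coeff]
    refine Finset.sum_eq_single n (fun m _ hmn => ?_) fun hn => ?_
    · rw [coneMap_eq_monomial a I (SetLike.coe_mem _), Polynomial.coeff_monomial_of_ne _ hmn.symm]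
    · rw [DFinsupp.notMem_support_iff.mp hn, ZeroMemClass.coe_zero, map_zero, Polynomial.coeff_zero]
  rw [RingHom.mem_ker] at hx ⊢
  rw [coneMap_eq_monomial a I (SetLike.coe_mem _), Polynomial.coeff_monomial_same, hx,
    Polynomial.coeff_zero] at hcoeff
  rw [coneMap_eq_monomial a I (SetLike.coe_mem _), ← hcoeff, map_zero]

/-- The homogeneous ideal of the cone over the closed subscheme `V(I)` given by the lines `a`. -/
def coneIdeal : HomogeneousIdeal (grading A T) :=
  ⟨RingHom.ker (coneMap a I), isHomogeneous_ker_coneMap a I⟩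

lemma mem_coneIdeal {n : ℕ} {x : SymmetricAlgebra A T} (hx : x ∈ grading A T n) :
    x ∈ coneIdeal a I ↔ SymmetricAlgebra.lift a x ∈ I := by
  change x ∈ RingHom.ker (coneMap a I) ↔ _
  rw [RingHom.mem_ker, coneMap_eq_monomial a I hx, Polynomial.monomial_eq_zero_iff,
    Ideal.Quotient.eq_zero_iff_mem]

lemma ι_mem_coneIdeal (t : T) : SymmetricAlgebra.ι A T t ∈ coneIdeal a I ↔ a t ∈ I := by
  rw [mem_coneIdeal a I (ι_mem t), SymmetricAlgebra.lift_ι_apply]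

lemma algebraMap_mem_coneIdeal (r : A) : algebraMap A _ r ∈ coneIdeal a I ↔ r ∈ I := by
  rw [mem_coneIdeal a I (SetLike.algebraMap_mem_graded (grading A T) r), AlgHom.commutes]
  rfl

lemma isPrime_coneIdeal [I.IsPrime] : (coneIdeal a I).toIdeal.IsPrime :=
  RingHom.ker_isPrime (coneMap a I).toRingHom

variable {a I}

lemma pow_smul_sub_lift_smul_mem {K : Ideal (SymmetricAlgebra A T)} {t₀ : T}
    (h : ∀ t, a t₀ • SymmetricAlgebra.ι A T t - a t • SymmetricAlgebra.ι A T t₀ ∈ K) {n : ℕ}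
    {x : SymmetricAlgebra A T} (hx : x ∈ grading A T n) :
    a t₀ ^ n • x - SymmetricAlgebra.lift a x • SymmetricAlgebra.ι A T t₀ ^ n ∈ K := by
  induction hx using grading_induction with
  | algebraMap r =>
    rw [AlgHom.commutes]
    simp [Algebra.smul_def]
  | add n x y _ _ ihx ihy =>
    convert add_mem ihx ihy using 1
    rw [map_add, smul_add, add_smul]
    abel
  | mul n t x _ _ ih =>
    convert add_mem (Ideal.mul_mem_right (a t₀ ^ n • x) _ (h t))
      (Ideal.mul_mem_left _ (a t • SymmetricAlgebra.ι A T t₀) ih) using 1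
    simp only [SymmetricAlgebra.lift_ι_apply, Algebra.smul_def, map_mul, map_pow, pow_succ]
    ring

/- The hypothesis `h` says that `K` contains the `2 × 2` minors of `a` and the tautological
covector: where `a t₀` is invertible, the tautological covector is a multiple of `a`. -/
lemma coneIdeal_le {K : Ideal (SymmetricAlgebra A T)} [K.IsPrime]
    (hI : ∀ r ∈ I, algebraMap A _ r ∈ K) {t₀ : T} (h₀ : algebraMap A _ (a t₀) ∉ K)
    (h : ∀ t, a t₀ • SymmetricAlgebra.ι A T t - a t • SymmetricAlgebra.ι A T t₀ ∈ K) :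
    (coneIdeal a I).toIdeal ≤ K := by
  refine toIdeal_le_of_homogeneous fun n x hx hxI => ?_
  rw [mem_coneIdeal a I hx] at hxI
  have hlift : SymmetricAlgebra.lift a x • SymmetricAlgebra.ι A T t₀ ^ n ∈ K := by
    rw [Algebra.smul_def]
    exact Ideal.mul_mem_right _ _ (hI _ hxI)
  have hpow := add_mem (pow_smul_sub_lift_smul_mem h hx) hlift
  rw [sub_add_cancel, Algebra.smul_def, map_pow] at hpow
  exact (Ideal.IsPrime.mem_or_mem ‹_› hpow).resolve_left fun ha =>
    h₀ (Ideal.IsPrime.mem_of_pow_mem ‹_› _ ha)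

lemma lift_sub_mem {a' : T →ₗ[A] A} {u : A} (h : ∀ t, a' t - u * a t ∈ I) {n : ℕ}
    {x : SymmetricAlgebra A T} (hx : x ∈ grading A T n) :
    SymmetricAlgebra.lift a' x - u ^ n * SymmetricAlgebra.lift a x ∈ I := by
  induction hx using grading_induction with
  | algebraMap r => simp [AlgHom.commutes]
  | add n x y _ _ ihx ihy =>
    convert add_mem ihx ihy using 1
    simp only [map_add]
    ring
  | mul n t x _ _ ih =>
    convert add_mem (Ideal.mul_mem_right (SymmetricAlgebra.lift a' x) _ (h t))
      (Ideal.mul_mem_left _ (u * a t) ih) using 1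
    simp only [map_mul, SymmetricAlgebra.lift_ι_apply, pow_succ]
    ring

lemma mk_zero_algebraMap {s : SymmetricAlgebra A T} (hs : s ∈ grading A T 1) (r : A)
    (h : algebraMap A _ r ∈ grading A T (0 • 1)) :
    Away.mk (grading A T) hs 0 (algebraMap A _ r) h = toAway T s r := by
  ext
  rw [Away.val_mk]
  simp only [pow_zero]
  rfl

lemma pow_mul_awayLift {B : Type u} [CommRing B] [Algebra A B] {s : SymmetricAlgebra A T}
    (hs : s ∈ grading A T 1) (φ : T →ₗ[A] B) (h : SymmetricAlgebra.lift φ s = 1) {b : B}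
    (hb : ∀ t, algebraMap A B (a t) = b * φ t) {k : ℕ} {x : SymmetricAlgebra A T}
    (hx : x ∈ grading A T (k • 1)) :
    b ^ k * awayLift φ h (Away.mk (grading A T) hs k x hx) =
      algebraMap A B (SymmetricAlgebra.lift a x) := by
  have hx' : x ∈ grading A T k := by simpa using hx
  induction hx' using grading_induction with
  | algebraMap r =>
    rw [mk_zero_algebraMap, awayLift_toAway, AlgHom.commutes, pow_zero, one_mul,
      Algebra.algebraMap_self_apply]
  | add n x y hx' hy' ihx ihy =>
    have hx'' : x ∈ grading A T (n • 1) := by simpa using hx'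
    have hy'' : y ∈ grading A T (n • 1) := by simpa using hy'
    rw [away_mk_add hs n hx'' hy'', map_add, mul_add, ihx hx'', ihy hy'', map_add, map_add]
  | mul n t x hx' _ ih =>
    have hx'' : x ∈ grading A T (n • 1) := by simpa using hx'
    rw [away_mk_succ hs t n hx'', map_mul, awayLift_frac, map_mul, map_mul, ← ih hx'',
      SymmetricAlgebra.lift_ι_apply, hb]
    ring

end SymProj

/-! ### Smooth points of a hypersurface -/

section SmoothPoints

variable {W S X : Scheme.{u}} {q : W ⟶ S} {i : X ⟶ W}

lemma formallySmooth_stalkMap {f : X ⟶ S} {x : X} (hx : x ∈ smoothLocus f) :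
    (f.stalkMap x).hom.FormallySmooth := by
  obtain ⟨U, hxU, hU⟩ := hx
  obtain ⟨y, rfl⟩ : ∃ y : U.toScheme, U.ι y = x := ⟨⟨x, hxU⟩, rfl⟩
  have hy : ((U.ι ≫ f).stalkMap y).hom.FormallySmooth :=
    (U.ι ≫ f).smoothLocus_eq_top.ge (Set.mem_univ y)
  rw [Scheme.Hom.stalkMap_comp] at hy
  exact (RingHom.FormallySmooth.respectsIso.cancel_right_isIso (f.stalkMap (U.ι y))
    (U.ι.stalkMap y)).mp hy

lemma formallySmooth_germ {U : S.Opens} (hU : IsAffineOpen U) {s : S} (hs : s ∈ U) :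
    (S.presheaf.germ U s hs).hom.FormallySmooth := by
  let := S.presheaf.algebra_section_stalk (⟨s, hs⟩ : U)
  have := hU.isLocalization_stalk ⟨s, hs⟩
  exact Algebra.FormallySmooth.of_isLocalization (hU.primeIdealOf ⟨s, hs⟩).asIdeal.primeCompl

lemma appLE_germ (f : X ⟶ S) {V : S.Opens} {U : X.Opens} (h : U ≤ f ⁻¹ᵁ V) {x : X}
    (hx : x ∈ U) :
    f.appLE V U h ≫ X.presheaf.germ U x hx = S.presheaf.germ V (f x) (h hx) ≫ f.stalkMap x := by
  have hV : f x ∈ V := h hx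
  calc f.appLE V U h ≫ X.presheaf.germ U x hx
      = f.app V ≫ X.presheaf.germ (f ⁻¹ᵁ V) x hV := by
        rw [Scheme.Hom.appLE, Category.assoc]
        exact congrArg (f.app V ≫ ·) (X.presheaf.germ_res _ _ _)
    _ = S.presheaf.germ V (f x) hV ≫ f.stalkMap x := (Scheme.Hom.germ_stalkMap f V x hV).symm

lemma formallySmooth_appLE_germ_stalkMap {x : X} (hx : x ∈ smoothLocus (i ≫ q)) {V : S.Opens}
    (hV : IsAffineOpen V) {U : W.Opens} (h : U ≤ q ⁻¹ᵁ V) (hxU : i x ∈ U) :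
    (q.appLE V U h ≫ W.presheaf.germ U (i x) hxU ≫ i.stalkMap x).hom.FormallySmooth := by
  have hstalk : q.appLE V U h ≫ W.presheaf.germ U (i x) hxU ≫ i.stalkMap x =
      S.presheaf.germ V ((i ≫ q) x) (h hxU) ≫ (i ≫ q).stalkMap x := by
    rw [← Category.assoc, appLE_germ, Category.assoc, Scheme.Hom.stalkMap_comp]
    rfl
  rw [hstalk]
  exact (formallySmooth_germ hV (h hxU)).comp (formallySmooth_stalkMap hx)

lemma ker_stalkMap_eq_span_germ [IsIntegral X] [IsClosedImmersion i] {U : W.affineOpens}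
    {F : Γ(W, U.1)} (hF : i.ker.ideal U = Ideal.span {F}) {x : X} (hx : i x ∈ U.1) :
    RingHom.ker (i.stalkMap x).hom = Ideal.span {W.presheaf.germ U.1 (i x) hx F} := by
  have hgerm (a : Γ(W, U.1)) :
      i.stalkMap x (W.presheaf.germ U.1 (i x) hx a) = 0 ↔ a ∈ Ideal.span {F} := by
    rw [← hF, Scheme.Hom.ker_apply, RingHom.mem_ker, Scheme.Hom.germ_stalkMap_apply]
    exact map_eq_zero_iff _ (germ_injective_of_isIntegral (X := X) x hx)
  refine le_antisymm (fun y hy => ?_) ?_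
  · let := W.presheaf.algebra_section_stalk (⟨i x, hx⟩ : U.1)
    have := U.2.isLocalization_stalk ⟨i x, hx⟩
    obtain ⟨⟨a, r⟩, har⟩ := IsLocalization.surj
      (U.2.primeIdealOf ⟨i x, hx⟩).asIdeal.primeCompl y
    have hr : IsUnit (W.presheaf.germ U.1 (i x) hx r.1) := IsLocalization.map_units _ r
    replace har : y * W.presheaf.germ U.1 (i x) hx r.1 = W.presheaf.germ U.1 (i x) hx a := har
    replace hy : i.stalkMap x y = 0 := hy
    have ha : a ∈ Ideal.span {F} := by rw [← hgerm, ← har, map_mul, hy, zero_mul]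
    rw [Ideal.mem_span_singleton] at ha ⊢
    rw [← hr.dvd_mul_right, har]
    exact map_dvd (W.presheaf.germ U.1 (i x) hx).hom ha
  · rw [Ideal.span_singleton_le_iff_mem]
    exact (hgerm F).mpr (Ideal.mem_span_singleton_self F)

lemma mem_ideal_ker_iff [IsIntegral X] [IsClosedImmersion i] (U : W.affineOpens)
    (F : Γ(W, U.1)) : F ∈ i.ker.ideal U ↔ i (genericPoint X) ∉ W.basicOpen F := by
  have hpreimage : i (genericPoint X) ∈ W.basicOpen F ↔
      genericPoint X ∈ X.basicOpen (i.app U.1 F) := by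
    rw [← Scheme.preimage_basicOpen]
    rfl
  rw [Scheme.Hom.ker_apply, RingHom.mem_ker, hpreimage, ← basicOpen_eq_bot_iff]
  refine ⟨fun hbot => hbot ▸ id, fun hgen => ?_⟩
  by_contra hne
  obtain ⟨y, hy⟩ := (TopologicalSpace.Opens.ne_bot_iff_nonempty _).mp hne
  exact hgen ((genericPoint_specializes y).mem_open (X.basicOpen _).2 hy)

lemma genericPoint_mem [IsIntegral X] {U : W.Opens} {x : X} (hx : i x ∈ U) :
    i (genericPoint X) ∈ U :=
  (genericPoint_specializes x).mem_open (i ⁻¹ᵁ U).2 hx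

namespace Chart

lemma mem_equations_iff [IsIntegral X] [IsClosedImmersion i] (c : Chart q) (F : Γ(W, c.U)) :
    F ∈ c.equations i ↔ i (genericPoint X) ∉ W.basicOpen F :=
  mem_ideal_ker_iff ⟨c.U, c.isAffineOpen_U⟩ F

lemma genericPoint_mem_basicOpen_iff [IsIntegral X] [IsClosedImmersion i] (c : Chart q)
    (F : Γ(W, c.U)) : i (genericPoint X) ∈ W.basicOpen F ↔ F ∉ c.equations i := by
  rw [mem_equations_iff, not_not]

lemma isPrime_equations [IsIntegral X] [IsClosedImmersion i] (c : Chart q)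
    (h : i (genericPoint X) ∈ c.U) : (c.equations i).IsPrime := by
  refine ⟨(Ideal.ne_top_iff_one _).mpr ?_, fun {F G} hFG => ?_⟩
  · rwa [← genericPoint_mem_basicOpen_iff, Scheme.basicOpen_of_isUnit _ isUnit_one]
  · simp only [mem_equations_iff, Scheme.basicOpen_mul] at hFG ⊢
    by_contra! hmem
    exact hFG hmem

lemma exists_mem_basicOpen_deriv [IsIntegral W] [IsIntegral X] [IsClosedImmersion i] (c : Chart q)
    {F : Γ(W, c.U)} (hF : c.equations i = Ideal.span {F}) (hF0 : F ≠ 0) {x : X}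
    (hx : x ∈ smoothLocus (i ≫ q)) (hxc : i x ∈ c.U) :
    ∃ t : c.Tangent, i x ∈ W.basicOpen (c.deriv t F) := by
  let germ := W.presheaf.germ c.U (i x) hxc
  let := germ.hom.toAlgebra
  let := (q.appLE c.V c.U c.le ≫ germ).hom.toAlgebra
  let := (i.stalkMap x).hom.toAlgebra
  let := (q.appLE c.V c.U c.le ≫ germ ≫ i.stalkMap x).hom.toAlgebra
  have : IsScalarTower Γ(S, c.V) Γ(W, c.U) (W.presheaf.stalk (i x)) := .of_algebraMap_eq' rfl
  have : IsScalarTower Γ(S, c.V) (W.presheaf.stalk (i x)) (X.presheaf.stalk x) :=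
    .of_algebraMap_eq' rfl
  have : Algebra.FormallySmooth Γ(S, c.V) (X.presheaf.stalk x) :=
    formallySmooth_appLE_germ_stalkMap hx c.isAffineOpen_V c.le hxc
  have := c.free
  have := c.finite
  have hker : RingHom.ker (algebraMap (W.presheaf.stalk (i x)) (X.presheaf.stalk x)) =
      Ideal.span {algebraMap Γ(W, c.U) (W.presheaf.stalk (i x)) F} :=
    ker_stalkMap_eq_span_germ (U := ⟨c.U, c.isAffineOpen_U⟩) hF hxc
  have hgerm : algebraMap Γ(W, c.U) (W.presheaf.stalk (i x)) F ≠ 0 :=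
    (map_ne_zero_iff _ (germ_injective_of_isIntegral (X := W) (i x) hxc)).mpr hF0
  obtain ⟨t, ht⟩ := exists_isUnit_dual_D (R := Γ(S, c.V)) (i.stalkMap_surjective x) hker hgerm
  exact ⟨t, (W.mem_basicOpen _ _ hxc).mpr ht⟩

end Chart

lemma isField_of_flat_field {R K : Type*} [CommRing R] [IsLocalRing R] [Field K] [Algebra R K]
    [Module.Flat R K] [IsLocalHom (algebraMap R K)] : IsField R := by
  have : Module.FaithfullyFlat R K := Module.FaithfullyFlat.of_flat_of_isLocalHom
  have hinj : Function.Injective (algebraMap R K) := FaithfulSMul.algebraMap_injective R K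
  refine ⟨exists_pair_ne R, mul_comm, fun {a} ha => IsUnit.exists_right_inv ?_⟩
  exact isUnit_of_map_unit (algebraMap R K) a
    (isUnit_iff_ne_zero.mpr ((map_ne_zero_iff _ hinj).mpr ha))

lemma formallySmooth_of_flat_field {R K : Type u} [CommRing R] [IsLocalRing R] [CharZero R]
    [Field K] [Algebra R K] [Algebra.EssFiniteType R K] [Module.Flat R K]
    [IsLocalHom (algebraMap R K)] : Algebra.FormallySmooth R K := by
  let := (isField_of_flat_field (R := R) (K := K)).toField
  exact Algebra.FormallySmooth.of_perfectField

lemma genericPoint_mem_smoothLocus {k : Type u} [Field k] [CharZero k] (s : S ⟶ Spec (.of k))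
    (f : X ⟶ S) [IsIntegral X] [LocallyOfFinitePresentation f] [Flat f] :
    genericPoint X ∈ smoothLocus f := by
  have hsmooth : (f.stalkMap (genericPoint X)).hom.FormallySmooth := by
    have hess := LocallyOfFiniteType.stalkMap f (genericPoint X)
    have hflat := Flat.stalkMap f (genericPoint X)
    have hlocal : IsLocalHom (f.stalkMap (genericPoint X)).hom :=
      f.toLRSHom.prop (genericPoint X)
    let : Field (X.presheaf.stalk (genericPoint X)) := inferInstanceAs (Field X.functionField)
    algebraize [(f.stalkMap (genericPoint X)).hom]
    have : CharZero (S.presheaf.stalk (f (genericPoint X))) :=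
      charZero_of_injective_ringHom (RingHom.injective
        ((S.presheaf.germ ⊤ (f (genericPoint X)) trivial).hom.comp
          (s.appTop.hom.comp (Scheme.ΓSpecIso (.of k)).inv.hom)))
    exact formallySmooth_of_flat_field
  obtain ⟨U, hU, V, hV, hVU, hgen, H⟩ := exists_smooth_of_formallySmooth_stalk f _ hsmooth
  refine ⟨V, hgen, ?_⟩
  have : IsAffine _ := hU
  have : IsAffine _ := hV
  have : Smooth (f.resLE U V hVU) := by
    rw [HasRingHomProperty.iff_of_isAffine (P := @Smooth)]
    exact (RingHom.Smooth.propertyIsLocal.respectsIso.arrow_mk_iso_iff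
      (arrowResLEAppIso f U V hVU)).mpr H
  rw [← Scheme.Hom.resLE_comp_ι f hVU]
  infer_instance

end SmoothPoints

/-! ### Local equations of a divisor -/

section LocalEquations

lemma mem_primeIdealOf_iff {X : Scheme.{u}} {U : X.Opens} (hU : IsAffineOpen U) (x : U)
    (f : Γ(X, U)) : f ∈ (hU.primeIdealOf x).asIdeal ↔ x.1 ∉ X.basicOpen f := by
  have hx : x.1 ∈ X.basicOpen f ↔ hU.primeIdealOf x ∈ hU.fromSpec ⁻¹ᵁ X.basicOpen f := by
    change _ ↔ hU.fromSpec (hU.primeIdealOf x) ∈ X.basicOpen f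
    rw [hU.fromSpec_primeIdealOf]
  rw [hx, hU.fromSpec_preimage_basicOpen]
  exact not_not.symm

lemma fromSpec_eq_of_forall_mem_asIdeal_iff {X : Scheme.{u}} {U : X.Opens} (hU : IsAffineOpen U)
    {x : X} (hx : x ∈ U) {y : Spec Γ(X, U)} (h : ∀ f, f ∈ y.asIdeal ↔ x ∉ X.basicOpen f) :
    hU.fromSpec y = x := by
  have hy : y = hU.primeIdealOf ⟨x, hx⟩ := by
    refine PrimeSpectrum.ext (Ideal.ext fun f => ?_)
    rw [h, mem_primeIdealOf_iff]
  rw [hy, hU.fromSpec_primeIdealOf]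

lemma height_primeIdealOf {X : Scheme.{u}} {U : X.Opens} (hU : IsAffineOpen U) (x : U) :
    (hU.primeIdealOf x).asIdeal.height = Order.coheight x.1 := by
  let := X.presheaf.algebra_section_stalk x
  have := hU.isLocalization_stalk x
  have hdim := IsLocalization.AtPrime.ringKrullDim_eq_height (hU.primeIdealOf x).asIdeal
    (X.presheaf.stalk x.1)
  rw [ringKrullDim_stalk_eq_coheight] at hdim
  exact_mod_cast hdim.symm

lemma exists_isStandardSmooth_of_field {k : Type u} [Field k] {W : Scheme.{u}}
    (σ : W ⟶ Spec (.of k)) [Smooth σ] (w : W) :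
    ∃ V : W.affineOpens, w ∈ V.1 ∧ ∃ f : k →+* Γ(W, V.1), f.IsStandardSmooth := by
  obtain ⟨U, hU, V, hV, hw, hVU, hsmooth⟩ := Smooth.exists_isStandardSmooth σ w
  obtain rfl : U = ⊤ := by
    refine top_le_iff.mp fun y _ => ?_
    have : Subsingleton (Spec (.of k)) := inferInstanceAs (Subsingleton (PrimeSpectrum k))
    rw [Subsingleton.elim y (σ w)]
    exact hVU hw
  exact ⟨⟨V, hV⟩, hw, _, RingHom.isStandardSmooth_respectsIso.2 _
    (Scheme.ΓSpecIso (.of k)).symm.commRingCatIsoToRingEquiv hsmooth⟩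

lemma ideal_eq_span_of_le {W : Scheme.{u}} (J : W.IdealSheafData) {V' V : W.affineOpens}
    (h : V'.1 ≤ V.1) {F r : Γ(W, V.1)} (hF : F ∈ J.ideal V)
    (hspan : ∀ y ∈ J.ideal V, r * y ∈ Ideal.span {F})
    (hr : IsUnit (W.presheaf.map (homOfLE h).op r)) :
    J.ideal V' = Ideal.span {W.presheaf.map (homOfLE h).op F} := by
  rw [← J.map_ideal h]
  apply le_antisymm
  · rw [Ideal.map_le_iff_le_comap]
    intro y hy
    have hmap := Ideal.mem_map_of_mem (W.presheaf.map (homOfLE h).op).hom (hspan y hy)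
    rw [Ideal.map_span, Set.image_singleton, map_mul] at hmap
    exact (Ideal.unit_mul_mem_iff_mem _ hr).mp hmap
  · rw [Ideal.span_singleton_le_iff_mem]
    exact Ideal.mem_map_of_mem _ hF

variable {k : Type u} [Field k] [IsAlgClosed k] {S W X : Scheme.{u}} {i : X ⟶ W}

lemma ideal_ker_ne_bot [IsIntegral W] [IsIntegral X] [IsClosedImmersion i]
    (hcodim : Order.coheight (i (genericPoint X)) ≠ 0) {V : W.affineOpens}
    (hgen : i (genericPoint X) ∈ V.1) : i.ker.ideal V ≠ ⊥ := by
  have hV : IsAffineOpen V.1 := V.2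
  have : Nonempty V.1 := ⟨⟨_, hgen⟩⟩
  rw [← height_primeIdealOf hV ⟨_, hgen⟩] at hcodim
  rintro hbot
  refine hcodim (Ideal.height_eq_zero_iff_eq_bot.mpr (eq_bot_iff.mpr fun F hF => ?_))
  rwa [mem_primeIdealOf_iff, ← mem_ideal_ker_iff, hbot] at hF

lemma exists_ideal_ker_eq_span_of_isClosed (σ : W ⟶ Spec (.of k)) [Smooth σ]
    [IsIntegral W] [IsIntegral X] [IsClosedImmersion i]
    (hcodim : Order.coheight (i (genericPoint X)) = 1) {x : X} (hx : IsClosed {i x}) :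
    ∃ V : W.affineOpens, i x ∈ V.1 ∧ ∃ F, i.ker.ideal V = Ideal.span {F} := by
  obtain ⟨V, hxV, f, hf⟩ := exists_isStandardSmooth_of_field σ (i x)
  have hV : IsAffineOpen V.1 := V.2
  have hgen : i (genericPoint X) ∈ V.1 := genericPoint_mem hxV
  let := f.toAlgebra
  have : Algebra.IsStandardSmooth k Γ(W, V.1) := hf
  have : Nonempty V.1 := ⟨⟨_, hxV⟩⟩
  have hprime : (hV.primeIdealOf ⟨_, hgen⟩).asIdeal = i.ker.ideal V := by
    ext F
    rw [mem_ideal_ker_iff, mem_primeIdealOf_iff]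
  have hheight : (hV.primeIdealOf ⟨_, hgen⟩).asIdeal.height = 1 := by
    rw [height_primeIdealOf, hcodim]
  have hmax := hV.primeIdealOf_isMaximal_of_isClosed ⟨_, hxV⟩ hx
  obtain ⟨F, hF, r, hr, hspan⟩ := exists_locally_eq_span_of_isStandardSmooth k
    (hV.primeIdealOf ⟨_, hxV⟩).asIdeal (hV.primeIdealOf ⟨_, hgen⟩).asIdeal hheight
  rw [hprime] at hspan hF
  rw [mem_primeIdealOf_iff, not_not] at hr
  exact ⟨W.affineBasicOpen r, hr, _, ideal_eq_span_of_le i.ker (W.basicOpen_le r) hF hspan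
    (RingedSpace.isUnit_res_basicOpen W.toRingedSpace r)⟩

lemma exists_ideal_ker_eq_span (σ : W ⟶ Spec (.of k)) [Smooth σ] [CompactSpace W] [IsIntegral W]
    [IsIntegral X] [IsClosedImmersion i] (hcodim : Order.coheight (i (genericPoint X)) = 1)
    (x : X) : ∃ V : W.affineOpens, i x ∈ V.1 ∧ ∃ F, i.ker.ideal V = Ideal.span {F} := by
  obtain ⟨w, hw, hclosed⟩ := IsClosed.exists_closed_singleton isClosed_closure
    (Set.singleton_nonempty (i x)).closure
  have hspec : i x ⤳ w := specializes_iff_mem_closure.mpr hw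
  obtain ⟨z, rfl⟩ : w ∈ Set.range i :=
    closure_minimal (Set.singleton_subset_iff.mpr (Set.mem_range_self x))
      i.isClosedEmbedding.isClosed_range hw
  obtain ⟨V, hzV, F, hF⟩ := exists_ideal_ker_eq_span_of_isClosed σ hcodim hclosed
  exact ⟨V, hspec.mem_open V.1.2 hzV, F, hF⟩

lemma Chart.exists_equations_eq_span (q : W ⟶ S) [Smooth q] (σ : W ⟶ Spec (.of k)) [Smooth σ]
    [CompactSpace W] [IsIntegral W] [IsIntegral X] [IsClosedImmersion i]
    (hcodim : Order.coheight (i (genericPoint X)) = 1) (x : X) :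
    ∃ c : Chart q, i x ∈ c.U ∧ ∃ F ≠ 0, c.equations i = Ideal.span {F} := by
  obtain ⟨V, hxV, F, hF⟩ := exists_ideal_ker_eq_span σ hcodim x
  obtain ⟨d, hxd⟩ := Chart.exists_mem (q := q) (i x)
  obtain ⟨_, ⟨U, hU, rfl⟩, hxU, hU'⟩ := W.isBasis_affineOpens.exists_subset_of_mem_open
    (show i x ∈ ((V.1 ⊓ d.U : W.Opens) : Set W) from ⟨hxV, hxd⟩) (V.1 ⊓ d.U).2
  have hUV : U ≤ V.1 := fun y hy => (hU' hy).1
  have hUd : U ≤ d.U := fun y hy => (hU' hy).2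
  let e : AffinePair q := ⟨d.V, d.isAffineOpen_V, U, hU, hUd.trans d.le⟩
  have hed : e ≤ d.toAffinePair := ⟨le_rfl, hUd⟩
  have hspan : i.ker.ideal ⟨U, hU⟩ = Ideal.span {W.presheaf.map (homOfLE hUV).op F} := by
    rw [← i.ker.map_ideal (U := ⟨U, hU⟩) (V := V) hUV, hF, Ideal.map_span, Set.image_singleton]
    rfl
  refine ⟨⟨e, AffinePair.free_of_le hed d.free, AffinePair.finite_of_le hed d.finite⟩, hxU,
    _, fun hzero => ?_, hspan⟩
  refine ideal_ker_ne_bot (hcodim.trans_ne one_ne_zero) (genericPoint_mem hxU)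
    (V := ⟨U, hU⟩) ?_
  rw [hspan, hzero, Ideal.span_singleton_zero]

end LocalEquations

/-! ### The generic point of the conormal variety -/

section ConormalPoint

open SymProj

variable {W S X : Scheme.{u}} {q : W ⟶ S} {i : X ⟶ W}

namespace Chart

/-- The relative differential of a function on a chart, as a linear form on the relative vector
fields. -/
def differential (c : Chart q) (F : Γ(W, c.U)) : c.Tangent →ₗ[Γ(W, c.U)] Γ(W, c.U) where
  toFun t := c.deriv t F
  map_add' _ _ := rfl
  map_smul' _ _ := rfl

lemma differential_mul (c : Chart q) (F G : Γ(W, c.U)) (t : c.Tangent) :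
    c.differential (F * G) t = F * c.differential G t + G * c.differential F t :=
  c.deriv_mul t F G

variable (i) in
/-- `F` is an equation of the integral closed subscheme `X` on a chart meeting `X`. The chart meets
`X` exactly when it contains the generic point of `X`. -/
structure IsEquation [IsIntegral X] (c : Chart q) (F : Γ(W, c.U)) : Prop where
  equations_eq : c.equations i = Ideal.span {F}
  ne_zero : F ≠ 0
  mem : i (genericPoint X) ∈ c.U

variable {c d e : Chart q} {F G : Γ(W, c.U)}

lemma lift_differential_symRes (h : e ≤ c) (F : Γ(W, c.U))
    (x : SymmetricAlgebra Γ(W, c.U) c.Tangent) :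
    SymmetricAlgebra.lift (e.differential (W.presheaf.map (homOfLE h.2).op F))
        (AffinePair.symRes h x) =
      W.presheaf.map (homOfLE h.2).op (SymmetricAlgebra.lift (c.differential F) x) := by
  have hcomp :
      (SymmetricAlgebra.lift (e.differential (W.presheaf.map (homOfLE h.2).op F))).toRingHom.comp
        (AffinePair.symRes h).toRingHom = (W.presheaf.map (homOfLE h.2).op).hom.comp
          (SymmetricAlgebra.lift (c.differential F)).toRingHom := by
    refine ringHom_ext (fun a => ?_) fun t => ?_
    · change SymmetricAlgebra.lift _ (AffinePair.symRes h _) =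
        W.presheaf.map (homOfLE h.2).op (SymmetricAlgebra.lift _ _)
      rw [AffinePair.symRes_algebraMap, AlgHom.commutes, AlgHom.commutes]
      rfl
    · change SymmetricAlgebra.lift _ (AffinePair.symRes h _) =
        W.presheaf.map (homOfLE h.2).op (SymmetricAlgebra.lift _ _)
      rw [AffinePair.symRes_ι, SymmetricAlgebra.lift_ι_apply, SymmetricAlgebra.lift_ι_apply]
      exact deriv_res h t F
  exact congr($hcomp x)

variable [IsIntegral X]

namespace IsEquation

lemma res [IsIntegral W] (hF : c.IsEquation i F) (h : e ≤ c) (he : i (genericPoint X) ∈ e.U) :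
    e.IsEquation i (W.presheaf.map (homOfLE h.2).op F) where
  equations_eq := by
    rw [equations_of_le i h, hF.equations_eq, Ideal.map_span, Set.image_singleton]
  ne_zero h₀ := by
    have : Nonempty e.U := ⟨⟨_, he⟩⟩
    exact hF.ne_zero (map_injective_of_isIntegral W (homOfLE h.2) (h₀.trans (map_zero _).symm))
  mem := he

lemma self_mem (hF : c.IsEquation i F) : F ∈ c.equations i := by
  rw [hF.equations_eq]
  exact Ideal.mem_span_singleton_self F

lemma coneIdeal_differential_le (hF : c.IsEquation i F) (hG : c.IsEquation i G) :
    (coneIdeal (c.differential F) (c.equations i)).toIdeal ≤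
      (coneIdeal (c.differential G) (c.equations i)).toIdeal := by
  obtain ⟨u, rfl⟩ : ∃ u, u * F = G := by
    rw [← Ideal.mem_span_singleton', ← hF.equations_eq]
    exact hG.self_mem
  refine toIdeal_le_of_homogeneous fun n x hx hxF => ?_
  replace hxF := (mem_coneIdeal _ _ hx).mp hxF
  refine (mem_coneIdeal _ _ hx).mpr ?_
  have hsub (t) :
      c.differential (u * F) t - u * c.differential F t ∈ c.equations i := by
    rw [differential_mul, add_sub_cancel_left]
    exact Ideal.mul_mem_right _ _ hF.self_mem
  exact (Submodule.sub_mem_iff_left _ (Ideal.mul_mem_left _ _ hxF)).mp (lift_sub_mem hsub hx)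

end IsEquation

variable [IsClosedImmersion i]

lemma res_mem_equations_iff (h : e ≤ c) (he : i (genericPoint X) ∈ e.U) (F : Γ(W, c.U)) :
    W.presheaf.map (homOfLE h.2).op F ∈ e.equations i ↔ F ∈ c.equations i := by
  rw [mem_equations_iff, mem_equations_iff, Scheme.basicOpen_res]
  exact not_congr ⟨fun h => h.2, fun h => ⟨he, h⟩⟩

lemma symRes_mem_coneIdeal_iff (h : e ≤ c) (he : i (genericPoint X) ∈ e.U)
    {n : ℕ} {x : SymmetricAlgebra Γ(W, c.U) c.Tangent} (hx : x ∈ c.symGrading n) :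
    AffinePair.symRes h x ∈
        coneIdeal (e.differential (W.presheaf.map (homOfLE h.2).op F)) (e.equations i) ↔
      x ∈ coneIdeal (c.differential F) (c.equations i) := by
  have hx' : AffinePair.symRes h x ∈ e.symGrading n := (AffinePair.symRes h).map_mem hx
  rw [mem_coneIdeal _ _ hx, mem_coneIdeal _ _ hx', lift_differential_symRes,
    res_mem_equations_iff h he]

namespace IsEquation

variable [IsIntegral W]

lemma exists_deriv_notMem (hF : c.IsEquation i F)
    (hgen : genericPoint X ∈ smoothLocus (i ≫ q)) : ∃ t, c.deriv t F ∉ c.equations i := by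
  obtain ⟨t, ht⟩ := c.exists_mem_basicOpen_deriv hF.equations_eq hF.ne_zero hgen hF.mem
  exact ⟨t, (c.genericPoint_mem_basicOpen_iff _).mp ht⟩

/-- The point of the projectivized cotangent bundle of a chart given by the differential of an
equation at the generic point of `X`. It is the generic point of the projective conormal variety. -/
def point (hF : c.IsEquation i F) (hgen : genericPoint X ∈ smoothLocus (i ≫ q)) :
    Proj c.symGrading where
  asHomogeneousIdeal := coneIdeal (c.differential F) (c.equations i)
  isPrime := by
    have := c.isPrime_equations hF.mem
    exact isPrime_coneIdeal _ _
  not_irrelevant_le h := by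
    obtain ⟨t, ht⟩ := hF.exists_deriv_notMem hgen
    refine ht ((ι_mem_coneIdeal (c.differential F) (c.equations i) t).mp (h ?_))
    exact HomogeneousIdeal.mem_irrelevant_of_mem _ one_pos (ι_mem t)

lemma map_point_res (hF : c.IsEquation i F) (hgen : genericPoint X ∈ smoothLocus (i ≫ q))
    (h : e ≤ c) (he : i (genericPoint X) ∈ e.U) :
    Proj.map (AffinePair.symRes h) (AffinePair.symRes_irrelevant h c.free c.finite)
      ((hF.res h he).point hgen) = hF.point hgen :=
  ProjectiveSpectrum.ext <| HomogeneousIdeal.ext' fun _ _ hx => symRes_mem_coneIdeal_iff h he hx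

lemma point_eq (hF : c.IsEquation i F) (hG : c.IsEquation i G)
    (hgen : genericPoint X ∈ smoothLocus (i ≫ q)) : hF.point hgen = hG.point hgen :=
  ProjectiveSpectrum.ext <| HomogeneousIdeal.toIdeal_injective <|
    le_antisymm (hF.coneIdeal_differential_le hG) (hG.coneIdeal_differential_le hF)

lemma chart_point_res [Smooth q] (hF : c.IsEquation i F)
    (hgen : genericPoint X ∈ smoothLocus (i ≫ q)) (h : e ≤ c) (he : i (genericPoint X) ∈ e.U) :
    projCotangentBundle.chart q e ((hF.res h he).point hgen) =
      projCotangentBundle.chart q c (hF.point hgen) := by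
  have hmap := congr($(projCotangentBundle.map_chart q h) ((hF.res h he).point hgen))
  exact hmap.symm.trans
    (congrArg (projCotangentBundle.chart q c) (hF.map_point_res hgen h he))

lemma chart_point_eq [Smooth q] (hF : c.IsEquation i F) {G : Γ(W, d.U)} (hG : d.IsEquation i G)
    (hgen : genericPoint X ∈ smoothLocus (i ≫ q)) :
    projCotangentBundle.chart q c (hF.point hgen) =
      projCotangentBundle.chart q d (hG.point hgen) := by
  obtain ⟨e, hec, hed, he⟩ := exists_le c d hF.mem hG.mem
  calc projCotangentBundle.chart q c (hF.point hgen)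
      = projCotangentBundle.chart q e ((hF.res hec he).point hgen) :=
        (hF.chart_point_res hgen hec he).symm
    _ = projCotangentBundle.chart q e ((hG.res hed he).point hgen) := by
        rw [point_eq (hF.res hec he) (hG.res hed he)]
    _ = projCotangentBundle.chart q d (hG.point hgen) := hG.chart_point_res hgen hed he

lemma chart_map_point_eq [Smooth q] {E : Γ(W, e.U)} (hE : e.IsEquation i E)
    (hF : c.IsEquation i F) (hgen : genericPoint X ∈ smoothLocus (i ≫ q)) (h : e ≤ d) :
    projCotangentBundle.chart q d (Proj.map (AffinePair.symRes h)
      (AffinePair.symRes_irrelevant h d.free d.finite) (hE.point hgen)) =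
      projCotangentBundle.chart q c (hF.point hgen) :=
  congr($(projCotangentBundle.map_chart q h) (hE.point hgen)).trans (hE.chart_point_eq hF hgen)

end IsEquation

end Chart

namespace cotangentBundle

variable [Smooth q]

lemma algebraMap_mem_iff (c : Chart q)
    (𝔮 : Spec (.of (SymmetricAlgebra Γ(W, c.U) c.Tangent))) (F : Γ(W, c.U)) :
    algebraMap _ _ F ∈ 𝔮.asIdeal ↔ proj q (chart q c 𝔮) ∉ W.basicOpen F := by
  let toBase := Spec.map (CommRingCat.ofHom
    (algebraMap Γ(W, c.U) (SymmetricAlgebra Γ(W, c.U) c.Tangent)))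
  have hproj : proj q (chart q c 𝔮) = c.isAffineOpen_U.fromSpec (toBase 𝔮) :=
    congr($(chart_proj q c) 𝔮)
  have hmem : proj q (chart q c 𝔮) ∈ W.basicOpen F ↔
      toBase 𝔮 ∈ c.isAffineOpen_U.fromSpec ⁻¹ᵁ W.basicOpen F := by
    rw [hproj]
    rfl
  rw [hmem, c.isAffineOpen_U.fromSpec_preimage_basicOpen]
  exact not_not.symm

lemma proj_chart_mem (c : Chart q) (𝔮 : Spec (.of (SymmetricAlgebra Γ(W, c.U) c.Tangent))) :
    proj q (chart q c 𝔮) ∈ c.U :=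
  (opensRange_chart q c).le ⟨𝔮, rfl⟩

lemma exists_chart_eq (c : Chart q) {ξ : cotangentBundle q} (h : proj q ξ ∈ c.U) :
    ∃ 𝔮 : Spec (.of (SymmetricAlgebra Γ(W, c.U) c.Tangent)), chart q c 𝔮 = ξ :=
  (opensRange_chart q c).ge h

lemma symRes_mem_iff_of_chart_eq {c e : Chart q} (h : e ≤ c)
    {𝔮 : Spec (.of (SymmetricAlgebra Γ(W, c.U) c.Tangent))}
    {𝔭 : Spec (.of (SymmetricAlgebra Γ(W, e.U) e.Tangent))}
    (h𝔭 : chart q e 𝔭 = chart q c 𝔮) (x : SymmetricAlgebra Γ(W, c.U) c.Tangent) :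
    AffinePair.symRes h x ∈ 𝔭.asIdeal ↔ x ∈ 𝔮.asIdeal := by
  have hmap : chart q c (Spec.map (CommRingCat.ofHom (AffinePair.symRes h).toRingHom) 𝔭) =
      chart q c 𝔮 := by
    rw [← h𝔭, ← map_chart q h, Scheme.Hom.comp_apply]
  rw [← (chart q c).isOpenEmbedding.injective hmap]
  rfl

end cotangentBundle

end ConormalPoint

/-! ### The conormal variety of a hypersurface -/

section ConormalVariety

open SymProj

variable {W S X : Scheme.{u}} {q : W ⟶ S} {i : X ⟶ W}

lemma SymProj.smul_sub_smul_mem_of_mul_sub_mem {A T : Type u} [CommRing A] [AddCommGroup T]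
    [Module A T] {K : Ideal (SymmetricAlgebra A T)} [K.IsPrime] {g E x x₀ y y₀ : A}
    {z z₀ : SymmetricAlgebra A T} (hE : algebraMap A _ E ∈ K) (hg : algebraMap A _ g ∉ K)
    (h : algebraMap A _ (g * x₀ + E * y₀) * z - algebraMap A _ (g * x + E * y) * z₀ ∈ K) :
    x₀ • z - x • z₀ ∈ K := by
  rw [Algebra.smul_def, Algebra.smul_def]
  refine (Ideal.IsPrime.mem_or_mem ‹_› (?_ : algebraMap A _ g * _ ∈ K)).resolve_left hg
  convert sub_mem h
    (Ideal.mul_mem_right (algebraMap A _ y₀ * z - algebraMap A _ y * z₀) _ hE) using 1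
  simp only [map_add, map_mul]
  ring

lemma AffinePair.symRes_ι_smul_sub {c d : AffinePair q} (h : c ≤ d) (a b : Γ(W, d.U))
    (s t : d.Tangent) :
    symRes h (SymmetricAlgebra.ι Γ(W, d.U) d.Tangent (a • s - b • t)) =
      algebraMap _ _ (W.presheaf.map (homOfLE h.2).op a) *
          SymmetricAlgebra.ι Γ(W, c.U) c.Tangent (res h s) -
        algebraMap _ _ (W.presheaf.map (homOfLE h.2).op b) *
          SymmetricAlgebra.ι Γ(W, c.U) c.Tangent (res h t) := by
  have hι : SymmetricAlgebra.ι Γ(W, d.U) d.Tangent (a • s - b • t) =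
      algebraMap _ _ a * SymmetricAlgebra.ι Γ(W, d.U) d.Tangent s -
        algebraMap _ _ b * SymmetricAlgebra.ι Γ(W, d.U) d.Tangent t := by
    rw [map_sub, map_smul, map_smul, Algebra.smul_def, Algebra.smul_def]
  rw [hι, map_sub, map_mul, map_mul]
  exact congrArg₂ (· - ·) (congrArg₂ (· * ·) (symRes_algebraMap h a) (symRes_ι h s))
    (congrArg₂ (· * ·) (symRes_algebraMap h b) (symRes_ι h t))

namespace Chart

lemma notMem_basicOpen_of_mem_equations {c : Chart q} {F : Γ(W, c.U)}
    (hF : F ∈ c.equations i) (x : X) : i x ∉ W.basicOpen F := by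
  have hzero : i.app c.U F = 0 := i.ideal_ker_le ⟨c.U, c.isAffineOpen_U⟩ hF
  intro h
  replace h : x ∈ i ⁻¹ᵁ W.basicOpen F := h
  rw [Scheme.preimage_basicOpen, hzero, Scheme.basicOpen_zero] at h
  exact h

lemma map_deriv_of_map_eq_mul {d e : Chart q} (h : e ≤ d) {G : Γ(W, d.U)} {g E : Γ(W, e.U)}
    (hG : W.presheaf.map (homOfLE h.2).op G = g * E) (t : d.Tangent) :
    W.presheaf.map (homOfLE h.2).op (d.deriv t G) =
      g * e.differential E (AffinePair.res h t) + E * e.differential g (AffinePair.res h t) := by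
  rw [← deriv_res h, hG]
  exact deriv_mul e _ g E

lemma exists_map_eq_mul {d e : Chart q} (h : e ≤ d) {E : Γ(W, e.U)}
    (hE : e.equations i = Ideal.span {E}) {G : Γ(W, d.U)} (hG : G ∈ d.equations i) :
    ∃ g, W.presheaf.map (homOfLE h.2).op G = g * E := by
  obtain ⟨g, hg⟩ := Ideal.mem_span_singleton'.mp <|
    (equations_of_le i h ▸ hE).le (Ideal.mem_map_of_mem _ hG)
  exact ⟨g, hg.symm⟩

section Proportional

variable {d e : Chart q} (h : e ≤ d) {E : Γ(W, e.U)}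
  {K : Ideal (SymmetricAlgebra Γ(W, e.U) e.Tangent)} [K.IsPrime] {G : Γ(W, d.U)} {g : Γ(W, e.U)}

lemma map_deriv_minor_mem {G' : Γ(W, d.U)} {g' : Γ(W, e.U)}
    (hG : W.presheaf.map (homOfLE h.2).op G = g * E)
    (hG' : W.presheaf.map (homOfLE h.2).op G' = g' * E) (t₀ t : d.Tangent) :
    W.presheaf.map (homOfLE h.2).op (d.deriv (d.deriv t₀ G • t - d.deriv t G • t₀) G') ∈
      Ideal.span {E} := by
  have hminor : d.deriv (d.deriv t₀ G • t - d.deriv t G • t₀) G' =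
      d.deriv t₀ G * d.deriv t G' - d.deriv t G * d.deriv t₀ G' := rfl
  have hE : Ideal.Quotient.mk (Ideal.span {E}) E = 0 :=
    Ideal.Quotient.eq_zero_iff_mem.mpr (Ideal.mem_span_singleton_self E)
  rw [hminor, map_sub, map_mul, map_mul, map_deriv_of_map_eq_mul h hG,
    map_deriv_of_map_eq_mul h hG, map_deriv_of_map_eq_mul h hG', map_deriv_of_map_eq_mul h hG',
    ← Ideal.Quotient.eq_zero_iff_mem]
  simp only [map_sub, map_mul, map_add, hE, zero_mul, add_zero]
  ring

variable (htan : ∀ t : d.Tangent,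
  (∀ G ∈ d.equations i, algebraMap _ _ (W.presheaf.map (homOfLE h.2).op (d.deriv t G)) ∈ K) →
    AffinePair.symRes h (SymmetricAlgebra.ι _ _ t) ∈ K)

include htan

lemma differential_res_minor_mem (hE : e.equations i = Ideal.span {E})
    (hEK : algebraMap _ _ E ∈ K) (hG : W.presheaf.map (homOfLE h.2).op G = g * E)
    (hg : algebraMap _ _ g ∉ K) (t₀ t : d.Tangent) :
    e.differential E (AffinePair.res h t₀) •
        SymmetricAlgebra.ι Γ(W, e.U) e.Tangent (AffinePair.res h t) -
      e.differential E (AffinePair.res h t) •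
        SymmetricAlgebra.ι Γ(W, e.U) e.Tangent (AffinePair.res h t₀) ∈ K := by
  have hι := htan (d.deriv t₀ G • t - d.deriv t G • t₀) fun G' hG' => by
    obtain ⟨g', hg'⟩ := exists_map_eq_mul h hE hG'
    obtain ⟨r, hr⟩ := Ideal.mem_span_singleton'.mp (map_deriv_minor_mem h hG hg' t₀ t)
    rw [← hr, map_mul]
    exact Ideal.mul_mem_left _ _ hEK
  rw [AffinePair.symRes_ι_smul_sub, map_deriv_of_map_eq_mul h hG,
    map_deriv_of_map_eq_mul h hG] at hι
  exact smul_sub_smul_mem_of_mul_sub_mem hEK hg hι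

lemma differential_minor_mem (hE : e.equations i = Ideal.span {E})
    (hEK : algebraMap _ _ E ∈ K) (hG : W.presheaf.map (homOfLE h.2).op G = g * E)
    (hg : algebraMap _ _ g ∉ K) (t₀ : d.Tangent) (t : e.Tangent) :
    e.differential E (AffinePair.res h t₀) • SymmetricAlgebra.ι Γ(W, e.U) e.Tangent t -
      e.differential E t •
        SymmetricAlgebra.ι Γ(W, e.U) e.Tangent (AffinePair.res h t₀) ∈ K := by
  let minor : e.Tangent →ₗ[Γ(W, e.U)] SymmetricAlgebra Γ(W, e.U) e.Tangent :=
    e.differential E (AffinePair.res h t₀) • SymmetricAlgebra.ι Γ(W, e.U) e.Tangent -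
      (e.differential E).smulRight (SymmetricAlgebra.ι Γ(W, e.U) e.Tangent (AffinePair.res h t₀))
  let N : Submodule Γ(W, e.U) e.Tangent := (K.restrictScalars Γ(W, e.U)).comap minor
  exact tangent_induction h (p := (· ∈ N)) N.zero_mem
    (differential_res_minor_mem h htan hE hEK hG hg t₀) (fun a _ => N.smul_mem a)
    (fun _ _ => N.add_mem) t

lemma coneIdeal_le_of_conormal (hE : e.equations i = Ideal.span {E})
    (hI : ∀ r ∈ e.equations i, algebraMap _ _ r ∈ K) (hG : G ∈ d.equations i) {t₀ : d.Tangent}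
    (ht₀ : algebraMap _ _ (W.presheaf.map (homOfLE h.2).op (d.deriv t₀ G)) ∉ K) :
    (coneIdeal (e.differential E) (e.equations i)).toIdeal ≤ K := by
  obtain ⟨g, hg⟩ := exists_map_eq_mul h hE hG
  have hEK : algebraMap _ _ E ∈ K := hI E (hE ▸ Ideal.mem_span_singleton_self E)
  have hprod : algebraMap _ _ g * algebraMap _ _ (e.differential E (AffinePair.res h t₀)) ∉ K := by
    rw [map_deriv_of_map_eq_mul h hg, map_add, map_mul, map_mul _ E] at ht₀
    exact fun hmem => ht₀ (add_mem hmem (Ideal.mul_mem_right _ _ hEK))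
  exact coneIdeal_le hI (t₀ := AffinePair.res h t₀)
    (fun hmem => hprod (Ideal.mul_mem_left _ _ hmem))
    (differential_minor_mem h htan hE hEK hg (fun hmem => hprod (Ideal.mul_mem_right _ _ hmem)) t₀)

end Proportional

lemma exists_mem_basicOpen_deriv_of_le [IsIntegral W] [IsIntegral X] [IsClosedImmersion i]
    {d e : Chart q} (h : e ≤ d) {E : Γ(W, e.U)} (hE : e.IsEquation i E) {x : X}
    (hx : x ∈ smoothLocus (i ≫ q)) (hxe : i x ∈ e.U) :
    ∃ t : d.Tangent, ∃ G ∈ d.equations i, i x ∈ W.basicOpen (d.deriv t G) := by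
  by_contra! hderiv
  obtain ⟨t, ht⟩ := e.exists_mem_basicOpen_deriv hE.equations_eq hE.ne_zero hx hxe
  let 𝔪 := e.isAffineOpen_U.primeIdealOf ⟨i x, hxe⟩
  have hres (r : Γ(W, d.U)) (hr : i x ∉ W.basicOpen r) :
      W.presheaf.map (homOfLE h.2).op r ∈ 𝔪.asIdeal := by
    rw [mem_primeIdealOf_iff, Scheme.basicOpen_res]
    exact fun hmem => hr hmem.2
  have hle : e.singIdeal i ≤ 𝔪.asIdeal := by
    rw [singIdeal_of_le i h, Ideal.map_le_iff_le_comap, singIdeal_le_iff]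
    exact fun G hG => ⟨hres G (notMem_basicOpen_of_mem_equations hG x),
      fun t => hres _ (hderiv t G hG)⟩
  exact (mem_primeIdealOf_iff _ _ _).mp (hle (e.deriv_mem_singIdeal t hE.self_mem)) ht

end Chart

namespace cotangentBundle

variable [Smooth q]

lemma algebraMap_mem_of_mem_equations {c : Chart q}
    {𝔮 : Spec (.of (SymmetricAlgebra Γ(W, c.U) c.Tangent))} {x : X}
    (hx : i x = proj q (chart q c 𝔮)) {F : Γ(W, c.U)} (hF : F ∈ c.equations i) :
    algebraMap _ _ F ∈ 𝔮.asIdeal := by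
  rw [algebraMap_mem_iff, ← hx]
  exact Chart.notMem_basicOpen_of_mem_equations hF x

lemma proj_mem_range_of_mem_conormalVariety [IsClosedImmersion i] {ξ : cotangentBundle q}
    (hξ : ξ ∈ conormalVariety q i) : proj q ξ ∈ Set.range i := by
  refine closure_minimal (t := proj q ⁻¹' Set.range i) ?_
    (i.isClosedEmbedding.isClosed_range.preimage (proj q).continuous) hξ
  rintro ξ ⟨⟨x, _, hx⟩, _⟩
  exact ⟨x, hx⟩

end cotangentBundle

lemma projCotangentBundle.chart_specializes [Smooth q] {c : Chart q} {l₀ l : Proj c.symGrading}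
    (h : l₀.asHomogeneousIdeal.toIdeal ≤ l.asHomogeneousIdeal.toIdeal) :
    chart q c l₀ ⤳ chart q c l :=
  (specializes_iff_mem_closure.mpr
    ((ProjectiveSpectrum.le_iff_mem_closure _ l₀ l).mp h)).map (chart q c).continuous

variable [IsIntegral X] [IsClosedImmersion i] [Smooth q] {c : Chart q} {F : Γ(W, c.U)}

namespace Chart.IsEquation

/-- The point of the cotangent bundle of a chart given by the homogeneous ideal of
`Chart.IsEquation.point`. It is the generic point of the conormal variety. -/
def conePoint (hF : c.IsEquation i F) : Spec (.of (SymmetricAlgebra Γ(W, c.U) c.Tangent)) where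
  asIdeal := (coneIdeal (c.differential F) (c.equations i)).toIdeal
  isPrime := by
    have := c.isPrime_equations hF.mem
    exact isPrime_coneIdeal _ _

lemma proj_chart_conePoint (hF : c.IsEquation i F) :
    cotangentBundle.proj q (cotangentBundle.chart q c hF.conePoint) = i (genericPoint X) :=
  congr($(cotangentBundle.chart_proj q c) hF.conePoint).trans
    (fromSpec_eq_of_forall_mem_asIdeal_iff c.isAffineOpen_U hF.mem fun r =>
      (algebraMap_mem_coneIdeal (c.differential F) (c.equations i) r).trans (c.mem_equations_iff r))

lemma chart_conePoint_mem_conormalSet (hF : c.IsEquation i F)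
    (hgen : genericPoint X ∈ smoothLocus (i ≫ q)) :
    cotangentBundle.chart q c hF.conePoint ∈ conormalSet q i :=
  ⟨⟨_, hgen, hF.proj_chart_conePoint.symm⟩, c, hF.conePoint, rfl, fun t ht =>
    (ι_mem_coneIdeal (c.differential F) (c.equations i) t).mpr
      ((algebraMap_mem_coneIdeal (c.differential F) (c.equations i) _).mp (ht F hF.self_mem))⟩

variable [IsIntegral W]

lemma coneIdeal_le_of_mem_conormalSet (hF : c.IsEquation i F)
    {𝔮 : Spec (.of (SymmetricAlgebra Γ(W, c.U) c.Tangent))}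
    (h𝔮 : cotangentBundle.chart q c 𝔮 ∈ conormalSet q i) :
    (coneIdeal (c.differential F) (c.equations i)).toIdeal ≤ 𝔮.asIdeal := by
  obtain ⟨⟨x, hx, hxw⟩, d, 𝔭, h𝔭, htan⟩ := h𝔮
  change Spec (.of (SymmetricAlgebra Γ(W, d.U) d.Tangent)) at 𝔭
  have hxc : i x ∈ c.U := hxw ▸ cotangentBundle.proj_chart_mem c 𝔮
  have hxd : i x ∈ d.U := hxw ▸ h𝔭 ▸ cotangentBundle.proj_chart_mem d 𝔭
  obtain ⟨e, hec, hed, hxe⟩ := exists_le c d hxc hxd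
  have he := genericPoint_mem hxe
  have hE := hF.res hec he
  obtain ⟨𝔯, h𝔯⟩ := cotangentBundle.exists_chart_eq e (hxw ▸ hxe)
  change Spec (.of (SymmetricAlgebra Γ(W, e.U) e.Tangent)) at 𝔯
  have hx𝔯 : i x = cotangentBundle.proj q (cotangentBundle.chart q e 𝔯) := hxw.trans (h𝔯 ▸ rfl)
  have h𝔭𝔯 := cotangentBundle.symRes_mem_iff_of_chart_eq hed (h𝔯.trans h𝔭.symm)
  have hmap (r : Γ(W, d.U)) : algebraMap _ _ (W.presheaf.map (homOfLE hed.2).op r) ∈ 𝔯.asIdeal ↔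
      algebraMap _ _ r ∈ 𝔭.asIdeal := by
    rw [← h𝔭𝔯, AffinePair.symRes_algebraMap]
  obtain ⟨t₀, G, hG, ht₀⟩ := exists_mem_basicOpen_deriv_of_le hed hE hx hxe
  have hprime := 𝔯.isPrime
  have hle : (coneIdeal (e.differential (W.presheaf.map (homOfLE hec.2).op F))
      (e.equations i)).toIdeal ≤ 𝔯.asIdeal := by
    refine coneIdeal_le_of_conormal hed (fun t ht => (h𝔭𝔯 _).mpr (htan t fun G hG => ?_))
      hE.equations_eq (fun r hr => ?_) hG (t₀ := t₀) fun hmem => ?_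
    · exact (hmap _).mp (ht G hG)
    · exact cotangentBundle.algebraMap_mem_of_mem_equations hx𝔯 hr
    · rw [hmap, cotangentBundle.algebraMap_mem_iff, h𝔭, ← hxw] at hmem
      exact hmem ht₀
  refine toIdeal_le_of_homogeneous fun n y hy hyc => ?_
  rw [← cotangentBundle.symRes_mem_iff_of_chart_eq hec h𝔯]
  exact hle ((symRes_mem_coneIdeal_iff hec he hy).mpr hyc)

lemma coneIdeal_le_of_mem_conormalVariety (hF : c.IsEquation i F)
    {𝔮 : Spec (.of (SymmetricAlgebra Γ(W, c.U) c.Tangent))}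
    (h𝔮 : cotangentBundle.chart q c 𝔮 ∈ conormalVariety q i) :
    (coneIdeal (c.differential F) (c.equations i)).toIdeal ≤ 𝔮.asIdeal := by
  have hcl : 𝔮 ∈ closure (cotangentBundle.chart q c ⁻¹' conormalSet q i) := by
    rw [← (cotangentBundle.chart q c).isOpenEmbedding.isOpenMap.preimage_closure_eq_closure_preimage
      (cotangentBundle.chart q c).continuous]
    exact h𝔮
  exact closure_minimal (t := PrimeSpectrum.zeroLocus
    ((coneIdeal (c.differential F) (c.equations i)).toIdeal :
      Set (SymmetricAlgebra Γ(W, c.U) c.Tangent)))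
    (fun 𝔭 h𝔭 => hF.coneIdeal_le_of_mem_conormalSet (𝔮 := 𝔭) h𝔭)
    (PrimeSpectrum.isClosed_zeroLocus _) hcl

lemma chart_point_mem_projectivization (hF : c.IsEquation i F)
    (hgen : genericPoint X ∈ smoothLocus (i ≫ q)) :
    projCotangentBundle.chart q c (hF.point hgen) ∈ projectivization q (conormalVariety q i) :=
  ⟨c, hF.conePoint, hF.point hgen, subset_closure (hF.chart_conePoint_mem_conormalSet hgen),
    (HomogeneousIdeal.toIdeal_homogeneousCore_eq_self _).symm, rfl⟩

lemma chart_map_point_specializes {d e : Chart q} {E : Γ(W, e.U)} (hE : e.IsEquation i E)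
    (hgen : genericPoint X ∈ smoothLocus (i ≫ q)) (h : e ≤ d)
    {𝔮 : Spec (.of (SymmetricAlgebra Γ(W, d.U) d.Tangent))}
    (h𝔮 : cotangentBundle.chart q d 𝔮 ∈ conormalVariety q i)
    (he : cotangentBundle.proj q (cotangentBundle.chart q d 𝔮) ∈ e.U) {l : Proj d.symGrading}
    (hl : l.asHomogeneousIdeal = 𝔮.asIdeal.homogeneousCore d.symGrading) :
    projCotangentBundle.chart q d (Proj.map (AffinePair.symRes h)
        (AffinePair.symRes_irrelevant h d.free d.finite) (hE.point hgen)) ⤳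
      projCotangentBundle.chart q d l := by
  obtain ⟨𝔯, h𝔯⟩ := cotangentBundle.exists_chart_eq e he
  change Spec (.of (SymmetricAlgebra Γ(W, e.U) e.Tangent)) at 𝔯
  have hle : (coneIdeal (e.differential E) (e.equations i)).toIdeal ≤ 𝔯.asIdeal :=
    hE.coneIdeal_le_of_mem_conormalVariety (by rw [h𝔯]; exact h𝔮)
  refine projCotangentBundle.chart_specializes <| toIdeal_le_of_homogeneous fun n y hy hyl => ?_
  rw [hl]
  refine Ideal.mem_homogeneousCore_of_homogeneous_of_mem ⟨n, hy⟩ ?_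
  rw [← cotangentBundle.symRes_mem_iff_of_chart_eq h h𝔯]
  exact hle hyl

end Chart.IsEquation

variable (q i) in
/-- `X` is a generically smooth hypersurface in `W` relative to `q`: it is smooth over the base at
its generic point, and on charts around all of its points it is defined by a single equation. -/
structure IsHypersurface : Prop where
  generically_smooth : genericPoint X ∈ smoothLocus (i ≫ q)
  exists_isEquation : ∀ x : X, ∃ (c : Chart q) (F : Γ(W, c.U)), i x ∈ c.U ∧ c.IsEquation i F

namespace IsHypersurface

variable [IsIntegral W]

omit [IsClosedImmersion i] [Smooth q] in
lemma exists_le_isEquation (H : IsHypersurface q i) (d : Chart q) {x : X} (hx : i x ∈ d.U) :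
    ∃ (e : Chart q) (E : Γ(W, e.U)), e ≤ d ∧ i x ∈ e.U ∧ e.IsEquation i E := by
  obtain ⟨d', G, hxd', hG⟩ := H.exists_isEquation x
  obtain ⟨e, hed, hed', hxe⟩ := Chart.exists_le d d' hx hxd'
  exact ⟨e, _, hed, hxe, hG.res hed' (genericPoint_mem hxe)⟩

lemma chart_point_specializes (H : IsHypersurface q i) (hF : c.IsEquation i F)
    {p : projCotangentBundle q} (hp : p ∈ projectivization q (conormalVariety q i)) :
    projCotangentBundle.chart q c (hF.point H.generically_smooth) ⤳ p := by
  obtain ⟨d, 𝔮, l, h𝔮, hl, rfl⟩ := hp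
  obtain ⟨x, hx⟩ := cotangentBundle.proj_mem_range_of_mem_conormalVariety h𝔮
  have hxd : i x ∈ d.U := by rw [hx]; exact cotangentBundle.proj_chart_mem d 𝔮
  obtain ⟨e, E, hed, hxe, hE⟩ := H.exists_le_isEquation d hxd
  rw [← hE.chart_map_point_eq hF H.generically_smooth hed]
  exact hE.chart_map_point_specializes H.generically_smooth hed h𝔮 (by rw [← hx]; exact hxe) hl

lemma closure_projectivization (H : IsHypersurface q i) (hF : c.IsEquation i F) :
    closure (projectivization q (conormalVariety q i)) =
      closure {projCotangentBundle.chart q c (hF.point H.generically_smooth)} :=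
  Set.Subset.antisymm
    (closure_minimal (fun _ hp => (H.chart_point_specializes hF hp).mem_closure) isClosed_closure)
    (closure_mono (Set.singleton_subset_iff.mpr
      (hF.chart_point_mem_projectivization H.generically_smooth)))

lemma projConormalIdeal_eq (H : IsHypersurface q i) (hF : c.IsEquation i F) :
    projConormalIdeal q i = .vanishingIdeal
      ⟨closure {projCotangentBundle.chart q c (hF.point H.generically_smooth)},
        isClosed_closure⟩ := by
  rw [projConormalIdeal]
  congr 2
  exact H.closure_projectivization hF

end IsHypersurface

end ConormalVariety

/-! ### The universal property over affine schemes -/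

section UniversalProperty

open SymProj

section Algebra

variable {A T C : Type u} [CommRing A] [AddCommGroup T] [Module A T] [CommRing C]

lemma SymProj.map_toAway_eq_mul_of_map_frac_eq_zero {t t' : T}
    (φ : Away (grading A T) (SymmetricAlgebra.ι A T t) →+* C) {a a' : A}
    (h : φ (frac (ι_mem t) (a' • t + (-a) • t')) = 0) :
    φ (toAway T _ a') = φ (frac (ι_mem t) t') * φ (toAway T _ a) := by
  rw [frac_add, frac_smul, frac_smul, frac_self _ rfl, mul_one, map_neg, map_add, map_mul, map_neg,
    neg_mul, add_neg_eq_zero] at h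
  rw [h, mul_comm]

lemma SymProj.lift_ι_smul_add_neg_smul_eq_zero (a : T →ₗ[A] A) (t t' : T) :
    SymmetricAlgebra.lift a (SymmetricAlgebra.ι A T (a t' • t + (-a t) • t')) = 0 := by
  rw [SymmetricAlgebra.lift_ι_apply, map_add, map_smul, map_smul, smul_eq_mul, smul_eq_mul]
  ring

lemma exists_linearMap_eq_mul_of_dvd [Algebra A C] (a : T →ₗ[A] A) {x : C}
    (hx : x ∈ nonZeroDivisors C) (h : ∀ t, x ∣ algebraMap A C (a t)) :
    ∃ φ : T →ₗ[A] C, ∀ t, algebraMap A C (a t) = x * φ t := by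
  choose φ hφ using h
  refine ⟨{ toFun := φ, map_add' s t := ?_, map_smul' r t := ?_ }, hφ⟩
  · refine (mul_cancel_left_mem_nonZeroDivisors hx).mp ?_
    rw [mul_add, ← hφ, ← hφ, ← hφ, map_add, map_add]
  · refine (mul_cancel_left_mem_nonZeroDivisors hx).mp ?_
    rw [← hφ, map_smul, smul_eq_mul, map_mul, hφ, RingHom.id_apply, Algebra.smul_def,
      mul_left_comm]

lemma isUnit_of_eq_mul_of_dvd {x y u : C} (hx : x ∈ nonZeroDivisors C) (h : x = u * y)
    (hxy : x ∣ y) : IsUnit u := by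
  obtain ⟨a, rfl⟩ := hxy
  refine IsUnit.of_mul_eq_one a ((mul_cancel_left_mem_nonZeroDivisors hx).mp ?_)
  rw [mul_one, mul_left_comm]
  exact h.symm

end Algebra

lemma notMem_asIdeal_of_isUnit {B C : CommRingCat.{u}} (φ : B ⟶ C) (z : Spec C) {b : B}
    (h : IsUnit (φ b)) : b ∉ (Spec.map φ z).asIdeal := fun hb =>
  z.isPrime.ne_top (Ideal.eq_top_of_isUnit_mem _ hb h)

lemma exists_SpecMap_comp_eq {P : Scheme.{u}} {B C : CommRingCat.{u}} (j : Spec B ⟶ P)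
    [IsOpenImmersion j] (γ : Spec C ⟶ P) (h : Set.range γ ⊆ Set.range j) :
    ∃ φ : B ⟶ C, Spec.map φ ≫ j = γ := by
  obtain ⟨φ, hφ⟩ := Spec.map_surjective (IsOpenImmersion.lift j γ h)
  exact ⟨φ, by rw [hφ, IsOpenImmersion.lift_fac]⟩

lemma exists_localizationAway_SpecMap_comp_eq {P : Scheme.{u}} {B C : CommRingCat.{u}}
    (j : Spec B ⟶ P) [IsOpenImmersion j] (γ : Spec C ⟶ P) {y : Spec C}
    (hy : γ y ∈ j.opensRange) :
    ∃ (s : C) (z : Spec (.of (Localization.Away s))) (φ : B ⟶ .of (Localization.Away s)),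
      Spec.map (CommRingCat.ofHom (algebraMap C (Localization.Away s))) z = y ∧
      Spec.map φ ≫ j = Spec.map (CommRingCat.ofHom (algebraMap C (Localization.Away s))) ≫ γ := by
  obtain ⟨_, ⟨_, ⟨s, rfl⟩, rfl⟩, hys, hs⟩ :=
    PrimeSpectrum.isBasis_basic_opens.exists_subset_of_mem_open
      (show y ∈ (γ ⁻¹ᵁ j.opensRange : Set (Spec C)) from hy) (γ ⁻¹ᵁ j.opensRange).2
  have hrange : Set.range (Spec.map (CommRingCat.ofHom (algebraMap C (Localization.Away s)))) =
      (PrimeSpectrum.basicOpen s : Set (PrimeSpectrum C)) :=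
    PrimeSpectrum.localization_away_comap_range (Localization.Away s) s
  obtain ⟨z, hz⟩ := hrange.ge hys
  obtain ⟨φ, hφ⟩ := exists_SpecMap_comp_eq j
    (Spec.map (CommRingCat.ofHom (algebraMap C (Localization.Away s))) ≫ γ) (by
      rintro _ ⟨x, rfl⟩
      rw [Scheme.Hom.comp_apply]
      exact hs (hrange.le ⟨x, rfl⟩))
  exact ⟨s, z, φ, hz, hφ⟩

variable {W S X : Scheme.{u}} {q : W ⟶ S} {i : X ⟶ W}
variable {c : Chart q} {F : Γ(W, c.U)} {t₀ : c.Tangent} {C : CommRingCat.{u}} {ψ : Γ(W, c.U) ⟶ C}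

/-- The ring map `ψ` kills the equation `F` and pulls the derivatives of `F` back to multiples of
the nonzerodivisor `ψ (t₀ F)`: this says that `Spec ψ` factors through `X` and pulls the relative
singular scheme back to the effective Cartier divisor `ψ (t₀ F) = 0`. -/
structure Chart.IsAdapted (c : Chart q) (F : Γ(W, c.U)) (t₀ : c.Tangent) {C : CommRingCat.{u}}
    (ψ : Γ(W, c.U) ⟶ C) : Prop where
  map_eq_zero : ψ F = 0
  mem_nonZeroDivisors : ψ (c.deriv t₀ F) ∈ nonZeroDivisors C
  dvd : ∀ t, ψ (c.deriv t₀ F) ∣ ψ (c.deriv t F)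

lemma Chart.IsAdapted.comp_localizationAway (hψ : c.IsAdapted F t₀ ψ) (s : C) :
    c.IsAdapted F t₀ (ψ ≫ CommRingCat.ofHom (algebraMap C (Localization.Away s))) where
  map_eq_zero := by
    rw [CategoryTheory.comp_apply, hψ.map_eq_zero, map_zero]
  mem_nonZeroDivisors := IsLocalization.map_nonZeroDivisors_le (.powers s) (Localization.Away s)
    ⟨_, hψ.mem_nonZeroDivisors, rfl⟩
  dvd t := map_dvd (algebraMap C (Localization.Away s)) (hψ.dvd t)

variable [IsIntegral X]

lemma Chart.IsAdapted.map_eq_zero_of_mem (hψ : c.IsAdapted F t₀ ψ) (hF : c.IsEquation i F)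
    {G : Γ(W, c.U)} (hG : G ∈ c.equations i) : ψ G = 0 := by
  rw [hF.equations_eq, Ideal.mem_span_singleton'] at hG
  obtain ⟨u, rfl⟩ := hG
  rw [map_mul, hψ.map_eq_zero, mul_zero]

lemma Chart.IsAdapted.deriv_notMem_equations [Nontrivial C] (hψ : c.IsAdapted F t₀ ψ)
    (hF : c.IsEquation i F) : c.deriv t₀ F ∉ c.equations i := fun h =>
  nonZeroDivisors.ne_zero hψ.mem_nonZeroDivisors (hψ.map_eq_zero_of_mem hF h)

variable [Smooth q] {t : c.Tangent}

lemma Chart.map_toAway_eq_of_comp_proj_eq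
    {φ : CommRingCat.of (Away c.symGrading (SymmetricAlgebra.ι Γ(W, c.U) c.Tangent t)) ⟶ C}
    (h : (Spec.map φ ≫ projCotangentBundle.piece q c t) ≫ projCotangentBundle.proj q =
      Spec.map ψ ≫ c.isAffineOpen_U.fromSpec) (a : Γ(W, c.U)) :
    φ (toAway c.Tangent _ a) = ψ a := by
  have := c.isAffineOpen_U.isOpenImmersion_fromSpec
  rw [Category.assoc, projCotangentBundle.piece_proj, ← Category.assoc, cancel_mono,
    ← Spec.map_comp] at h
  exact congr($(Spec.map_injective h) a)

variable [IsClosedImmersion i] [IsIntegral W]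

namespace IsHypersurface

lemma projConormalIdeal_le_ker_iff (H : IsHypersurface q i) (hF : c.IsEquation i F)
    (ht : c.deriv t F ∉ c.equations i)
    (φ : CommRingCat.of (Away c.symGrading (SymmetricAlgebra.ι Γ(W, c.U) c.Tangent t)) ⟶ C) :
    projConormalIdeal q i ≤ (Spec.map φ ≫ projCotangentBundle.piece q c t).ker ↔
      ∀ k x (hx : x ∈ c.symGrading (k • 1)),
        SymmetricAlgebra.lift (c.differential F) x ∈ c.equations i →
          φ (Away.mk c.symGrading (ι_mem t) k x hx) = 0 := by
  obtain ⟨y, hy, hy'⟩ := projCotangentBundle.exists_piece_eq q c t (hF.point H.generically_smooth)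
    fun h => ht ((ι_mem_coneIdeal (c.differential F) (c.equations i) t).mp h)
  have hmem (k x) (hx : x ∈ c.symGrading (k • 1)) :
      Away.mk c.symGrading (ι_mem t) k x hx ∈ y.asIdeal ↔
        SymmetricAlgebra.lift (c.differential F) x ∈ c.equations i :=
    (hy' k x hx).trans (mem_coneIdeal (c.differential F) (c.equations i) hx)
  have hideal : projConormalIdeal q i = .vanishingIdeal
      ⟨closure {projCotangentBundle.piece q c t y}, isClosed_closure⟩ :=
    (H.projConormalIdeal_eq hF).trans (congrArg
      (fun z => Scheme.IdealSheafData.vanishingIdeal ⟨closure {z}, isClosed_closure⟩) hy.symm)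
  have hker := vanishingIdeal_closure_singleton_le_ker_iff (projCotangentBundle.piece q c t) y φ
  refine Iff.trans ⟨fun h => hker.mp (hideal.ge.trans h), fun h => hideal.le.trans (hker.mpr h)⟩ ?_
  constructor
  · intro h k x hx hxI
    exact h _ ((hmem k x hx).mpr hxI)
  · intro h b hb
    obtain ⟨k, x, hx, rfl⟩ := Away.mk_surjective c.symGrading (ι_mem t) b
    exact h k x hx ((hmem k x hx).mp hb)

lemma deriv_notMem_equations (H : IsHypersurface q i) (hF : c.IsEquation i F) {T : Scheme.{u}}
    {γ : T ⟶ projCotangentBundle q} (hγ : projConormalIdeal q i ≤ γ.ker) {y : T}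
    (hy : γ y ∈ (projCotangentBundle.piece q c t).opensRange) : c.deriv t F ∉ c.equations i := by
  have hclosure :
      γ y ∈ closure {projCotangentBundle.chart q c (hF.point H.generically_smooth)} := by
    have hsupport := Scheme.IdealSheafData.support_antitone hγ
      (Scheme.Hom.range_subset_ker_support γ ⟨y, rfl⟩)
    rw [H.projConormalIdeal_eq hF] at hsupport
    exact (Scheme.IdealSheafData.coe_support_vanishingIdeal _).le hsupport
  have hpoint := (specializes_iff_mem_closure.mpr hclosure).mem_open
    (projCotangentBundle.piece q c t).opensRange.2 hy
  exact fun h => (projCotangentBundle.mem_opensRange_piece q c t _).mp hpoint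
    ((ι_mem_coneIdeal (c.differential F) (c.equations i) t).mpr h)

lemma map_deriv_eq_mul (H : IsHypersurface q i) (hF : c.IsEquation i F)
    (ht : c.deriv t F ∉ c.equations i)
    (φ : CommRingCat.of (Away c.symGrading (SymmetricAlgebra.ι Γ(W, c.U) c.Tangent t)) ⟶ C)
    (hφ : projConormalIdeal q i ≤ (Spec.map φ ≫ projCotangentBundle.piece q c t).ker)
    (hproj : (Spec.map φ ≫ projCotangentBundle.piece q c t) ≫ projCotangentBundle.proj q =
      Spec.map ψ ≫ c.isAffineOpen_U.fromSpec) (t' : c.Tangent) :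
    ψ (c.deriv t' F) = φ (frac (ι_mem t) t') * ψ (c.deriv t F) := by
  have hminor := (H.projConormalIdeal_le_ker_iff hF ht φ).mp hφ 1
    (SymmetricAlgebra.ι Γ(W, c.U) c.Tangent
      (c.differential F t' • t + (-c.differential F t) • t'))
    (ι_mem _) (by rw [lift_ι_smul_add_neg_smul_eq_zero]; exact zero_mem _)
  have hcomp := Chart.map_toAway_eq_of_comp_proj_eq hproj
  exact (hcomp _).symm.trans
    ((map_toAway_eq_mul_of_map_frac_eq_zero φ.hom hminor).trans (congrArg _ (hcomp _)))

lemma isUnit_map_frac (H : IsHypersurface q i) (hF : c.IsEquation i F)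
    (hψ : c.IsAdapted F t₀ ψ) (ht : c.deriv t F ∉ c.equations i)
    (φ : CommRingCat.of (Away c.symGrading (SymmetricAlgebra.ι Γ(W, c.U) c.Tangent t)) ⟶ C)
    (hφ : projConormalIdeal q i ≤ (Spec.map φ ≫ projCotangentBundle.piece q c t).ker)
    (hproj : (Spec.map φ ≫ projCotangentBundle.piece q c t) ≫ projCotangentBundle.proj q =
      Spec.map ψ ≫ c.isAffineOpen_U.fromSpec) : IsUnit (φ (frac (ι_mem t) t₀)) :=
  isUnit_of_eq_mul_of_dvd hψ.mem_nonZeroDivisors (H.map_deriv_eq_mul hF ht φ hφ hproj t₀) (hψ.dvd t)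

lemma mem_opensRange_piece (H : IsHypersurface q i) (hF : c.IsEquation i F)
    (hψ : c.IsAdapted F t₀ ψ) {γ : Spec C ⟶ projCotangentBundle q}
    (hγ : projConormalIdeal q i ≤ γ.ker)
    (hproj : γ ≫ projCotangentBundle.proj q = Spec.map ψ ≫ c.isAffineOpen_U.fromSpec)
    (y : Spec C) : γ y ∈ (projCotangentBundle.piece q c t₀).opensRange := by
  have hyc : projCotangentBundle.proj q (γ y) ∈ c.U := by
    rw [← Scheme.Hom.comp_apply, hproj, Scheme.Hom.comp_apply]
    exact c.isAffineOpen_U.range_fromSpec.le ⟨_, rfl⟩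
  obtain ⟨t, ht⟩ := projCotangentBundle.exists_mem_opensRange_piece q c hyc
  obtain ⟨s, z, φ, hz, hφ⟩ :=
    exists_localizationAway_SpecMap_comp_eq (projCotangentBundle.piece q c t) γ ht
  have hunit : IsUnit (φ (frac (ι_mem t) t₀)) := by
    refine H.isUnit_map_frac hF (hψ.comp_localizationAway s) (H.deriv_notMem_equations hF hγ ht) φ
      ?_ ?_
    · rw [hφ]
      exact hγ.trans (Scheme.Hom.le_ker_comp _ _)
    · rw [hφ, Category.assoc, hproj, Spec.map_comp, Category.assoc]
  have hγy : γ y = projCotangentBundle.piece q c t (Spec.map φ z) :=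
    (congrArg γ hz).symm.trans congr($hφ z).symm
  refine Set.mem_of_eq_of_mem hγy
    ((projCotangentBundle.piece_mem_opensRange_piece q c t t₀ _).mpr ?_)
  exact notMem_asIdeal_of_isUnit φ z hunit

lemma exists_SpecMap_comp_piece_eq (H : IsHypersurface q i) (hF : c.IsEquation i F)
    (hψ : c.IsAdapted F t₀ ψ) {γ : Spec C ⟶ projCotangentBundle q}
    (hγ : projConormalIdeal q i ≤ γ.ker)
    (hproj : γ ≫ projCotangentBundle.proj q = Spec.map ψ ≫ c.isAffineOpen_U.fromSpec) :
    ∃ φ : CommRingCat.of (Away c.symGrading (SymmetricAlgebra.ι Γ(W, c.U) c.Tangent t₀)) ⟶ C,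
      Spec.map φ ≫ projCotangentBundle.piece q c t₀ = γ :=
  exists_SpecMap_comp_eq _ _
    (Set.range_subset_iff.mpr fun y => H.mem_opensRange_piece hF hψ hγ hproj y)

lemma SpecMap_hom_ext (H : IsHypersurface q i) (hF : c.IsEquation i F)
    (hψ : c.IsAdapted F t₀ ψ) {γ γ' : Spec C ⟶ projCotangentBundle q}
    (hγ : projConormalIdeal q i ≤ γ.ker) (hγ' : projConormalIdeal q i ≤ γ'.ker)
    (hproj : γ ≫ projCotangentBundle.proj q = Spec.map ψ ≫ c.isAffineOpen_U.fromSpec)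
    (hproj' : γ' ≫ projCotangentBundle.proj q = Spec.map ψ ≫ c.isAffineOpen_U.fromSpec) :
    γ = γ' := by
  obtain ⟨φ, rfl⟩ := H.exists_SpecMap_comp_piece_eq hF hψ hγ hproj
  obtain ⟨φ', rfl⟩ := H.exists_SpecMap_comp_piece_eq hF hψ hγ' hproj'
  have hcomp := Chart.map_toAway_eq_of_comp_proj_eq hproj
  have hcomp' := Chart.map_toAway_eq_of_comp_proj_eq hproj'
  suffices φ = φ' by rw [this]
  rcases subsingleton_or_nontrivial C with hC | hC
  · ext
    exact Subsingleton.elim _ _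
  · have ht₀ := hψ.deriv_notMem_equations hF
    refine CommRingCat.hom_ext (away_ext (ι_mem t₀) (fun a => (hcomp a).trans (hcomp' a).symm)
      fun t => (mul_cancel_right_mem_nonZeroDivisors hψ.mem_nonZeroDivisors).mp ?_)
    exact (H.map_deriv_eq_mul hF ht₀ φ hγ hproj t).symm.trans
      (H.map_deriv_eq_mul hF ht₀ φ' hγ' hproj' t)

lemma exists_SpecMap_lift (H : IsHypersurface q i) (hF : c.IsEquation i F) [Nontrivial C]
    (hψ : c.IsAdapted F t₀ ψ) :
    ∃ γ : Spec C ⟶ projCotangentBundle q, projConormalIdeal q i ≤ γ.ker ∧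
      γ ≫ projCotangentBundle.proj q = Spec.map ψ ≫ c.isAffineOpen_U.fromSpec := by
  let := ψ.hom.toAlgebra
  have hnzd := hψ.mem_nonZeroDivisors
  obtain ⟨φ, hφ⟩ := exists_linearMap_eq_mul_of_dvd (c.differential F) hnzd hψ.dvd
  have hone : SymmetricAlgebra.lift φ (SymmetricAlgebra.ι Γ(W, c.U) c.Tangent t₀) = 1 := by
    rw [SymmetricAlgebra.lift_ι_apply]
    refine (mul_cancel_left_mem_nonZeroDivisors hnzd).mp ?_
    rw [mul_one]
    exact (hφ t₀).symm
  refine ⟨Spec.map (CommRingCat.ofHom (awayLift φ hone)) ≫ projCotangentBundle.piece q c t₀, ?_, ?_⟩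
  · rw [H.projConormalIdeal_le_ker_iff hF (hψ.deriv_notMem_equations hF)]
    intro k x hx hxI
    have hpow := pow_mul_awayLift (ι_mem t₀) φ hone hφ hx
    have hzero : algebraMap Γ(W, c.U) C (SymmetricAlgebra.lift (c.differential F) x) = 0 :=
      hψ.map_eq_zero_of_mem hF hxI
    rw [hzero] at hpow
    exact (mul_right_mem_nonZeroDivisors_eq_zero_iff (pow_mem hnzd k)).mp
      ((mul_comm _ _).trans hpow)
  · rw [Category.assoc, projCotangentBundle.piece_proj, ← Category.assoc, ← Spec.map_comp]
    congr 2
    ext r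
    exact awayLift_toAway φ hone r

end IsHypersurface

end UniversalProperty

/-! ### The blowup of the relative singular scheme -/

section Blowup

open SymProj

lemma exists_eq_mul_of_span_range_eq {R ι : Type*} [CommRing R] {b : ι → R} {f : R}
    (hf : f ∈ nonZeroDivisors R) (h : Ideal.span (Set.range b) = Ideal.span {f}) (P : Ideal R)
    [P.IsPrime] : ∃ (t : ι) (a : R), a ∉ P ∧ b t = a * f := by
  have hdvd (t : ι) : ∃ a, a * f = b t := by
    rw [← Ideal.mem_span_singleton', ← h]
    exact Ideal.subset_span ⟨t, rfl⟩
  choose a ha using hdvd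
  by_contra! hcon
  have hP (t : ι) : a t ∈ P := by
    by_contra hP
    exact hcon t (a t) hP (ha t).symm
  have hle : Ideal.span (Set.range b) ≤ P * Ideal.span {f} := by
    rw [Ideal.span_le]
    rintro _ ⟨t, rfl⟩
    exact Ideal.mem_mul_span_singleton.mpr ⟨a t, hP t, ha t⟩
  obtain ⟨p, hp, hpf⟩ := Ideal.mem_mul_span_singleton.mp (hle (h ▸ Ideal.mem_span_singleton_self f))
  have hone : p = 1 := (mul_cancel_right_mem_nonZeroDivisors hf).mp (by rw [hpf, one_mul])
  exact Ideal.IsPrime.ne_top ‹_› ((Ideal.eq_top_iff_one _).mpr (hone ▸ hp))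

lemma exists_comp_eq_of_locally {T Y Z : Scheme.{u}} {π : Y ⟶ Z} {f : T ⟶ Z}
    (hunique : ∀ {U : Scheme.{u}} (j : U ⟶ T) [IsOpenImmersion j] {h h' : U ⟶ Y},
      h ≫ π = j ≫ f → h' ≫ π = j ≫ f → h = h')
    (hlocal : ∀ x : T, ∃ (V : T.Opens) (h : V.toScheme ⟶ Y), x ∈ V ∧ h ≫ π = V.ι ≫ f) :
    ∃ h : T ⟶ Y, h ≫ π = f := by
  choose V h hxV hh using hlocal
  have hcover : TopologicalSpace.IsOpenCover V :=
    top_unique fun x _ => TopologicalSpace.Opens.mem_iSup.mpr ⟨x, hxV x⟩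
  have hcompat (x y : T) :
      pullback.fst (V x).ι (V y).ι ≫ h x = pullback.snd (V x).ι (V y).ι ≫ h y :=
    hunique (pullback.fst (V x).ι (V y).ι ≫ (V x).ι) (by rw [Category.assoc, hh, Category.assoc])
      (by rw [pullback.condition, Category.assoc, hh, Category.assoc])
  let 𝒰 : T.OpenCover := T.openCoverOfIsOpenCover V hcover
  have hglue (x : T) : (V x).ι ≫ 𝒰.glueMorphisms h hcompat = h x :=
    𝒰.ι_glueMorphisms h hcompat x
  refine ⟨𝒰.glueMorphisms h hcompat, 𝒰.hom_ext _ _ fun x => ?_⟩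
  exact (reassoc_of% hglue x) π |>.trans (hh x)

variable {W S X : Scheme.{u}} {q : W ⟶ S} {i : X ⟶ W} {c : Chart q} {F : Γ(W, c.U)}

variable [Smooth q]

instance : IsClosedImmersion (projConormal.ι q i) :=
  inferInstanceAs (IsClosedImmersion (projConormalIdeal q i).subschemeι)

lemma projConormal.ker_ι : (projConormal.ι q i).ker = projConormalIdeal q i :=
  Scheme.IdealSheafData.ker_subschemeι _

lemma projConormalIdeal_le_ker_comp {T : Scheme.{u}} (h : T ⟶ projConormal q i) :
    projConormalIdeal q i ≤ (h ≫ projConormal.ι q i).ker :=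
  projConormal.ker_ι.ge.trans (Scheme.Hom.le_ker_comp _ _)

variable [IsIntegral X]

namespace Chart.IsEquation

omit [Smooth q] in
lemma map_singIdeal_eq_span (hF : c.IsEquation i F) {C : CommRingCat.{u}} (ψ : Γ(W, c.U) ⟶ C)
    (h : ψ F = 0) :
    (c.singIdeal i).map ψ.hom = Ideal.span (Set.range fun t => ψ (c.deriv t F)) := by
  refine le_antisymm ?_ (Ideal.span_le.mpr ?_)
  · refine Ideal.map_le_iff_le_comap.mpr (c.singIdeal_le_iff.mpr fun G hG => ?_)
    rw [hF.equations_eq, Ideal.mem_span_singleton'] at hG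
    obtain ⟨g, rfl⟩ := hG
    simp only [Ideal.mem_comap]
    refine ⟨?_, fun t => ?_⟩
    · have hzero : ψ (g * F) = 0 := by rw [map_mul, h, mul_zero]
      exact (congrArg (· ∈ Ideal.span (Set.range fun t => ψ (c.deriv t F))) hzero).mpr (zero_mem _)
    · have hmul : ψ (c.deriv t (g * F)) = ψ g * ψ (c.deriv t F) := by
        rw [deriv_mul, map_add, map_mul, map_mul, h, zero_mul, add_zero]
      exact (congrArg (· ∈ Ideal.span (Set.range fun t => ψ (c.deriv t F))) hmul).mpr
        (Ideal.mul_mem_left _ _ (Ideal.subset_span ⟨t, rfl⟩))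
  · rintro _ ⟨t, rfl⟩
    exact Ideal.mem_map_of_mem _ (c.deriv_mem_singIdeal t hF.self_mem)

omit [Smooth q] in
lemma appLE_comp_eq_zero (hF : c.IsEquation i F) {T : Scheme.{u}} (g : T ⟶ X) {V : T.Opens}
    (h : V ≤ (g ≫ i) ⁻¹ᵁ c.U) : (g ≫ i).appLE c.U V h F = 0 := by
  have hzero : i.app c.U F = 0 := i.ideal_ker_le ⟨c.U, c.isAffineOpen_U⟩ hF.self_mem
  rw [Scheme.Hom.comp_appLE, CategoryTheory.comp_apply, hzero, map_zero]

lemma ideal_comap_relSingIdeal [CompactSpace W] [QuasiSeparatedSpace W]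
    (hF : c.IsEquation i F) {T : Scheme.{u}} (g : T ⟶ X) (V : T.affineOpens)
    (h : V.1 ≤ (g ≫ i) ⁻¹ᵁ c.U) :
    ((relSingIdeal q i).comap (g ≫ i)).ideal V =
      Ideal.span (Set.range fun t => (g ≫ i).appLE c.U V.1 h (c.deriv t F)) := by
  rw [ideal_comap (g ≫ i) (relSingIdeal q i) ⟨c.U, c.isAffineOpen_U⟩ V h, relSingIdeal_ideal]
  exact hF.map_singIdeal_eq_span _ (hF.appLE_comp_eq_zero g h)

end Chart.IsEquation

variable [IsClosedImmersion i] [IsIntegral W]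

lemma Chart.IsEquation.proj_chart_point (hF : c.IsEquation i F)
    (hgen : genericPoint X ∈ smoothLocus (i ≫ q)) :
    projCotangentBundle.proj q (projCotangentBundle.chart q c (hF.point hgen)) =
      i (genericPoint X) := by
  obtain ⟨t, ht⟩ := hF.exists_deriv_notMem hgen
  obtain ⟨y, hy, hy'⟩ := projCotangentBundle.exists_piece_eq q c t (hF.point hgen)
    fun h => ht ((ι_mem_coneIdeal (c.differential F) (c.equations i) t).mp h)
  refine (congrArg (projCotangentBundle.proj q) hy.symm).trans
    (congr($(projCotangentBundle.piece_proj q c t) y).trans ?_)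
  refine fromSpec_eq_of_forall_mem_asIdeal_iff c.isAffineOpen_U hF.mem fun f => ?_
  have hf : algebraMap Γ(W, c.U) (SymmetricAlgebra Γ(W, c.U) c.Tangent) f ∈
      c.symGrading (0 • 1) := by
    rw [zero_smul]
    exact SetLike.algebraMap_mem_graded (grading Γ(W, c.U) c.Tangent) f
  have htoAway : toAway c.Tangent _ f ∈ y.asIdeal ↔ _ :=
    iff_of_eq (congrArg (· ∈ y.asIdeal) (mk_zero_algebraMap (ι_mem t) f hf).symm)
  exact htoAway.trans ((hy' 0 _ hf).trans
    ((algebraMap_mem_coneIdeal (c.differential F) (c.equations i) f).trans (c.mem_equations_iff f)))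

namespace IsHypersurface

lemma isIntegral_projConormal (H : IsHypersurface q i) : IsIntegral (projConormal q i) := by
  obtain ⟨c, F, -, hF⟩ := H.exists_isEquation (genericPoint X)
  exact (congrArg (fun J : (projCotangentBundle q).IdealSheafData => IsIntegral J.subscheme)
    (H.projConormalIdeal_eq hF)).mpr (isIntegral_subscheme_vanishingIdeal_closure_singleton _)

lemma exists_forall_specializes (H : IsHypersurface q i) :
    ∃ η : projConormal q i, (∀ z, η ⤳ z) ∧
      projCotangentBundle.proj q (projConormal.ι q i η) = i (genericPoint X) := by
  obtain ⟨c, F, -, hF⟩ := H.exists_isEquation (genericPoint X)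
  have hrange : Set.range (projConormal.ι q i) =
      closure {projCotangentBundle.chart q c (hF.point H.generically_smooth)} :=
    (Scheme.IdealSheafData.range_subschemeι _).trans (congrArg
      (fun J : (projCotangentBundle q).IdealSheafData => (J.support : Set (projCotangentBundle q)))
      (H.projConormalIdeal_eq hF))
  obtain ⟨η, hη⟩ := hrange.ge (subset_closure rfl)
  refine ⟨η, fun z => ?_, by rw [hη, hF.proj_chart_point]⟩
  refine (projConormal.ι q i).isClosedEmbedding.isInducing.specializes_iff.mp ?_
  rw [hη]
  exact specializes_iff_mem_closure.mpr (hrange.le ⟨z, rfl⟩)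

lemma exists_comp_eq (H : IsHypersurface q i) :
    ∃ p : projConormal q i ⟶ X, p ≫ i = projConormal.ι q i ≫ projCotangentBundle.proj q := by
  have := H.isIntegral_projConormal
  obtain ⟨η, hη, hproj⟩ := H.exists_forall_specializes
  have h : i.ker ≤ (projConormal.ι q i ≫ projCotangentBundle.proj q).ker := by
    refine le_ker_of_range_subset_support ?_
    rw [Scheme.Hom.support_ker]
    rintro _ ⟨z, rfl⟩
    have hspec := (hη z).map (projConormal.ι q i ≫ projCotangentBundle.proj q).continuous
    rw [Scheme.Hom.comp_apply, hproj] at hspec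
    exact closure_mono (Set.singleton_subset_iff.mpr (Set.mem_range_self _)) hspec.mem_closure
  exact ⟨IsClosedImmersion.lift i _ h, IsClosedImmersion.lift_fac _ _ _⟩

lemma appLE_ne_zero (H : IsHypersurface q i) {p : projConormal q i ⟶ X}
    (hp : p ≫ i = projConormal.ι q i ≫ projCotangentBundle.proj q) {V : (projConormal q i).Opens}
    [Nonempty V] (hV : V ≤ (p ≫ i) ⁻¹ᵁ c.U) {G : Γ(W, c.U)} (hG : G ∉ c.equations i) :
    (p ≫ i).appLE c.U V hV G ≠ 0 := fun hzero => by
  obtain ⟨z, hz⟩ := ‹Nonempty V›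
  obtain ⟨η, hη, hproj⟩ := H.exists_forall_specializes
  have hmem : η ∈ (projConormal q i).basicOpen ((p ≫ i).appLE c.U V hV G) := by
    have hgen : (p ≫ i) η = i (genericPoint X) := congr($hp η).trans hproj
    have hηV := (hη z).mem_open V.2 hz
    rw [Scheme.basicOpen_appLE]
    refine ⟨hηV, Set.mem_of_eq_of_mem (s := (W.basicOpen G : Set W)) hgen ?_⟩
    exact (c.genericPoint_mem_basicOpen_iff G).mpr hG
  rw [hzero, Scheme.basicOpen_zero] at hmem
  exact hmem

variable [CompactSpace W] [QuasiSeparatedSpace W]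

lemma ideal_comap_relSingIdeal_eq_span_singleton (H : IsHypersurface q i) (hF : c.IsEquation i F)
    {p : projConormal q i ⟶ X} (hp : p ≫ i = projConormal.ι q i ≫ projCotangentBundle.proj q)
    (V : (projConormal q i).affineOpens) (hV : V.1 ≤ (p ≫ i) ⁻¹ᵁ c.U) {t : c.Tangent}
    (hVt : V.1 ≤ projConormal.ι q i ⁻¹ᵁ (projCotangentBundle.piece q c t).opensRange)
    (ht : c.deriv t F ∉ c.equations i) :
    ((relSingIdeal q i).comap (p ≫ i)).ideal V =
      Ideal.span {(p ≫ i).appLE c.U V.1 hV (c.deriv t F)} := by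
  obtain ⟨φ, hφ⟩ := exists_SpecMap_comp_eq (projCotangentBundle.piece q c t)
    (V.2.fromSpec ≫ projConormal.ι q i) (Set.range_subset_iff.mpr fun y =>
      hVt (V.2.range_fromSpec.le ⟨y, rfl⟩))
  have hker : projConormalIdeal q i ≤ (Spec.map φ ≫ projCotangentBundle.piece q c t).ker := by
    rw [hφ]
    exact projConormalIdeal_le_ker_comp _
  have hmul := H.map_deriv_eq_mul (ψ := (p ≫ i).appLE c.U V.1 hV) hF ht φ hker (by
    rw [hφ, c.isAffineOpen_U.SpecMap_appLE_fromSpec (p ≫ i) V.2 hV, hp, Category.assoc])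
  rw [hF.ideal_comap_relSingIdeal p V hV]
  refine le_antisymm (Ideal.span_le.mpr ?_) ?_
  · rintro _ ⟨t', rfl⟩
    exact Ideal.mem_span_singleton'.mpr ⟨_, (hmul t').symm⟩
  · rw [Ideal.span_singleton_le_iff_mem]
    exact Ideal.subset_span ⟨t, rfl⟩

lemma isInvertibleIdeal_comap (H : IsHypersurface q i) {p : projConormal q i ⟶ X}
    (hp : p ≫ i = projConormal.ι q i ≫ projCotangentBundle.proj q) :
    IsInvertibleIdeal ((relSingIdeal q i).comap (p ≫ i)) := by
  intro z
  have := H.isIntegral_projConormal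
  obtain ⟨c, F, hzc, hF⟩ := H.exists_isEquation (p z)
  obtain ⟨t, ht⟩ := projCotangentBundle.exists_mem_opensRange_piece q c
    (Set.mem_of_eq_of_mem congr($hp z).symm hzc)
  have htF := H.deriv_notMem_equations hF projConormal.ker_ι.ge ht
  let O : (projConormal q i).Opens :=
    projConormal.ι q i ⁻¹ᵁ (projCotangentBundle.piece q c t).opensRange ⊓ (p ≫ i) ⁻¹ᵁ c.U
  obtain ⟨_, ⟨V, hVaffine, rfl⟩, hzV, hVO⟩ :=
    (projConormal q i).isBasis_affineOpens.exists_subset_of_mem_open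
      (show z ∈ (O : Set (projConormal q i)) from ⟨ht, hzc⟩) O.2
  have hV : V ≤ (p ≫ i) ⁻¹ᵁ c.U := fun x hx => (hVO hx).2
  have : Nonempty V := ⟨⟨z, hzV⟩⟩
  exact ⟨⟨V, hVaffine⟩, hzV, (p ≫ i).appLE c.U V hV (c.deriv t F),
    mem_nonZeroDivisors_of_ne_zero (H.appLE_ne_zero hp hV htF),
    H.ideal_comap_relSingIdeal_eq_span_singleton hF hp ⟨V, hVaffine⟩ hV
      (fun x hx => (hVO hx).1) htF⟩

variable {T : Scheme.{u}} (g : T ⟶ X)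

omit [IsClosedImmersion i] [IsIntegral W] in
lemma exists_isAdapted (H : IsHypersurface q i)
    (hg : IsInvertibleIdeal ((relSingIdeal q i).comap (g ≫ i))) (x : T) :
    ∃ (V : T.affineOpens) (c : Chart q) (F : Γ(W, c.U)) (h : V.1 ≤ (g ≫ i) ⁻¹ᵁ c.U)
      (t₀ : c.Tangent), x ∈ V.1 ∧ c.IsEquation i F ∧
        c.IsAdapted F t₀ ((g ≫ i).appLE c.U V.1 h) := by
  obtain ⟨c, F, hxc, hF⟩ := H.exists_isEquation (g x)
  obtain ⟨V, hxV, hV, f, hf, hspan⟩ := hg.exists_le (x := x) (O := (g ≫ i) ⁻¹ᵁ c.U) hxc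
  rw [hF.ideal_comap_relSingIdeal g V hV] at hspan
  have hVaffine : IsAffineOpen V.1 := V.2
  obtain ⟨t₀, a, haP, ha⟩ := exists_eq_mul_of_span_range_eq hf hspan
    (hVaffine.primeIdealOf ⟨x, hxV⟩).asIdeal
  rw [mem_primeIdealOf_iff, not_not] at haP
  have hle : (T.affineBasicOpen a).1 ≤ V.1 := T.basicOpen_le a
  let res := T.presheaf.map (homOfLE hle).op
  have hres (r) : (g ≫ i).appLE c.U (T.affineBasicOpen a).1 (hle.trans hV) r =
      res ((g ≫ i).appLE c.U V.1 hV r) := by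
    rw [← CategoryTheory.comp_apply, Scheme.Hom.appLE_map]
  have hunit : IsUnit (res a) := RingedSpace.isUnit_res_basicOpen T.toRingedSpace a
  have hresf : res f ∈ nonZeroDivisors Γ(T, T.basicOpen a) := by
    have := hVaffine.isLocalization_basicOpen a
    exact IsLocalization.map_nonZeroDivisors_le (.powers a) Γ(T, T.basicOpen a) ⟨f, hf, rfl⟩
  have hderiv : (g ≫ i).appLE c.U (T.affineBasicOpen a).1 (hle.trans hV) (c.deriv t₀ F) =
      res a * res f := by
    rw [hres, ← map_mul]
    exact congrArg _ ha
  refine ⟨T.affineBasicOpen a, c, F, hle.trans hV, t₀, haP, hF,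
    hF.appLE_comp_eq_zero g _, ?_, fun t => ?_⟩
  · rw [hderiv]
    exact mul_mem hunit.mem_nonZeroDivisors hresf
  · rw [hderiv, hunit.mul_left_dvd, hres]
    refine map_dvd res.hom ?_
    rw [← Ideal.mem_span_singleton, ← hspan]
    exact Ideal.subset_span ⟨t, rfl⟩

variable {g}

lemma lift_unique (H : IsHypersurface q i)
    (hg : IsInvertibleIdeal ((relSingIdeal q i).comap (g ≫ i))) {h h' : T ⟶ projConormal q i}
    (hh : h ≫ projConormal.ι q i ≫ projCotangentBundle.proj q = g ≫ i)
    (hh' : h' ≫ projConormal.ι q i ≫ projCotangentBundle.proj q = g ≫ i) : h = h' := by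
  refine Scheme.hom_ext_of_forall h h' fun x => ?_
  obtain ⟨V, c, F, hV, t₀, hxV, hF, hψ⟩ := H.exists_isAdapted g hg x
  refine ⟨V.1, hxV, ?_⟩
  have hproj {k : T ⟶ projConormal q i}
      (hk : k ≫ projConormal.ι q i ≫ projCotangentBundle.proj q = g ≫ i) :
      ((V.2.fromSpec ≫ k) ≫ projConormal.ι q i) ≫ projCotangentBundle.proj q =
        Spec.map ((g ≫ i).appLE c.U V.1 hV) ≫ c.isAffineOpen_U.fromSpec := by
    rw [Category.assoc, Category.assoc, hk, c.isAffineOpen_U.SpecMap_appLE_fromSpec (g ≫ i) V.2 hV]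
  have heq : V.2.fromSpec ≫ h = V.2.fromSpec ≫ h' :=
    (cancel_mono (projConormal.ι q i)).mp (H.SpecMap_hom_ext hF hψ
      (projConormalIdeal_le_ker_comp _) (projConormalIdeal_le_ker_comp _) (hproj hh) (hproj hh'))
  rw [← V.2.isoSpec_hom_fromSpec, Category.assoc, Category.assoc, heq]

lemma exists_local_lift (H : IsHypersurface q i)
    (hg : IsInvertibleIdeal ((relSingIdeal q i).comap (g ≫ i))) (x : T) :
    ∃ (V : T.Opens) (h : V.toScheme ⟶ projConormal q i), x ∈ V ∧
      h ≫ projConormal.ι q i ≫ projCotangentBundle.proj q = V.ι ≫ g ≫ i := by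
  obtain ⟨V, c, F, hV, t₀, hxV, hF, hψ⟩ := H.exists_isAdapted g hg x
  have : Nonempty V.1 := ⟨⟨x, hxV⟩⟩
  obtain ⟨γ, hγ, hproj⟩ := H.exists_SpecMap_lift hF hψ
  refine ⟨V.1, V.2.isoSpec.hom ≫ IsClosedImmersion.lift (projConormal.ι q i) γ
    (projConormal.ker_ι.le.trans hγ), hxV, ?_⟩
  rw [Category.assoc, IsClosedImmersion.lift_fac_assoc, hproj,
    c.isAffineOpen_U.SpecMap_appLE_fromSpec (g ≫ i) V.2 hV, V.2.isoSpec_hom_fromSpec_assoc]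

lemma exists_lift (H : IsHypersurface q i)
    (hg : IsInvertibleIdeal ((relSingIdeal q i).comap (g ≫ i))) :
    ∃ h : T ⟶ projConormal q i,
      h ≫ projConormal.ι q i ≫ projCotangentBundle.proj q = g ≫ i :=
  exists_comp_eq_of_locally
    (fun j _ _ _ hh hh' => H.lift_unique (g := j ≫ g)
      (by
        rw [Category.assoc, Scheme.IdealSheafData.comap_comp]
        exact hg.comap_of_isOpenImmersion j)
      (hh.trans (Category.assoc _ _ _).symm) (hh'.trans (Category.assoc _ _ _).symm))
    (H.exists_local_lift hg)

omit [QuasiSeparatedSpace W] in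
lemma of_coheight_eq_one {k : Type u} [Field k] [IsAlgClosed k] (σ : W ⟶ Spec (.of k)) [Smooth σ]
    (hgen : genericPoint X ∈ smoothLocus (i ≫ q))
    (hcodim : Order.coheight (i (genericPoint X)) = 1) : IsHypersurface q i where
  generically_smooth := hgen
  exists_isEquation x := by
    obtain ⟨c, hxc, F, hF, hspan⟩ := Chart.exists_equations_eq_span q σ hcodim x
    exact ⟨c, F, hxc, hspan, hF, genericPoint_mem hxc⟩

lemma exists_isBlowup (H : IsHypersurface q i) :
    ∃ p : projConormal q i ⟶ X,
      p ≫ i = projConormal.ι q i ≫ projCotangentBundle.proj q ∧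
      IsBlowup p ((relSingIdeal q i).comap i) := by
  obtain ⟨p, hp⟩ := H.exists_comp_eq
  refine ⟨p, hp, ?_, fun T g hg => ?_⟩
  · rw [← Scheme.IdealSheafData.comap_comp]
    exact H.isInvertibleIdeal_comap hp
  · rw [← Scheme.IdealSheafData.comap_comp] at hg
    have hiff (h : T ⟶ projConormal q i) : h ≫ p = g ↔
        h ≫ projConormal.ι q i ≫ projCotangentBundle.proj q = g ≫ i := by
      rw [← hp, ← Category.assoc, cancel_mono]
    obtain ⟨h, hh⟩ := H.exists_lift hg
    exact ⟨h, (hiff h).mpr hh, fun h' hh' => H.lift_unique hg ((hiff h').mp hh') hh⟩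

end IsHypersurface

end Blowup

end RelConormal

end

theorem mainTheorem11_general {k : Type u} [Field k] [IsAlgClosed k] {S W X : Scheme.{u}}
    (σ : W ⟶ Spec (.of k)) (q : W ⟶ S) (i : X ⟶ W)
    [Smooth σ] [Smooth q] [IsIntegral W] [CompactSpace W] [QuasiSeparatedSpace W]
    [IsIntegral X] [IsClosedImmersion i] (hgen : genericPoint X ∈ RelConormal.smoothLocus (i ≫ q))
    (hcodim : Order.coheight (i (genericPoint X)) = 1) :
    ∃ p : RelConormal.projConormal q i ⟶ X,
      p ≫ i = RelConormal.projConormal.ι q i ≫ RelConormal.projCotangentBundle.proj q ∧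
      RelConormal.IsBlowup p ((RelConormal.relSingIdeal q i).comap i) :=
  (RelConormal.IsHypersurface.of_coheight_eq_one σ hgen hcodim).exists_isBlowup

theorem mainTheorem11 {S W X : Scheme.{0}} (s : S ⟶ Spec (.of ℂ)) (q : W ⟶ S) (i : X ⟶ W)
    [IsIntegral S] [IsSeparated s] [QuasiCompact s]
    (hS : IsIso s ∨ SmoothOfRelativeDimension 1 s)
    [IsIntegral W] [IsSeparated q] [QuasiCompact q] [Smooth q] [IsDominant q]
    [IsIntegral X] [IsClosedImmersion i] [Flat (i ≫ q)]
    (hcodim : Order.coheight (i (genericPoint X)) = 1) :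
    ∃ p : RelConormal.projConormal q i ⟶ X,
      p ≫ i = RelConormal.projConormal.ι q i ≫ RelConormal.projCotangentBundle.proj q ∧
      RelConormal.IsBlowup p ((RelConormal.relSingIdeal q i).comap i) := by
  have : Smooth s := by
    rcases hS with h | h
    · infer_instance
    · exact h.smooth
  have : IsLocallyNoetherian S := LocallyOfFiniteType.isLocallyNoetherian s
  have : CompactSpace W := QuasiCompact.compactSpace_of_compactSpace (q ≫ s)
  have : QuasiSeparatedSpace W := quasiSeparatedSpace_of_quasiSeparated (q ≫ s)
  have : LocallyOfFinitePresentation (i ≫ q) :=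
    LocallyOfFinitePresentation.iff_locallyOfFiniteType.mpr inferInstance
  exact mainTheorem11_general (q ≫ s) q i
    (RelConormal.genericPoint_mem_smoothLocus s (i ≫ q)) hcodim
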